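/- Let $\mathbb T^d=(\mathbb R/2\pi\mathbb Z)^d$ with the flat metric $\delta$ inherited from the Euclidean metric of $\mathbb R^d$, and identify every tangent space with $\mathbb R^d$. For $0<\beta<1$ and $f:\mathbb T^d\to\mathbb R^m$ put $\|f\|_\beta=\sup_\psi\|f(\psi)\|+\sup_{\psi\neq\psi'}\|f(\psi)-f(\psi')\|/\delta(\psi,\psi')^\beta$; $f$ is $\beta$-Hölder if $\|f\|_\beta<\infty$. Let $A_0:\mathbb T^d\to\mathbb T^d$ be a real analytic Anosov diffeomorphism: $A_0$ and $A_0^{-1}$ are real analytic, $A_0$ has a dense orbit $\{A_0^m\psi\}_{m\in\mathbb Z}$, and there is a continuous $DA_0$-invariant splitting $\mathbb R^d=W^s(\psi)\oplus W^u(\psi)$ into subspaces of constant dimension, with constants $\Theta>0$, $0<\lambda<1$ such that, for all $n\ge 0$, $\|DA_0^n w\|\le\Theta\lambda^n\|w\|$ for $w\in W^s(\psi)$ and $\|DA_0^{-n}w\|\le\Theta\lambda^n\|w\|$ for $w\in W^u(\psi)$. Let $F:\mathbb T^d\to\mathbb R^d$ be real analytic and $A_\varepsilon(\psi)=A_0(\psi)+\varepsilon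 F(\psi) \bmod 2\pi$. Assume that there are $\beta_0\in(0,1)$, $\beta_0$-Hölder vector fields $\mathbf v_1,\dots,\mathbf v_d$ that form a basis of $\mathbb R^d$ at every point of $\mathbb T^d$, and $\beta_0$-Hölder functions $\Lambda_1,\dots,\Lambda_d:\mathbb T^d\to\mathbb R$ with $$DA_0(\psi)\mathbf v_i(\psi)=\Lambda_i(\psi)\,\mathbf v_i(A_0\psi),$$ and that, with $\Lambda_i^{[n]}(\psi)=\prod_{j=0}^{n-1}\Lambda_i(A_0^j\psi)$, there is $N_0$ such that for all $n>N_0$ and $i=1,\dots,d-1$ $$\|\Lambda_i^{[n]}\|_\infty\,\|(\Lambda_{i+1}^{[n]})^{-1}\|_\infty<1 .$$ Call a family $f_\varepsilon$ of functions on $\mathbb T^d$ analytic in $\varepsilon$ and $\beta$-Hölder in $\psi$ for $|\varepsilon|<\bar\varepsilon$ if $f_\varepsilon(\psi)=\sum_{n\ge0}\varepsilon^n a_n(\psi)$ for $|\varepsilon|<\bar\varepsilon$, where $\|a_n\|_\beta\le KC^n$ for all $n$ with constants $K,C\ge 0$ such that $C\bar\varepsilon\le1$. Then there are maps $H_\varepsilon:\mathbb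 T^d\to\mathbb T^d$ of the form $H_\varepsilon(\psi)=\psi+h_\varepsilon(\psi) \bmod 2\pi$, with $h_\varepsilon:\mathbb T^d\to\mathbb R^d$ and $h_0=0$, and there is $\bar\beta>0$ such that for every $\beta\in(0,\bar\beta)$ there is $\bar\varepsilon=\bar\varepsilon(\beta)>0$ for which the following holds. 1. The family $h_\varepsilon$ is analytic in $\varepsilon$ and $\beta$-Hölder in $\psi$ for $|\varepsilon|<\bar\varepsilon$, and for these $\varepsilon$ the map $H_\varepsilon$ is a homeomorphism with $H_\varepsilon\circ A_0=A_\varepsilon\circ H_\varepsilon$. 2. There are vector fields $\mathbf v_{i,\varepsilon}:\mathbb T^d\to\mathbb R^d$ and functions $L_{i,\varepsilon}:\mathbb T^d\to\mathbb R$, $i=1,\dots,d$, analytic in $\varepsilon$ and $\beta$-Hölder in $\psi$ for $|\varepsilon|<\bar\varepsilon$, with $\mathbf v_{i,0}=\mathbf v_i$ and $L_{i,0}=\Lambda_i$, such that for all $|\varepsilon|<\bar\varepsilon$ and all $\psi\in\mathbb T^d$ the vectors $\mathbf v_{1,\varepsilon}(\psi),\dots,\mathbf v_{d,\varepsilon}(\psi)$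 are linearly independent and $$DA_\varepsilon(H_\varepsilon(\psi))\,\mathbf v_{i,\varepsilon}(\psi)=L_{i,\varepsilon}(\psi)\,\mathbf v_{i,\varepsilon}(A_0\psi),\qquad i=1,\dots,d.$$ -/

import Mathlib

open scoped NNReal ENNReal

noncomputable section

namespace ToralAnosov

/-- `ℝ^d` with the Euclidean norm; it is also the tangent space of the torus at every point. -/
abbrev E (d : ℕ) : Type := EuclideanSpace ℝ (Fin d)

/-- The torus `(ℝ / 2πℤ)^d` with the flat metric inherited from the Euclidean metric of `ℝ^d`. -/
abbrev Torus (d : ℕ) : Type := PiLp 2 (fun _ : Fin d => AddCircle (2 * Real.pi))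

instance two_pi_pos_fact : Fact (0 < 2 * Real.pi) := ⟨Real.two_pi_pos⟩

variable {d : ℕ}

/-- The covering projection `ℝ^d → T^d`, i.e. reduction mod `2π`. -/
def proj (x : E d) : Torus d := WithLp.toLp 2 (fun i => (x i : AddCircle (2 * Real.pi)))

/-- The representative in `(-π, π]^d` of a point of the torus. -/
def rep (ψ : Torus d) : E d :=
  WithLp.toLp 2 (fun i => (AddCircle.equivIoc (2 * Real.pi) (-Real.pi) (ψ i) : ℝ))

/-- The differential at `ψ` of a map of the torus, computed in the chart `u ↦ ψ + u` around `ψ`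
and the chart `w ↦ f ψ + w` around `f ψ`. -/
def tderiv (f : Torus d → Torus d) (ψ : Torus d) : E d →L[ℝ] E d :=
  fderiv ℝ (fun u : E d => rep (f (ψ + proj u) - f ψ)) 0

/-- A real analytic map `T^d → T^d`: it is induced by a real analytic map `ℝ^d → ℝ^d`. -/
def IsAnalyticMap (f : Torus d → Torus d) : Prop :=
  ∃ g : E d → E d, AnalyticOnNhd ℝ g Set.univ ∧ ∀ x, proj (g x) = f (proj x)

/-- A real analytic function `T^d → ℝ^d`: its `2πℤ^d`-periodic lift is real analytic. -/
def IsAnalyticField (F : Torus d → E d) : Prop :=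
  AnalyticOnNhd ℝ (fun x : E d => F (proj x)) Set.univ

/-- A family of subspaces that depends continuously on the point. -/
def ContinuousSubspaces (W : Torus d → Submodule ℝ (E d)) : Prop :=
  Continuous fun ψ => (W ψ).starProjection

/-- The data of an Anosov splitting: `Ws` and `Wu` are complementary, of constant dimension,
continuous, invariant, and uniformly contracted in the future, resp. in the past. -/
structure IsHyperbolicSplitting (A : Equiv.Perm (Torus d))
    (Ws Wu : Torus d → Submodule ℝ (E d)) : Prop where
  isCompl : ∀ ψ, IsCompl (Ws ψ) (Wu ψ)
  dim_const : ∃ ds du : ℕ, ∀ ψ, Module.finrank ℝ (Ws ψ) = ds ∧ Module.finrank ℝ (Wu ψ) = du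
  invariant_s : ∀ ψ, (Ws ψ).map (tderiv A ψ).toLinearMap = Ws (A ψ)
  invariant_u : ∀ ψ, (Wu ψ).map (tderiv A ψ).toLinearMap = Wu (A ψ)
  continuous_s : ContinuousSubspaces Ws
  continuous_u : ContinuousSubspaces Wu
  hyperbolic : ∃ Θ l : ℝ, 0 < Θ ∧ 0 < l ∧ l < 1 ∧ ∀ (n : ℕ) (ψ : Torus d),
    (∀ w ∈ Ws ψ, ‖tderiv (A ^ n : Equiv.Perm (Torus d)) ψ w‖ ≤ Θ * l ^ n * ‖w‖) ∧
    (∀ w ∈ Wu ψ, ‖tderiv ((A⁻¹) ^ n : Equiv.Perm (Torus d)) ψ w‖ ≤ Θ * l ^ n * ‖w‖)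

/-- A real analytic Anosov diffeomorphism of the torus with a dense orbit. -/
structure IsAnalyticAnosov (A : Equiv.Perm (Torus d)) : Prop where
  analytic : IsAnalyticMap A
  analytic_symm : IsAnalyticMap A.symm
  dense_orbit : ∃ ψ, Dense (Set.range fun m : ℤ => (A ^ m : Equiv.Perm (Torus d)) ψ)
  splitting : ∃ Ws Wu, IsHyperbolicSplitting A Ws Wu

/-- The perturbed map `A_ε = A₀ + ε F mod 2π`. -/
def perturbed (A : Equiv.Perm (Torus d)) (F : Torus d → E d) (ε : ℝ) (ψ : Torus d) : Torus d :=
  A ψ + proj (ε • F ψ)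

/-- The sup norm, with values in `[0, ∞]`. -/
def supNorm {V : Type*} [NormedAddCommGroup V] (f : Torus d → V) : ℝ≥0∞ := ⨆ ψ, ‖f ψ‖ₑ

/-- The Hölder norm `‖f‖_β = ‖f‖_∞ + |f|_β`, with values in `[0, ∞]`. -/
def holderNorm {V : Type*} [NormedAddCommGroup V] (β : ℝ≥0) (f : Torus d → V) : ℝ≥0∞ :=
  supNorm f + eHolderNorm β f

/-- `f` is `β`-Hölder continuous. -/
def IsHolder {V : Type*} [NormedAddCommGroup V] (β : ℝ≥0) (f : Torus d → V) : Prop :=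
  holderNorm β f < ∞

/-- The cocycle product `Λ^{[n]}(ψ) = ∏_{j<n} Λ(A^j ψ)`. -/
def cocycle (A : Equiv.Perm (Torus d)) (Λ : Torus d → ℝ) (n : ℕ) (ψ : Torus d) : ℝ :=
  ∏ j ∈ Finset.range n, Λ ((A ^ j : Equiv.Perm (Torus d)) ψ)

/-- The domination condition: from some time on, the rate of the `i`-th direction is strictly
smaller than that of the next one. -/
def IsDominated (A : Equiv.Perm (Torus d)) (Λ : Fin d → Torus d → ℝ) : Prop :=
  ∃ N₀ : ℕ, ∀ n > N₀, ∀ i j : Fin d, (i : ℕ) + 1 = j →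
    supNorm (cocycle A (Λ i) n) * supNorm (fun ψ => (cocycle A (Λ j) n ψ)⁻¹) < 1

/-- The family `f_ε` is analytic in `ε` on `|ε| < ε₀` and `β`-Hölder in `ψ`: there
`f_ε = ∑ εⁿ aₙ`, where the `β`-Hölder norms of the coefficients grow at most like `ε₀⁻ⁿ`, so that
the series converges in the `β`-Hölder norm on `|ε| < ε₀`. -/
def IsAnalyticHolder {V : Type*} [NormedAddCommGroup V] [NormedSpace ℝ V]
    (β : ℝ≥0) (ε₀ : ℝ) (f : ℝ → Torus d → V) : Prop :=
  ∃ (a : ℕ → Torus d → V) (K C : ℝ≥0), (C : ℝ) * ε₀ ≤ 1 ∧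
    (∀ n, holderNorm β (a n) ≤ ((K * C ^ n : ℝ≥0) : ℝ≥0∞)) ∧
    ∀ ε : ℝ, |ε| < ε₀ → ∀ ψ, HasSum (fun n => ε ^ n • a n ψ) (f ε ψ)

theorem proj_add (x y : E d) : proj (x + y) = proj x + proj y := by
  ext i; simp [proj]

theorem proj_rep (ψ : Torus d) : proj (rep ψ) = ψ := by
  ext i; simp [proj, rep]

/-- The differential on the torus is the ordinary differential of any lift. -/
theorem tderiv_eq_of_lift {f : Torus d → Torus d} {g : E d → E d}
    (hg : ∀ x, proj (g x) = f (proj x)) {x : E d} (hx : ContinuousAt g x) :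
    tderiv f (proj x) = fderiv ℝ g x := by
  have hsub : ∀ a b : E d, proj (a - b) = proj a - proj b := by
    intro a b; ext i; simp [proj]
  have key : (fun u : E d => rep (f (proj x + proj u) - f (proj x)))
      =ᶠ[nhds 0] fun u => g (x + u) - g x := by
    have hc : ContinuousAt (fun u : E d => g (x + u) - g x) 0 := by
      refine ContinuousAt.sub ?_ continuousAt_const
      refine ContinuousAt.comp (g := g) (f := fun u => x + u) (by simpa using hx) (by fun_prop)
    have hb := hc.preimage_mem_nhds (Metric.ball_mem_nhds _ Real.pi_pos)
    filter_upwards [hb] with u hu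
    have hu' : ‖g (x + u) - g x‖ < Real.pi := by simpa using hu
    rw [← proj_add, ← hg, ← hg, ← hsub]
    ext i
    have h1 : ‖(g (x + u) - g x) i‖ < Real.pi := (PiLp.norm_apply_le _ i).trans_lt hu'
    rw [Real.norm_eq_abs, abs_lt] at h1
    exact AddCircle.equivIoc_coe_of_mem (p := 2 * Real.pi) (a := -Real.pi)
      ⟨h1.1, by linarith [h1.2]⟩
  rw [tderiv, key.fderiv_eq, fderiv_sub_const]
  simpa using fderiv_comp_add_left (𝕜 := ℝ) (f := g) (x := (0 : E d)) x

end ToralAnosov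

end

open ToralAnosov

/-! Everything is an implicit function problem in a Banach space of Hölder functions, analytic in ε.
Put H = id + h and h = ∑ aₖ vₖ. At ε = 0 the linearised conjugacy equation, read in the frame vₖ ∘
A₀, decouples into the scalar operators a ↦ Λₖ a - a ∘ A₀. For the i-th direction the perturbed
vector is normalised to vᵢ + ∑_{k ≠ i} aₖ vₖ and the free unknown aᵢ corrects Λᵢ. The linear part is
then aₖ ↦ Λₖ aₖ - Λᵢ aₖ ∘ A₀ for k ≠ i, and -aᵢ for k = i (`exists_analytic_conjugacy`,
`exists_analytic_eigen`).

Such a twisted operator is, up to invertible factors, 1 minus a weighted composition with A₀ or with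
its inverse. It is invertible on β-Hölder functions as soon as an n-step weight is at most κ < 1 and
κ L^{βn} < 1, where L is the Lipschitz constant of the map; the second condition holds for small β
(`isUnit_one_sub_wcomp`, `eventually_twist_bijective`). For a pair Λₖ, Λᵢ the weight is controlled
by domination. For the pair Λₖ, 1 each vₖ must be stable everywhere or unstable everywhere, which
follows from domination and a dimension count (`stable_or_unstable`).

Analyticity of the nonlinear terms holds because the Taylor coefficients of an analytic map of the
torus are Lipschitz in the base point with geometrically growing constants, so that u ↦ g(· + u) has
a convergent power series on Hölder functions (`exists_torus_superposition`).

The implicit function theorem does not give injectivity of H. For that a map K = id + k with K ∘ A_ε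
= A₀ ∘ K is found among bounded functions, where composition with A_ε needs no regularity.
Uniqueness of small bounded solutions forces H ∘ K and K ∘ H to be the identity (`exists_shadowing`,
`exists_radius_isHomeomorph`). -/

noncomputable section

namespace ToralAnosov

open Filter Topology

/-! ### Banach spaces of functions Lipschitz for a gauge, and pointwise operations on them. -/

section HolderSpace

variable {T : Type*}

/-- The bounded functions that are Lipschitz with respect to the gauge `ρ`. -/
def gaugeSubmodule (ρ : T → T → ℝ≥0) (V : Type*) [NormedAddCommGroup V] [NormedSpace ℝ V] :
    Submodule ℝ (T → V) where
  carrier := {f | ∃ C : ℝ, 0 ≤ C ∧ (∀ x, ‖f x‖ ≤ C) ∧ ∀ x y, ‖f x - f y‖ ≤ C * ρ x y}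
  add_mem' := by
    rintro f g ⟨C, hC, h1, h2⟩ ⟨D, hD, h3, h4⟩
    refine ⟨C + D, by positivity, fun x => (norm_add_le _ _).trans (add_le_add (h1 x) (h3 x)), ?_⟩
    intro x y
    have : (f + g) x - (f + g) y = (f x - f y) + (g x - g y) := by simp; abel
    rw [this, add_mul]
    exact (norm_add_le _ _).trans (add_le_add (h2 x y) (h4 x y))
  zero_mem' := ⟨0, le_rfl, by simp, by simp⟩
  smul_mem' := by
    rintro c f ⟨C, hC, h1, h2⟩
    refine ⟨‖c‖ * C, by positivity, fun x => ?_, fun x y => ?_⟩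
    · simp only [Pi.smul_apply, norm_smul]; gcongr; exact h1 x
    · simp only [Pi.smul_apply, ← smul_sub, norm_smul, mul_assoc]; gcongr; exact h2 x y

/-- The Banach space of bounded functions that are Lipschitz with respect to the gauge `ρ`. For
`ρ = dist ^ β` this is the space of `β`-Hölder functions, for `ρ = 2` the space of all bounded
functions with the sup norm. -/
def Hol (ρ : T → T → ℝ≥0) (V : Type*) [NormedAddCommGroup V] [NormedSpace ℝ V] : Type _ :=
  gaugeSubmodule ρ V

namespace Hol

variable {ρ : T → T → ℝ≥0} {V W Z : Type*} [NormedAddCommGroup V] [NormedSpace ℝ V]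
  [NormedAddCommGroup W] [NormedSpace ℝ W] [NormedAddCommGroup Z] [NormedSpace ℝ Z]

instance : AddCommGroup (Hol ρ V) := inferInstanceAs (AddCommGroup (gaugeSubmodule ρ V))

instance : Module ℝ (Hol ρ V) := inferInstanceAs (Module ℝ (gaugeSubmodule ρ V))

/-- The underlying function. -/
@[coe] def toFun (f : Hol ρ V) : T → V := f.1

instance : CoeFun (Hol ρ V) (fun _ => T → V) := ⟨toFun⟩

@[ext] theorem ext {f g : Hol ρ V} (h : ∀ x, f x = g x) : f = g := Subtype.ext (funext h)

@[simp] theorem add_apply (f g : Hol ρ V) (x : T) : (f + g) x = f x + g x := rfl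
@[simp] theorem sub_apply (f g : Hol ρ V) (x : T) : (f - g) x = f x - g x := rfl
@[simp] theorem neg_apply (f : Hol ρ V) (x : T) : (-f) x = -f x := rfl
@[simp] theorem zero_apply (x : T) : (0 : Hol ρ V) x = 0 := rfl
@[simp] theorem smul_apply (c : ℝ) (f : Hol ρ V) (x : T) : (c • f) x = c • f x := rfl

/-- An element of the space from its values and a bound. -/
def mk (f : T → V) (h : ∃ C : ℝ, 0 ≤ C ∧ (∀ x, ‖f x‖ ≤ C) ∧ ∀ x y, ‖f x - f y‖ ≤ C * ρ x y) :
    Hol ρ V := ⟨f, h⟩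

@[simp] theorem mk_apply (f : T → V) (h) (x : T) : (mk f h : Hol ρ V) x = f x := rfl

instance : Norm (Hol ρ V) :=
  ⟨fun f => sInf {C : ℝ | 0 ≤ C ∧ (∀ x, ‖f x‖ ≤ C) ∧ ∀ x y, ‖f x - f y‖ ≤ C * ρ x y}⟩

/-- The set of admissible constants is closed and bounded below, so its infimum is itself
admissible. -/
theorem norm_mem (f : Hol ρ V) :
    0 ≤ ‖f‖ ∧ (∀ x, ‖f x‖ ≤ ‖f‖) ∧ ∀ x y, ‖f x - f y‖ ≤ ‖f‖ * ρ x y := by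
  have hne : {C : ℝ | 0 ≤ C ∧ (∀ x, ‖f x‖ ≤ C) ∧ ∀ x y, ‖f x - f y‖ ≤ C * ρ x y}.Nonempty := f.2
  have hcl : IsClosed {C : ℝ | 0 ≤ C ∧ (∀ x, ‖f x‖ ≤ C) ∧ ∀ x y, ‖f x - f y‖ ≤ C * ρ x y} := by
    simp only [Set.ofPred_and, Set.ofPred_forall]
    refine isClosed_Ici.inter (IsClosed.inter ?_ ?_)
    · exact isClosed_iInter fun x => isClosed_le continuous_const continuous_id
    · exact isClosed_iInter fun x => isClosed_iInter fun y =>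
        isClosed_le continuous_const (continuous_id.mul continuous_const)
  exact hcl.csInf_mem hne ⟨0, fun C hC => hC.1⟩

theorem norm_apply_le (f : Hol ρ V) (x : T) : ‖f x‖ ≤ ‖f‖ := f.norm_mem.2.1 x

theorem norm_sub_apply_le (f : Hol ρ V) (x y : T) : ‖f x - f y‖ ≤ ‖f‖ * ρ x y := f.norm_mem.2.2 x y

theorem norm_le {f : Hol ρ V} {C : ℝ} (hC : 0 ≤ C) (h1 : ∀ x, ‖f x‖ ≤ C)
    (h2 : ∀ x y, ‖f x - f y‖ ≤ C * ρ x y) : ‖f‖ ≤ C :=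
  csInf_le ⟨0, fun _ hC => hC.1⟩ ⟨hC, h1, h2⟩

instance : NormedAddCommGroup (Hol ρ V) :=
  AddGroupNorm.toNormedAddCommGroup
    { toFun := norm
      map_zero' := le_antisymm (norm_le le_rfl (by simp) (by simp)) (norm_mem _).1
      add_le' := fun f g => by
        refine norm_le (add_nonneg f.norm_mem.1 g.norm_mem.1) (fun x => ?_) (fun x y => ?_)
        · exact (norm_add_le _ _).trans (add_le_add (f.norm_apply_le x) (g.norm_apply_le x))
        · have : (f + g) x - (f + g) y = (f x - f y) + (g x - g y) := by simp; abel
          rw [this, add_mul]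
          exact (norm_add_le _ _).trans
            (add_le_add (f.norm_sub_apply_le x y) (g.norm_sub_apply_le x y))
      neg' := fun f => by
        have key : ∀ f : Hol ρ V, ‖-f‖ ≤ ‖f‖ := fun f => by
          refine norm_le f.norm_mem.1 (fun x => ?_) (fun x y => ?_)
          · simpa using f.norm_apply_le x
          · rw [neg_apply, neg_apply, ← neg_sub', norm_neg]; exact f.norm_sub_apply_le x y
        exact le_antisymm (key f) (by simpa using key (-f))
      eq_zero_of_map_eq_zero' := fun f hf => by
        ext x
        have := f.norm_apply_le x
        rw [show ‖f‖ = 0 from hf] at this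
        simpa using this }

instance : NormedSpace ℝ (Hol ρ V) where
  norm_smul_le c f := by
    refine norm_le (mul_nonneg (norm_nonneg _) f.norm_mem.1) (fun x => ?_) (fun x y => ?_)
    · rw [smul_apply, norm_smul]; gcongr; exact f.norm_apply_le x
    · rw [smul_apply, smul_apply, ← smul_sub, norm_smul, mul_assoc]; gcongr
      exact f.norm_sub_apply_le x y

/-- Evaluation at a point. -/
def eval (x : T) : Hol ρ V →L[ℝ] V :=
  LinearMap.mkContinuous { toFun := fun f => f x, map_add' := fun _ _ => rfl,
                           map_smul' := fun _ _ => rfl } 1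
    (fun f => by rw [one_mul]; exact f.norm_apply_le x)

@[simp] theorem eval_apply (x : T) (f : Hol ρ V) : eval x f = f x := rfl

instance [CompleteSpace V] : CompleteSpace (Hol ρ V) := by
  refine Metric.complete_of_cauchySeq_tendsto fun u hu => ?_
  have hx : ∀ x, ∃ l, Tendsto (fun n => u n x) atTop (𝓝 l) := fun x =>
    cauchySeq_tendsto_of_complete (hu.map (eval x).uniformContinuous)
  choose l hl using hx
  have key : ∀ ε > 0, ∃ N, ∀ n ≥ N, (∀ x, ‖u n x - l x‖ ≤ ε) ∧
      ∀ x y, ‖(u n x - l x) - (u n y - l y)‖ ≤ ε * ρ x y := by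
    intro ε hε
    obtain ⟨N, hN⟩ := Metric.cauchySeq_iff.1 hu ε hε
    refine ⟨N, fun n hn => ⟨fun x => ?_, fun x y => ?_⟩⟩
    · refine le_of_tendsto ((tendsto_const_nhds.sub (hl x)).norm) ?_
      filter_upwards [eventually_ge_atTop N] with m hm
      have := hN n hn m hm
      rw [dist_eq_norm] at this
      exact ((u n - u m).norm_apply_le x).trans this.le
    · refine le_of_tendsto (((tendsto_const_nhds.sub (hl x)).sub
        (tendsto_const_nhds.sub (hl y))).norm) ?_
      filter_upwards [eventually_ge_atTop N] with m hm
      have := hN n hn m hm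
      rw [dist_eq_norm] at this
      refine ((u n - u m).norm_sub_apply_le x y).trans ?_
      gcongr
  obtain ⟨N, hN⟩ := key 1 one_pos
  have hmem : ∃ C : ℝ, 0 ≤ C ∧ (∀ x, ‖l x‖ ≤ C) ∧ ∀ x y, ‖l x - l y‖ ≤ C * ρ x y := by
    have h := (gaugeSubmodule ρ V).sub_mem (show (u N : T → V) ∈ gaugeSubmodule ρ V from (u N).2)
      (show (fun x => u N x - l x) ∈ gaugeSubmodule ρ V from
        ⟨1, zero_le_one, (hN N le_rfl).1, (hN N le_rfl).2⟩)
    have e : ((u N : T → V) - fun x => u N x - l x) = l := by ext x; simp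
    rw [e] at h
    exact h
  refine ⟨mk l hmem, Metric.tendsto_atTop.2 fun ε hε => ?_⟩
  obtain ⟨N, hN⟩ := key (ε / 2) (half_pos hε)
  refine ⟨N, fun n hn => ?_⟩
  rw [dist_eq_norm]
  exact (norm_le (half_pos hε).le (hN n hn).1 (hN n hn).2).trans_lt (half_lt_self hε)

/-- Constant functions. -/
def const (v : V) : Hol ρ V :=
  mk (fun _ => v) ⟨‖v‖, norm_nonneg _, fun _ => le_rfl, fun x y => by simp; positivity⟩

@[simp] theorem const_apply (v : V) (x : T) : (const v : Hol ρ V) x = v := rfl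

/-- Composition with a map that is Lipschitz with respect to the gauge. -/
def comp (φ : T → T) (L : ℝ≥0) (hφ : ∀ x y, ρ (φ x) (φ y) ≤ L * ρ x y) : Hol ρ V →L[ℝ] Hol ρ V :=
  LinearMap.mkContinuous
    { toFun := fun f => mk (fun x => f (φ x)) ⟨(max 1 L : ℝ≥0) * ‖f‖, by positivity,
        fun x => (f.norm_apply_le _).trans
          (le_mul_of_one_le_left (norm_nonneg _) (mod_cast le_max_left _ _)),
        fun x y => by
          refine (f.norm_sub_apply_le _ _).trans ?_
          have h : (ρ (φ x) (φ y) : ℝ) ≤ L * ρ x y := mod_cast hφ x y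
          calc ‖f‖ * ρ (φ x) (φ y) ≤ ‖f‖ * (L * ρ x y) := by gcongr
            _ ≤ ‖f‖ * ((max 1 L : ℝ≥0) * ρ x y) := by gcongr; exact mod_cast le_max_right _ _
            _ = _ := by push_cast; ring⟩
      map_add' := fun _ _ => rfl
      map_smul' := fun _ _ => rfl } (max 1 L : ℝ≥0)
    (fun f => by
      refine norm_le (by positivity) (fun x => ?_) (fun x y => ?_)
      · exact (f.norm_apply_le _).trans
          (le_mul_of_one_le_left (norm_nonneg _) (mod_cast le_max_left _ _))
      · refine (f.norm_sub_apply_le _ _).trans ?_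
        have h : (ρ (φ x) (φ y) : ℝ) ≤ L * ρ x y := mod_cast hφ x y
        calc ‖f‖ * ρ (φ x) (φ y) ≤ ‖f‖ * (L * ρ x y) := by gcongr
          _ ≤ ‖f‖ * ((max 1 L : ℝ≥0) * ρ x y) := by gcongr; exact mod_cast le_max_right _ _
          _ = _ := by push_cast; ring)

@[simp] theorem comp_apply (φ : T → T) (L : ℝ≥0) (hφ : ∀ x y, ρ (φ x) (φ y) ≤ L * ρ x y)
    (f : Hol ρ V) (x : T) : comp φ L hφ f x = f (φ x) := rfl

/-- Leibniz rule: the increment splits into two terms, each bounded by the product of the norms,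
whence the factor 2. -/
theorem bilin_bound (B : V →L[ℝ] W →L[ℝ] Z) (f : Hol ρ V) (g : Hol ρ W) :
    (∀ x, ‖B (f x) (g x)‖ ≤ 2 * ‖B‖ * ‖f‖ * ‖g‖) ∧
      ∀ x y, ‖B (f x) (g x) - B (f y) (g y)‖ ≤ 2 * ‖B‖ * ‖f‖ * ‖g‖ * ρ x y := by
  constructor
  · intro x
    calc ‖B (f x) (g x)‖ ≤ ‖B‖ * ‖f x‖ * ‖g x‖ := B.le_opNorm₂ _ _
      _ ≤ ‖B‖ * ‖f‖ * ‖g‖ := by gcongr; exacts [f.norm_apply_le x, g.norm_apply_le x]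
      _ ≤ 2 * ‖B‖ * ‖f‖ * ‖g‖ := by
        have : 0 ≤ ‖B‖ * ‖f‖ * ‖g‖ := by positivity
        linarith
  · intro x y
    have : B (f x) (g x) - B (f y) (g y) = B (f x - f y) (g x) + B (f y) (g x - g y) := by
      simp
    rw [this]
    calc _ ≤ ‖B (f x - f y) (g x)‖ + ‖B (f y) (g x - g y)‖ := norm_add_le _ _
      _ ≤ ‖B‖ * ‖f x - f y‖ * ‖g x‖ + ‖B‖ * ‖f y‖ * ‖g x - g y‖ :=
        add_le_add (B.le_opNorm₂ _ _) (B.le_opNorm₂ _ _)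
      _ ≤ ‖B‖ * (‖f‖ * ρ x y) * ‖g‖ + ‖B‖ * ‖f‖ * (‖g‖ * ρ x y) := by
        gcongr
        exacts [f.norm_sub_apply_le x y, g.norm_apply_le x, f.norm_apply_le y,
          g.norm_sub_apply_le x y]
      _ = _ := by ring

/-- Pointwise application of a continuous bilinear map. -/
def bilin (B : V →L[ℝ] W →L[ℝ] Z) : Hol ρ V →L[ℝ] Hol ρ W →L[ℝ] Hol ρ Z :=
  LinearMap.mkContinuous₂
    (LinearMap.mk₂ ℝ (fun f g => mk (fun x => B (f x) (g x)) ⟨2 * ‖B‖ * ‖f‖ * ‖g‖, by positivity,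
        (bilin_bound B f g).1, (bilin_bound B f g).2⟩)
      (fun f f' g => by ext x; simp) (fun c f g => by ext x; simp)
      (fun f g g' => by ext x; simp) (fun c f g => by ext x; simp)) (2 * ‖B‖)
    (fun f g => norm_le (by positivity) (bilin_bound B f g).1 (bilin_bound B f g).2)

@[simp] theorem bilin_apply (B : V →L[ℝ] W →L[ℝ] Z) (f : Hol ρ V) (g : Hol ρ W) (x : T) :
    bilin B f g x = B (f x) (g x) := rfl

theorem norm_bilin_apply_le (B : V →L[ℝ] W →L[ℝ] Z) (f : Hol ρ V) (g : Hol ρ W) :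
    ‖bilin B f g‖ ≤ 2 * ‖B‖ * ‖f‖ * ‖g‖ :=
  norm_le (by positivity) (bilin_bound B f g).1 (bilin_bound B f g).2

/-- Pointwise multiplication of a vector-valued function by a scalar one. -/
abbrev smulL : Hol ρ ℝ →L[ℝ] Hol ρ V →L[ℝ] Hol ρ V := bilin (ContinuousLinearMap.lsmul ℝ ℝ)

/-- Pointwise application of operator-valued functions to vector-valued ones. -/
abbrev applyL : Hol ρ (V →L[ℝ] W) →L[ℝ] Hol ρ V →L[ℝ] Hol ρ W :=
  bilin (ContinuousLinearMap.id ℝ (V →L[ℝ] W))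

/-- Currying off one argument at a time costs a factor 2 per argument by `bilin_bound`. The
resulting 2 ^ n is geometric, hence harmless for convergence of power series. -/
theorem multilin_bound (n : ℕ) (q : Hol ρ (V [×n]→L[ℝ] W)) (u : Fin n → Hol ρ V) :
    (∀ x, ‖q x (fun i => u i x)‖ ≤ 2 ^ n * ‖q‖ * ∏ i, ‖u i‖) ∧
      ∀ x y, ‖q x (fun i => u i x) - q y (fun i => u i y)‖ ≤
        (2 ^ n * ‖q‖ * ∏ i, ‖u i‖) * ρ x y := by
  induction n with
  | zero =>
    have e : ∀ x, q x (fun i => u i x) = (continuousMultilinearCurryFin0 ℝ V W) (q x) := by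
      intro x; simp only [continuousMultilinearCurryFin0_apply]; congr 1; ext i; exact i.elim0
    constructor
    · intro x
      rw [e, LinearIsometryEquiv.norm_map]; simpa using q.norm_apply_le x
    · intro x y
      rw [e, e, ← map_sub, LinearIsometryEquiv.norm_map]; simpa using q.norm_sub_apply_le x y
  | succ n ih =>
    let Φ := continuousMultilinearCurryLeftEquiv ℝ (fun _ : Fin (n + 1) => V) W
    have hΦ : ∀ a b, Φ a - Φ b = Φ (a - b) := fun _ _ => rfl
    let q' : Hol ρ (V →L[ℝ] (V [×n]→L[ℝ] W)) := mk (fun x => Φ (q x))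
      ⟨‖q‖, norm_nonneg _, fun x => by rw [LinearIsometryEquiv.norm_map]; exact q.norm_apply_le x,
        fun x y => by
          rw [hΦ, LinearIsometryEquiv.norm_map]; exact q.norm_sub_apply_le x y⟩
    have hq' : ‖q'‖ ≤ ‖q‖ := norm_le (norm_nonneg _)
      (fun x => by simp only [q', mk_apply, LinearIsometryEquiv.norm_map]; exact q.norm_apply_le x)
      (fun x y => by
        simp only [q', mk_apply]
        rw [hΦ, LinearIsometryEquiv.norm_map]; exact q.norm_sub_apply_le x y)
    have h1 : ‖applyL q' (u 0)‖ ≤ 2 * ‖q‖ * ‖u 0‖ := by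
      refine (norm_bilin_apply_le _ _ _).trans ?_
      have := ContinuousLinearMap.norm_id_le (𝕜 := ℝ) (E := V →L[ℝ] (V [×n]→L[ℝ] W))
      calc _ ≤ 2 * 1 * ‖q‖ * ‖u 0‖ := by gcongr
        _ = _ := by ring
    have h2 : 2 ^ n * ‖applyL q' (u 0)‖ * ∏ i : Fin n, ‖u i.succ‖ ≤
        2 ^ (n + 1) * ‖q‖ * ∏ i, ‖u i‖ := by
      rw [Fin.prod_univ_succ]
      calc _ ≤ 2 ^ n * (2 * ‖q‖ * ‖u 0‖) * ∏ i : Fin n, ‖u i.succ‖ := by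
            gcongr
        _ = _ := by ring
    have e : ∀ x, q x (fun i => u i x) = (applyL q' (u 0)) x (fun i => u i.succ x) := by
      intro x
      change _ = (Φ (q x)) (u 0 x) (fun i => u i.succ x)
      simp only [Φ, continuousMultilinearCurryLeftEquiv_apply]
      congr 1
      ext i
      refine Fin.cases ?_ (fun j => ?_) i <;> simp
    obtain ⟨i1, i2⟩ := ih (applyL q' (u 0)) (fun i => u i.succ)
    refine ⟨fun x => ?_, fun x y => ?_⟩
    · rw [e]; exact (i1 x).trans h2
    · rw [e, e]
      exact (i2 x y).trans (by gcongr)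

/-- Pointwise application of a continuous multilinear map depending on the point. -/
def multilin {n : ℕ} (q : Hol ρ (V [×n]→L[ℝ] W)) : (Hol ρ V) [×n]→L[ℝ] (Hol ρ W) :=
  MultilinearMap.mkContinuous
    { toFun := fun u => mk (fun x => q x (fun i => u i x))
        ⟨2 ^ n * ‖q‖ * ∏ i, ‖u i‖, by positivity, (multilin_bound n q u).1,
          (multilin_bound n q u).2⟩
      map_update_add' := by
        intro _ u i f g
        ext x
        have key : ∀ f : Hol ρ V, (fun j => Function.update u i f j x) =
            Function.update (fun j => u j x) i (f x) := by
          intro f; ext j; by_cases h : j = i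
          · subst h; simp
          · simp [h]
        have := (q x).map_update_add (fun j => u j x) i (f x) (g x)
        simp only [mk_apply, add_apply, key]
        convert this
      map_update_smul' := by
        intro _ u i c f
        ext x
        have key : ∀ f : Hol ρ V, (fun j => Function.update u i f j x) =
            Function.update (fun j => u j x) i (f x) := by
          intro f; ext j; by_cases h : j = i
          · subst h; simp
          · simp [h]
        have := (q x).map_update_smul (fun j => u j x) i c (f x)
        simp only [mk_apply, smul_apply, key]
        convert this }
    (2 ^ n * ‖q‖)
    (fun u => norm_le (by positivity) (multilin_bound n q u).1 (multilin_bound n q u).2)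

theorem norm_multilin_le {n : ℕ} (q : Hol ρ (V [×n]→L[ℝ] W)) : ‖multilin q‖ ≤ 2 ^ n * ‖q‖ :=
  MultilinearMap.mkContinuous_norm_le _ (by positivity) _

end Hol

end HolderSpace

/-- The element 1 - T divides the unit 1 - T ^ n, with the commuting cofactor 1 + T + ⋯ + T ^ (n -
1). -/
theorem isUnit_one_sub_of_norm_pow_lt_one {R : Type*} [NormedRing R] [HasSummableGeomSeries R]
    (T : R) (n : ℕ) (h : ‖T ^ n‖ < 1) : IsUnit (1 - T) := by
  have h1 : IsUnit (1 - T ^ n) := isUnit_one_sub_of_norm_lt_one h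
  have h2 : Commute (1 - T) (∑ i ∈ Finset.range n, T ^ i) := by
    change (1 - T) * _ = _ * (1 - T)
    rw [mul_neg_geom_sum, geom_sum_mul_neg]
  rw [← mul_neg_geom_sum, h2.isUnit_mul_iff] at h1
  exact h1.1

/-! ### Weighted composition operators and invertibility of twisted cohomological operators. -/

section WeightedComposition

variable {T : Type*} {ρ : T → T → ℝ≥0}

namespace Hol

/-- A function bounded away from zero is invertible. -/
theorem exists_inv (a : Hol ρ ℝ) {δ : ℝ} (hδ : 0 < δ) (h : ∀ x, δ ≤ |a x|) :
    ∃ a' : Hol ρ ℝ, ∀ x, a' x = (a x)⁻¹ := by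
  have hne : ∀ x, a x ≠ 0 := fun x hx => by have := h x; rw [hx, abs_zero] at this; linarith
  have hinv : ∀ x, |a x|⁻¹ ≤ δ⁻¹ := fun x => inv_anti₀ hδ (h x)
  refine ⟨mk (fun x => (a x)⁻¹) ⟨δ⁻¹ + ‖a‖ * δ⁻¹ * δ⁻¹, by positivity, fun x => ?_, fun x y => ?_⟩,
    fun x => rfl⟩
  · rw [norm_inv, Real.norm_eq_abs]
    exact (hinv x).trans (le_add_of_nonneg_right (by positivity))
  · rw [inv_sub_inv (hne x) (hne y), norm_div, norm_mul, div_eq_mul_inv, mul_inv]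
    have h1 := a.norm_sub_apply_le y x
    have h2 := a.norm_sub_apply_le x y
    rw [norm_sub_rev] at h2
    calc ‖a y - a x‖ * (‖a x‖⁻¹ * ‖a y‖⁻¹) ≤ (‖a‖ * ρ x y) * (δ⁻¹ * δ⁻¹) := by
          gcongr
          exacts [h x, h y]
      _ ≤ (δ⁻¹ + ‖a‖ * δ⁻¹ * δ⁻¹) * ρ x y := by
          have : 0 ≤ δ⁻¹ * ρ x y := by positivity
          linarith

variable (φ : T → T) (L : ℝ≥0) (hφ : ∀ x y, ρ (φ x) (φ y) ≤ L * ρ x y)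

/-- The weighted composition operator `w ↦ c · (w ∘ φ)`. -/
def wcomp (c : Hol ρ ℝ) : Hol ρ ℝ →L[ℝ] Hol ρ ℝ := (smulL c) ∘L (comp φ L hφ)

theorem wcomp_apply (c w : Hol ρ ℝ) (x : T) : wcomp φ L hφ c w x = c x * w (φ x) := rfl

theorem wcomp_pow_apply (c w : Hol ρ ℝ) (n : ℕ) (x : T) :
    (wcomp φ L hφ c ^ n) w x = (∏ j ∈ Finset.range n, c (φ^[j] x)) * w (φ^[n] x) := by
  induction n generalizing w with
  | zero => simp
  | succ n ih =>
    rw [pow_succ, mul_apply_eq_comp, ih, wcomp_apply, Finset.prod_range_succ,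
      Function.iterate_succ_apply', mul_assoc]

theorem gauge_iterate_le (φ : T → T) (L : ℝ≥0) (hφ : ∀ x y, ρ (φ x) (φ y) ≤ L * ρ x y)
    (n : ℕ) (x y : T) : (ρ (φ^[n] x) (φ^[n] y) : ℝ) ≤ (L : ℝ) ^ n * ρ x y := by
  induction n with
  | zero => simp
  | succ n ih =>
    rw [Function.iterate_succ_apply', Function.iterate_succ_apply', pow_succ']
    have h : (ρ (φ (φ^[n] x)) (φ (φ^[n] y)) : ℝ) ≤ L * ρ (φ^[n] x) (φ^[n] y) := mod_cast hφ _ _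
    refine h.trans ?_
    rw [mul_assoc]
    gcongr

/-- A weighted composition operator whose iterated weight is a contraction that dominates the
expansion of the gauge has `1` in its resolvent set. -/
theorem isUnit_one_sub_wcomp (c : Hol ρ ℝ) (n : ℕ) {κ : ℝ} (hκ0 : 0 ≤ κ) (hκ : κ < 1)
    (hκL : κ * (L : ℝ) ^ n < 1) (hc : ∀ x, |∏ j ∈ Finset.range n, c (φ^[j] x)| ≤ κ) :
    IsUnit (1 - wcomp φ L hφ c) := by
  set S := wcomp φ L hφ c ^ n with hS
  let cn : Hol ρ ℝ := S (const 1)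
  have hcn : ∀ x, cn x = ∏ j ∈ Finset.range n, c (φ^[j] x) := fun x => by
    rw [show cn = S (const 1) from rfl, hS, wcomp_pow_apply, const_apply, mul_one]
  have hSa : ∀ w x, S w x = cn x * w (φ^[n] x) := fun w x => by
    rw [hcn, hS, wcomp_pow_apply]
  obtain ⟨q, hq1, hq⟩ : ∃ q, max κ (κ * (L : ℝ) ^ n) < q ∧ q < 1 :=
    exists_between (max_lt hκ hκL)
  have hqκ : κ < q := (le_max_left _ _).trans_lt hq1
  have hqL : κ * (L : ℝ) ^ n ≤ q := (le_max_right _ _).trans hq1.le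
  have hq0 : 0 ≤ q := hκ0.trans hqκ.le
  -- On pairs (sup bound, gauge seminorm bound) the operator `S` acts as a triangular matrix with
  -- diagonal κ, κ L ^ n and off-diagonal entry ‖cn‖. This weight is chosen so that b + M a is
  -- contracted by the factor q.
  set M : ℝ := ‖cn‖ / (q - κ) with hM
  have hM0 : 0 ≤ M := div_nonneg (norm_nonneg _) (by linarith)
  have hMq : ‖cn‖ + M * κ ≤ q * M := by
    have : M * (q - κ) = ‖cn‖ := by rw [hM]; field_simp [(by linarith : q - κ ≠ 0)]
    linarith
  have step : ∀ (w : Hol ρ ℝ) (a b : ℝ), 0 ≤ a → 0 ≤ b → (∀ x, ‖w x‖ ≤ a) →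
      (∀ x y, ‖w x - w y‖ ≤ b * ρ x y) → (∀ x, ‖S w x‖ ≤ κ * a) ∧
      ∀ x y, ‖S w x - S w y‖ ≤ (‖cn‖ * a + κ * (L : ℝ) ^ n * b) * ρ x y := by
    intro w a b ha hb h1 h2
    refine ⟨fun x => ?_, fun x y => ?_⟩
    · rw [hSa, norm_mul, hcn]; gcongr; exacts [hc x, h1 _]
    · have e : S w x - S w y = (cn x - cn y) * w (φ^[n] x) +
          cn y * (w (φ^[n] x) - w (φ^[n] y)) := by rw [hSa w x, hSa w y]; ring
      rw [e]
      calc _ ≤ ‖cn x - cn y‖ * ‖w (φ^[n] x)‖ + ‖cn y‖ * ‖w (φ^[n] x) - w (φ^[n] y)‖ := by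
            refine (norm_add_le _ _).trans ?_
            rw [norm_mul, norm_mul]
        _ ≤ (‖cn‖ * ρ x y) * a + κ * (b * ((L : ℝ) ^ n * ρ x y)) := by
            gcongr
            · exact cn.norm_sub_apply_le x y
            · exact h1 _
            · rw [hcn]; exact hc y
            · exact (h2 _ _).trans (by gcongr; exact gauge_iterate_le φ L hφ n x y)
        _ = _ := by ring
  have iter : ∀ (k : ℕ) (w : Hol ρ ℝ), ∃ a b : ℝ, 0 ≤ a ∧ 0 ≤ b ∧ (∀ x, ‖(S ^ k) w x‖ ≤ a) ∧
      (∀ x y, ‖(S ^ k) w x - (S ^ k) w y‖ ≤ b * ρ x y) ∧ a ≤ q ^ k * ‖w‖ ∧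
      b + M * a ≤ q ^ k * ((1 + M) * ‖w‖) := by
    intro k w
    induction k with
    | zero =>
      refine ⟨‖w‖, ‖w‖, norm_nonneg _, norm_nonneg _, w.norm_apply_le, w.norm_sub_apply_le,
        by simp, by simp; linarith⟩
    | succ k ih =>
      obtain ⟨a, b, ha, hb, h1, h2, h3, h4⟩ := ih
      obtain ⟨s1, s2⟩ := step ((S ^ k) w) a b ha hb h1 h2
      refine ⟨κ * a, ‖cn‖ * a + κ * (L : ℝ) ^ n * b, by positivity, by positivity, ?_, ?_, ?_, ?_⟩
      · intro x; rw [pow_succ', mul_apply_eq_comp]; exact s1 x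
      · intro x y; rw [pow_succ', mul_apply_eq_comp]; exact s2 x y
      · calc κ * a ≤ q * (q ^ k * ‖w‖) := by gcongr
          _ = _ := by ring
      · calc ‖cn‖ * a + κ * (L : ℝ) ^ n * b + M * (κ * a)
            = (‖cn‖ + M * κ) * a + κ * (L : ℝ) ^ n * b := by ring
          _ ≤ (q * M) * a + q * b := by gcongr
          _ = q * (b + M * a) := by ring
          _ ≤ q * (q ^ k * ((1 + M) * ‖w‖)) := by gcongr
          _ = _ := by ring
  have hnorm : ∀ k, ‖S ^ k‖ ≤ q ^ k * (1 + M) := by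
    intro k
    refine ContinuousLinearMap.opNorm_le_bound _ (by positivity) fun w => ?_
    obtain ⟨a, b, ha, hb, h1, h2, h3, h4⟩ := iter k w
    have hMa : 0 ≤ M * a := by positivity
    refine norm_le (by positivity) (fun x => ?_) (fun x y => ?_)
    · refine (h1 x).trans (h3.trans ?_)
      have : 0 ≤ q ^ k * M * ‖w‖ := by positivity
      linarith
    · refine (h2 x y).trans ?_
      gcongr
      linarith
  have hlim : Tendsto (fun k => q ^ k * (1 + M)) atTop (𝓝 0) := by
    simpa using (tendsto_pow_atTop_nhds_zero_of_lt_one hq0 hq).mul_const (1 + M)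
  obtain ⟨k, hk⟩ := (hlim.eventually_lt_const zero_lt_one).exists
  refine isUnit_one_sub_of_norm_pow_lt_one _ (n * k) ?_
  rw [pow_mul]
  exact (hnorm k).trans_lt hk

/-- The operator `w ↦ a · w - b · (w ∘ φ)`. -/
def twist (a b : Hol ρ ℝ) : Hol ρ ℝ →L[ℝ] Hol ρ ℝ := smulL a - wcomp φ L hφ b

theorem twist_apply (a b w : Hol ρ ℝ) (x : T) :
    twist φ L hφ a b w x = a x * w x - b x * w (φ x) := rfl

theorem smulL_bijective {V : Type*} [NormedAddCommGroup V] [NormedSpace ℝ V] (a a' : Hol ρ ℝ)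
    (h : ∀ x, a x * a' x = 1) : Function.Bijective (smulL a : Hol ρ V → Hol ρ V) := by
  refine Function.bijective_iff_has_inverse.2 ⟨smulL a', fun w => ?_, fun w => ?_⟩
  · ext x; simp [smul_smul, h x]
  · ext x; simp [smul_smul, mul_comm (a' x), h x]

/-- Dividing by a leaves 1 minus the weighted composition with weight b / a, which is solved along
forward orbits. -/
theorem twist_bijective_of_right_lt (a a' b : Hol ρ ℝ) (ha : ∀ x, a x * a' x = 1) (n : ℕ) {κ : ℝ}
    (hκ0 : 0 ≤ κ) (hκ : κ < 1) (hκL : κ * (L : ℝ) ^ n < 1)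
    (hc : ∀ x, |∏ j ∈ Finset.range n, (a' (φ^[j] x) * b (φ^[j] x))| ≤ κ) :
    Function.Bijective (twist φ L hφ a b) := by
  have hu := isUnit_one_sub_wcomp φ L hφ (smulL a' b) n hκ0 hκ hκL hc
  rw [ContinuousLinearMap.isUnit_iff_bijective] at hu
  have e : (twist φ L hφ a b : Hol ρ ℝ → Hol ρ ℝ) =
      smulL a ∘ ⇑(1 - wcomp φ L hφ (smulL a' b)) := by
    ext w x
    change a x * w x - b x * w (φ x) = a x * (w x - (a' x * b x) * w (φ x))
    linear_combination (b x * w (φ x)) * ha x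
  rw [e]
  exact (smulL_bijective a a' ha).comp hu

end Hol

/-- The backward orbit of x, shifted by one step, is the forward orbit of its endpoint φ⁻ⁿ x
traversed in reverse. Bounds that are uniform in the point therefore pass from φ to φ⁻¹. -/
theorem prod_range_inv_pow {T : Type*} (φ : Equiv.Perm T) (c : T → ℝ) (n : ℕ) (x : T) :
    ∏ j ∈ Finset.range n, c (φ⁻¹ ((⇑φ⁻¹)^[j] x)) =
      ∏ j ∈ Finset.range n, c (φ^[j] ((⇑φ⁻¹)^[n] x)) := by
  rw [← Finset.prod_range_reflect]
  refine Finset.prod_congr rfl fun j hj => ?_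
  rw [Finset.mem_range] at hj
  have : (⇑φ⁻¹)^[n] x = (⇑φ⁻¹)^[j] (φ⁻¹ ((⇑φ⁻¹)^[n - 1 - j] x)) := by
    rw [← Function.iterate_succ_apply' (⇑φ⁻¹), ← Function.iterate_add_apply]
    congr 2
    omega
  rw [this]
  congr 1
  have hl : Function.LeftInverse φ (φ⁻¹ : Equiv.Perm T) := fun y => by simp
  exact ((hl.iterate j) _).symm

namespace Hol

/-- When a is the smaller weight, one divides by -b and solves for w ∘ φ. This gives 1 minus a
weighted composition with φ⁻¹, so it is the expansion constant of φ⁻¹ that enters the condition on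
κ. -/
theorem twist_bijective_of_left_lt (φ : Equiv.Perm T) (L L' : ℝ≥0)
    (hφ : ∀ x y, ρ (φ x) (φ y) ≤ L * ρ x y)
    (hφ' : ∀ x y, ρ (φ⁻¹ x) (φ⁻¹ y) ≤ L' * ρ x y)
    (a b b' : Hol ρ ℝ) (hb : ∀ x, b x * b' x = 1) (n : ℕ) {κ : ℝ}
    (hκ0 : 0 ≤ κ) (hκ : κ < 1) (hκL : κ * (L' : ℝ) ^ n < 1)
    (hc : ∀ x, |∏ j ∈ Finset.range n, (b' (φ^[j] x) * a (φ^[j] x))| ≤ κ) :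
    Function.Bijective (twist φ L hφ a b) := by
  have hu := isUnit_one_sub_wcomp (φ⁻¹ : Equiv.Perm T) L' hφ'
    (comp (φ⁻¹ : Equiv.Perm T) L' hφ' (smulL b' a)) n hκ0 hκ hκL (fun x => by
      have := prod_range_inv_pow φ (fun y => b' y * a y) n x
      simp only [comp_apply, bilin_apply, ContinuousLinearMap.lsmul_apply, smul_eq_mul]
      rw [this]
      exact hc _)
  rw [ContinuousLinearMap.isUnit_iff_bijective] at hu
  have hcomp : Function.Bijective (comp φ L hφ : Hol ρ ℝ → Hol ρ ℝ) := by
    refine Function.bijective_iff_has_inverse.2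
      ⟨comp (φ⁻¹ : Equiv.Perm T) L' hφ', fun w => ?_, fun w => ?_⟩ <;> ext x <;> simp
  have e : (twist φ L hφ a b : Hol ρ ℝ → Hol ρ ℝ) = smulL (-b) ∘ (comp φ L hφ) ∘
      ⇑(1 - wcomp (φ⁻¹ : Equiv.Perm T) L' hφ' (comp (φ⁻¹ : Equiv.Perm T) L' hφ' (smulL b' a))) := by
    ext w x
    change a x * w x - b x * w (φ x) = (-b x) * (w (φ x) - (b' (φ⁻¹ (φ x)) * a (φ⁻¹ (φ x))) *
      w (φ⁻¹ (φ x)))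
    rw [show φ⁻¹ (φ x) = x by simp]
    linear_combination (-(a x * w x)) * hb x
  rw [e]
  refine (smulL_bijective (-b) (-b') (fun x => ?_)).comp (hcomp.comp hu)
  simpa using hb x

end Hol

/-- A priori bound for bounded approximate solutions of `w = c · (w ∘ φ)`. -/
theorem abs_le_of_abs_sub_weighted_le {T : Type*} (φ : T → T) (c w : T → ℝ) {s C κ M : ℝ} (n : ℕ)
    (hM : ∀ x, |w x| ≤ M) (hs : ∀ x, |w x - c x * w (φ x)| ≤ s) (hC : ∀ x, |c x| ≤ C)
    (hκ0 : 0 ≤ κ) (hκ : κ < 1) (hc : ∀ x, |∏ j ∈ Finset.range n, c (φ^[j] x)| ≤ κ) (x : T) :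
    |w x| ≤ s * (∑ j ∈ Finset.range n, C ^ j) / (1 - κ) := by
  have hC0 : 0 ≤ C := (abs_nonneg _).trans (hC x)
  have h1 : ∀ (m : ℕ) y, |w y - (∏ j ∈ Finset.range m, c (φ^[j] y)) * w (φ^[m] y)| ≤
      s * ∑ j ∈ Finset.range m, C ^ j := by
    intro m y
    induction m with
    | zero => simp
    | succ m ih =>
      have hp : |∏ j ∈ Finset.range m, c (φ^[j] y)| ≤ C ^ m := by
        rw [Finset.abs_prod]
        refine (Finset.prod_le_prod (fun _ _ => abs_nonneg _) (fun j _ => hC _)).trans ?_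
        simp
      have e : w y - (∏ j ∈ Finset.range (m + 1), c (φ^[j] y)) * w (φ^[m + 1] y) =
          (w y - (∏ j ∈ Finset.range m, c (φ^[j] y)) * w (φ^[m] y)) +
          (∏ j ∈ Finset.range m, c (φ^[j] y)) * (w (φ^[m] y) - c (φ^[m] y) * w (φ (φ^[m] y))) := by
        rw [Finset.prod_range_succ, Function.iterate_succ_apply']; ring
      rw [e, Finset.sum_range_succ, mul_add]
      refine (abs_add_le _ _).trans (add_le_add ih ?_)
      rw [abs_mul, mul_comm s]
      gcongr
      exact hs _
  have hbdd : BddAbove (Set.range fun y => |w y|) := ⟨M, by rintro _ ⟨y, rfl⟩; exact hM y⟩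
  have : Nonempty T := ⟨x⟩
  -- The bound M only serves to make this supremum finite, so that κ M₀ can be absorbed; it does not
  -- enter the conclusion.
  set M₀ := ⨆ y, |w y|
  have h2 : M₀ ≤ κ * M₀ + s * ∑ j ∈ Finset.range n, C ^ j := by
    refine ciSup_le fun y => ?_
    have h3 := h1 n y
    have h4 : |(∏ j ∈ Finset.range n, c (φ^[j] y)) * w (φ^[n] y)| ≤ κ * M₀ := by
      rw [abs_mul]; gcongr; exacts [hc y, le_ciSup hbdd (φ^[n] y)]
    have h5 := abs_sub_abs_le_abs_sub (w y) ((∏ j ∈ Finset.range n, c (φ^[j] y)) * w (φ^[n] y))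
    linarith
  refine (le_ciSup hbdd x).trans ?_
  rw [le_div_iff₀ (by linarith)]
  linarith

end WeightedComposition

/-! ### Coordinates of Hölder vector fields with respect to a Hölder frame. -/

section Frame

variable {T : Type*} {ρ : T → T → ℝ≥0} {V : Type*} [NormedAddCommGroup V] [NormedSpace ℝ V] {d : ℕ}

/-- The synthesis map `a ↦ ∑ aₖ vₖ` of a frame. -/
def frameL (v : Fin d → Hol ρ V) : (Fin d → Hol ρ ℝ) →L[ℝ] Hol ρ V :=
  ∑ k, (Hol.smulL.flip (v k)) ∘L (ContinuousLinearMap.proj k)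

theorem Hol.sum_apply {ι : Type*} (s : Finset ι) (f : ι → Hol ρ V) (x : T) :
    (∑ i ∈ s, f i) x = ∑ i ∈ s, f i x := map_sum (Hol.eval x) f s

theorem frameL_apply (v : Fin d → Hol ρ V) (a : Fin d → Hol ρ ℝ) (x : T) :
    frameL v a x = ∑ k, a k x • v k x := by
  rw [frameL, _root_.sum_apply, Hol.sum_apply]
  rfl

theorem frameL_bijective [FiniteDimensional ℝ V] (hd : Module.finrank ℝ V = d)
    (v : Fin d → Hol ρ V) {c : ℝ} (hc : 0 < c)
    (h : ∀ x (a : Fin d → ℝ), c * ‖a‖ ≤ ‖∑ k, a k • v k x‖) :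
    Function.Bijective (frameL v) := by
  constructor
  · rw [injective_iff_map_eq_zero]
    intro a ha
    ext k x
    have h1 := h x (fun k => a k x)
    rw [← frameL_apply, ha, Hol.zero_apply, norm_zero] at h1
    have h2 : ‖fun k => a k x‖ = 0 := le_antisymm
      (by by_contra h3; push Not at h3; nlinarith) (norm_nonneg _)
    exact congrFun (norm_eq_zero.1 h2) k
  · intro u
    have hli : ∀ x, LinearIndependent ℝ (fun k => v k x) := fun x => by
      rw [Fintype.linearIndependent_iff]
      intro g hg k
      have h1 := h x g
      rw [hg, norm_zero] at h1
      have h2 : ‖g‖ = 0 := le_antisymm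
        (by by_contra h3; push Not at h3; nlinarith) (norm_nonneg _)
      exact congrFun (norm_eq_zero.1 h2) k
    have hsp : ∀ x, ∃ a : Fin d → ℝ, ∑ k, a k • v k x = u x := fun x => by
      have h1 := (hli x).span_eq_top_of_card_eq_finrank' (by simp [hd])
      have h2 : u x ∈ Submodule.span ℝ (Set.range fun k => v k x) := by rw [h1]; trivial
      exact (Submodule.mem_span_range_iff_exists_fun ℝ).1 h2
    choose a ha using hsp
    have hab : ∀ x, ‖a x‖ ≤ c⁻¹ * ‖u‖ := fun x => by
      rw [inv_mul_eq_div, le_div_iff₀ hc, mul_comm]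
      refine (h x (a x)).trans ?_
      rw [ha]; exact u.norm_apply_le x
    have hai : ∀ x k, ‖a x k‖ ≤ c⁻¹ * ‖u‖ := fun x k => (norm_le_pi_norm (a x) k).trans (hab x)
    set D : ℝ := c⁻¹ * (‖u‖ + ∑ k, (c⁻¹ * ‖u‖) * ‖v k‖) with hD
    have hDu : c⁻¹ * ‖u‖ ≤ D := by
      rw [hD]; gcongr
      exact le_add_of_nonneg_right (Finset.sum_nonneg fun k _ => by positivity)
    have hdiff : ∀ x y, ‖a x - a y‖ ≤ D * ρ x y := fun x y => by
      rw [hD, mul_assoc, inv_mul_eq_div, le_div_iff₀ hc, mul_comm]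
      refine (h x (a x - a y)).trans ?_
      -- Both coordinate vectors are compared in the frame at the single point x. The variation of
      -- the frame is thereby multiplied only by `a y`, which is already bounded.
      have e : ∑ k, (a x - a y) k • v k x = (u x - u y) - ∑ k, a y k • (v k x - v k y) := by
        simp only [Pi.sub_apply, sub_smul, smul_sub, Finset.sum_sub_distrib, ha]
        abel
      rw [e, add_mul]
      refine (norm_sub_le _ _).trans (add_le_add (u.norm_sub_apply_le x y) ?_)
      rw [Finset.sum_mul]
      refine (norm_sum_le _ _).trans (Finset.sum_le_sum fun k _ => ?_)
      rw [norm_smul, mul_assoc]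
      gcongr
      exacts [hai y k, (v k).norm_sub_apply_le x y]
    refine ⟨fun k => Hol.mk (fun x => a x k) ⟨D, (by positivity : 0 ≤ c⁻¹ * ‖u‖).trans hDu,
      fun x => (hai x k).trans hDu,
      fun x y => (norm_le_pi_norm (a x - a y) k).trans (hdiff x y)⟩, ?_⟩
    ext x
    rw [frameL_apply]
    exact ha x

end Frame

/-! ### Analytic superposition operators and uniform Taylor bounds. -/

section Superposition

variable {T : Type*} {ρ : T → T → ℝ≥0} {X V : Type*} [NormedAddCommGroup X] [NormedSpace ℝ X]
  [NormedAddCommGroup V] [NormedSpace ℝ V]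

/-- A superposition operator whose Taylor coefficients grow at most geometrically is analytic. -/
theorem exists_superposition [CompleteSpace V] (Φ : T → X → V) (q : ∀ n, Hol ρ (X [×n]→L[ℝ] V))
    {K C r : ℝ} (hC : 0 ≤ C) (hr : 0 < r) (hq : ∀ n, ‖q n‖ ≤ K * C ^ n)
    (hsum : ∀ x u, ‖u‖ < r → HasSum (fun n => q n x (fun _ => u)) (Φ x u)) :
    ∃ N : Hol ρ X → Hol ρ V, HasFPowerSeriesAt N (fun n => Hol.multilin (q n)) 0 ∧
      ∀ᶠ u in 𝓝 (0 : Hol ρ X), ∀ x, N u x = Φ x (u x) := by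
  set p : FormalMultilinearSeries ℝ (Hol ρ X) (Hol ρ V) := fun n => Hol.multilin (q n) with hp
  -- The coefficients of `p` are bounded by K (2C) ^ n; the extra 1 covers C = 0.
  let s : ℝ≥0 := ⟨(2 * C + 1)⁻¹, by positivity⟩
  have hs : 0 < s := by
    have : 0 < (2 * C + 1)⁻¹ := by positivity
    exact this
  have hK : 0 ≤ K := by have := (norm_nonneg _).trans (hq 0); simpa using this
  have hrad : (s : ℝ≥0∞) ≤ p.radius := by
    refine p.le_radius_of_bound K fun n => ?_
    have h1 : ‖p n‖ ≤ 2 ^ n * (K * C ^ n) :=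
      (Hol.norm_multilin_le (q n)).trans (by gcongr; exact hq n)
    have h2 : (2 * C * (s : ℝ)) ^ n ≤ 1 := by
      refine pow_le_one₀ (by positivity) ?_
      change 2 * C * (2 * C + 1)⁻¹ ≤ 1
      rw [mul_inv_le_iff₀ (by positivity)]; linarith
    calc ‖p n‖ * (s : ℝ) ^ n ≤ 2 ^ n * (K * C ^ n) * (s : ℝ) ^ n := by gcongr
      _ = K * (2 * C * (s : ℝ)) ^ n := by rw [mul_pow, mul_pow]; ring
      _ ≤ K * 1 := by gcongr
      _ = K := mul_one K
  have hrad0 : 0 < p.radius := lt_of_lt_of_le (by exact_mod_cast hs) hrad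
  have hN := p.hasFPowerSeriesOnBall hrad0
  refine ⟨p.sum, hN.hasFPowerSeriesAt, ?_⟩
  filter_upwards [Metric.ball_mem_nhds (0 : Hol ρ X) hr,
    Metric.eball_mem_nhds (0 : Hol ρ X) hrad0] with u hu1 hu2 x
  have h1 := hN.hasSum hu2
  rw [zero_add] at h1
  have h2 := h1.mapL (Hol.eval x)
  have h3 := hsum x (u x) ((u.norm_apply_le x).trans_lt (by simpa using hu1))
  exact h2.unique h3

end Superposition

section TaylorBounds

variable {X V : Type*} [NormedAddCommGroup X] [NormedSpace ℝ X]
  [NormedAddCommGroup V] [NormedSpace ℝ V] [CompleteSpace V]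

/-- Near a point, the derivatives of an analytic function satisfy uniform factorial bounds, and its
Taylor series converge on balls of uniform radius. -/
theorem exists_taylor_bound_nhds {f : X → V} {x : X} (hf : AnalyticAt ℝ f x) :
    ∃ r > 0, ∃ K C : ℝ, 0 ≤ K ∧ 0 ≤ C ∧ ∀ y ∈ Metric.ball x r,
      (∀ n, ‖iteratedFDeriv ℝ n f y‖ ≤ K * C ^ n * n.factorial) ∧
      ∀ u, ‖u‖ < r → HasSum (fun n => ((n.factorial : ℝ)⁻¹ • iteratedFDeriv ℝ n f y) fun _ => u)
        (f (y + u)) := by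
  obtain ⟨p, R, hp⟩ := hf
  -- One `s` is spent on moving the base point to y, the other on the increment u.
  obtain ⟨s, hs0, hsR⟩ : ∃ s : ℝ≥0, 0 < s ∧ ((s + s : ℝ≥0) : ℝ≥0∞) < R := by
    obtain ⟨t, ht0, htR⟩ := ENNReal.lt_iff_exists_nnreal_btwn.1 hp.r_pos
    refine ⟨t / 2, by simpa using ht0, by simpa using htR⟩
  have hsr : ((s : ℝ≥0∞) + (s : ℝ≥0∞)) < p.radius := by
    have := hsR.trans_le hp.r_le
    simpa using this
  have hsum := p.changeOriginSeries_summable_aux₁ hsr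
  set S : ℝ≥0 := ∑' t : Σ k l : ℕ, { s : Finset (Fin (k + l)) // s.card = l },
    ‖p (t.1 + t.2.1)‖₊ * s ^ t.2.1 * s ^ t.1 with hS
  refine ⟨s, hs0, S, (s : ℝ)⁻¹, S.2, by positivity, fun y hy => ?_⟩
  have hyn : ‖y - x‖ < s := by simpa [dist_eq_norm] using hy
  have hyn' : ‖y - x‖₊ < s := hyn
  have hyR : (‖y - x‖₊ : ℝ≥0∞) < R := by
    refine lt_trans ?_ hsR
    exact_mod_cast hyn'.trans_le (by simp)
  have hpy := hp.changeOrigin hyR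
  rw [add_sub_cancel] at hpy
  constructor
  · intro n
    have h1 : ‖p.changeOrigin (y - x) n‖₊ * s ^ n ≤ S := by
      have h2 := p.nnnorm_changeOrigin_le n (hyR.trans_le hp.r_le)
      have h3 := (NNReal.summable_sigma.1 hsum).1 n
      have h4 := p.changeOriginSeries_summable_aux₂ (hyR.trans_le hp.r_le) n
      calc ‖p.changeOrigin (y - x) n‖₊ * s ^ n
          ≤ (∑' t : Σ l : ℕ, { s : Finset (Fin (n + l)) // s.card = l },
            ‖p (n + t.1)‖₊ * ‖y - x‖₊ ^ t.1) * s ^ n := by gcongr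
        _ = ∑' t : Σ l : ℕ, { s : Finset (Fin (n + l)) // s.card = l },
            ‖p (n + t.1)‖₊ * ‖y - x‖₊ ^ t.1 * s ^ n := by rw [NNReal.tsum_mul_right]
        _ ≤ ∑' t : Σ l : ℕ, { s : Finset (Fin (n + l)) // s.card = l },
            ‖p (n + t.1)‖₊ * s ^ t.1 * s ^ n := by
            refine Summable.tsum_le_tsum (fun t => ?_) (h4.mul_right _) h3
            gcongr
        _ ≤ S := by
            rw [hS, hsum.tsum_sigma' (NNReal.summable_sigma.1 hsum).1]
            exact (NNReal.summable_sigma.1 hsum).2.le_tsum n (fun _ _ => zero_le)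
    have h1' : ‖p.changeOrigin (y - x) n‖ * (s : ℝ) ^ n ≤ S := by exact_mod_cast h1
    have h5 : ‖p.changeOrigin (y - x) n‖ ≤ S * (s : ℝ)⁻¹ ^ n := by
      rw [inv_pow, ← div_eq_mul_inv, le_div_iff₀ (by positivity)]; exact h1'
    refine ContinuousMultilinearMap.opNorm_le_bound (by positivity) fun v => ?_
    -- The n-th derivative is the symmetrisation of the n-th coefficient over the n! permutations,
    -- which is where the factorial comes from.
    rw [hpy.iteratedFDeriv_eq_sum_of_completeSpace]
    refine (norm_sum_le _ _).trans ?_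
    calc ∑ σ : Equiv.Perm (Fin n), ‖p.changeOrigin (y - x) n fun i => v (σ i)‖
        ≤ ∑ σ : Equiv.Perm (Fin n), S * (s : ℝ)⁻¹ ^ n * ∏ i, ‖v i‖ := by
          refine Finset.sum_le_sum fun σ _ => ?_
          refine ((p.changeOrigin (y - x) n).le_opNorm _).trans ?_
          rw [Equiv.prod_comp σ (fun i => ‖v i‖)]
          gcongr
      _ = _ := by
          rw [Finset.sum_const, Finset.card_univ, Fintype.card_perm, Fintype.card_fin,
            nsmul_eq_mul]
          ring
  · intro u hu
    refine hpy.hasSum_iteratedFDeriv ?_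
    rw [Metric.mem_eball, edist_zero_right, lt_tsub_iff_right]
    refine lt_trans ?_ hsR
    rw [enorm_eq_nnnorm, ← ENNReal.coe_add, ENNReal.coe_lt_coe]
    have hu' : ‖u‖₊ < s := hu
    exact add_lt_add hu' hyn'

/-- Uniform version of `exists_taylor_bound_nhds` on a compact set. -/
theorem exists_taylor_bound_of_isCompact {f : X → V} (hf : AnalyticOnNhd ℝ f Set.univ) {S : Set X}
    (hS : IsCompact S) :
    ∃ r > 0, ∃ K C : ℝ, 0 ≤ K ∧ 0 ≤ C ∧ ∀ y ∈ S,
      (∀ n, ‖iteratedFDeriv ℝ n f y‖ ≤ K * C ^ n * n.factorial) ∧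
      ∀ u, ‖u‖ < r → HasSum (fun n => ((n.factorial : ℝ)⁻¹ • iteratedFDeriv ℝ n f y) fun _ => u)
        (f (y + u)) := by
  refine hS.induction_on ?_ ?_ ?_ ?_
  · exact ⟨1, one_pos, 0, 0, le_rfl, le_rfl, by simp⟩
  · intro s t hst ht
    obtain ⟨r, hr, K, C, hK, hC, h⟩ := ht
    exact ⟨r, hr, K, C, hK, hC, fun y hy => h y (hst hy)⟩
  · intro s t hs ht
    obtain ⟨r, hr, K, C, hK, hC, h⟩ := hs
    obtain ⟨r', hr', K', C', hK', hC', h'⟩ := ht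
    refine ⟨min r r', lt_min hr hr', max K K', max C C', hK.trans (le_max_left _ _),
      hC.trans (le_max_left _ _), ?_⟩
    rintro y (hy | hy)
    · refine ⟨fun n => ((h y hy).1 n).trans ?_,
        fun u hu => (h y hy).2 u (hu.trans_le (min_le_left _ _))⟩
      gcongr
      exacts [le_max_left _ _, le_max_left _ _]
    · refine ⟨fun n => ((h' y hy).1 n).trans ?_,
        fun u hu => (h' y hy).2 u (hu.trans_le (min_le_right _ _))⟩
      gcongr
      exacts [le_max_right _ _, le_max_right _ _]
  · intro x hx
    obtain ⟨r, hr, K, C, hK, hC, h⟩ := exists_taylor_bound_nhds (hf x (Set.mem_univ x))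
    exact ⟨Metric.ball x r, mem_nhdsWithin_of_mem_nhds (Metric.ball_mem_nhds x hr),
      r, hr, K, C, hK, hC, h⟩

end TaylorBounds

/-! ### The Hölder gauge, and comparison of exponents. -/

section Gauge

variable {T : Type*} [MetricSpace T] {V : Type*} [NormedAddCommGroup V] [NormedSpace ℝ V]

/-- The gauge of `β`-Hölder continuity. -/
def gauge (β : ℝ≥0) (x y : T) : ℝ≥0 := nndist x y ^ (β : ℝ)

theorem coe_gauge (β : ℝ≥0) (x y : T) : (gauge β x y : ℝ) = dist x y ^ (β : ℝ) := by
  simp [gauge, NNReal.coe_rpow]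

/-- This is why small exponents help: the expansion factor L ^ β of the gauge tends to 1 as β → 0
when L > 0. -/
theorem gauge_le_of_lipschitz (β : ℝ≥0) {φ : T → T} {L : ℝ≥0} (hφ : LipschitzWith L φ) (x y : T) :
    gauge β (φ x) (φ y) ≤ L ^ (β : ℝ) * gauge β x y := by
  rw [gauge, gauge, ← NNReal.mul_rpow]
  exact NNReal.rpow_le_rpow (hφ.nndist_le x y) β.2

/-- Interpolation between a bound on the oscillation and a Hölder bound of a larger exponent. -/
theorem le_mul_rpow_of_le {t a b r s : ℝ} (hr : 0 ≤ r) (hrs : r ≤ s) (ht : 0 ≤ t) (ha : 0 ≤ a)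
    {y : ℝ} (h1 : y ≤ a) (h2 : y ≤ b * t ^ s) : y ≤ max a b * t ^ r := by
  rcases le_total t 1 with h | h
  · rcases ht.eq_or_lt with rfl | ht'
    · rcases hr.eq_or_lt with rfl | hr'
      · rw [Real.rpow_zero, mul_one]; exact h1.trans (le_max_left _ _)
      · rw [Real.zero_rpow hr'.ne', mul_zero]
        rwa [Real.zero_rpow (hr'.trans_le hrs).ne', mul_zero] at h2
    · refine h2.trans ?_
      exact mul_le_mul (le_max_right _ _) (Real.rpow_le_rpow_of_exponent_ge ht' h hrs)
        (by positivity) (ha.trans (le_max_left _ _))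
  · refine h1.trans ((le_max_left a b).trans ?_)
    exact le_mul_of_one_le_right (ha.trans (le_max_left _ _)) (Real.one_le_rpow h hr)

/-- A bounded Lipschitz function is Hölder. -/
theorem exists_hol_of_lipschitz (β : ℝ≥0) (hβ : β ≤ 1) (f : T → V) {a b : ℝ} (ha : 0 ≤ a)
    (hb : 0 ≤ b) (h1 : ∀ x, ‖f x‖ ≤ a) (h2 : ∀ x y, ‖f x - f y‖ ≤ b * dist x y) :
    ∃ g : Hol (gauge (T := T) β) V, (∀ x, g x = f x) ∧ ‖g‖ ≤ 2 * a + b := by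
  have h3 : ∀ x y, ‖f x - f y‖ ≤ (2 * a + b) * gauge β x y := fun x y => by
    have h4 : ‖f x - f y‖ ≤ 2 * a := (norm_sub_le _ _).trans (by linarith [h1 x, h1 y])
    have h5 := le_mul_rpow_of_le (r := β) (s := 1) β.2 (by exact_mod_cast hβ) dist_nonneg
      (by positivity) h4 (by simpa using h2 x y)
    rw [coe_gauge]
    refine h5.trans ?_
    gcongr
    exact max_le (by linarith) (by linarith)
  have h4 : ∀ x, ‖f x‖ ≤ 2 * a + b := fun x => (h1 x).trans (by linarith)
  exact ⟨Hol.mk f ⟨2 * a + b, by positivity, h4, h3⟩, fun x => rfl,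
    Hol.norm_le (by positivity) h4 h3⟩

theorem Hol.continuous {β : ℝ≥0} (hβ : 0 < β) (f : Hol (gauge (T := T) β) V) :
    Continuous (f : T → V) := by
  have h : HolderWith ‖f‖₊ β (f : T → V) := by
    intro x y
    have h1 : nndist (f x) (f y) ≤ ‖f‖₊ * nndist x y ^ (β : ℝ) := by
      have := f.norm_sub_apply_le x y
      rw [← dist_eq_norm] at this
      exact this
    rw [edist_nndist, edist_nndist]
    rw [← ENNReal.coe_rpow_of_nonneg _ β.coe_nonneg]
    exact_mod_cast h1
  exact h.continuous hβ

end Gauge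

section HolderNorm

variable {d : ℕ} {V : Type*} [NormedAddCommGroup V] [NormedSpace ℝ V]

/-- The sup norm contributes 1 and the β-seminorm at most 2, by interpolating between the
oscillation 2‖f‖ and the β'-bound. -/
theorem holderNorm_le_of_le {β β' : ℝ≥0} (h : β ≤ β') (f : Hol (gauge (T := Torus d) β') V) :
    holderNorm β (f : Torus d → V) ≤ ((3 * ‖f‖₊ : ℝ≥0) : ℝ≥0∞) := by
  have h1 : supNorm (f : Torus d → V) ≤ (‖f‖₊ : ℝ≥0∞) := by
    refine iSup_le fun x => ?_
    rw [enorm_eq_nnnorm]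
    exact_mod_cast f.norm_apply_le x
  have h2 : HolderWith (2 * ‖f‖₊) β (f : Torus d → V) := by
    intro x y
    have h3 : nndist (f x) (f y) ≤ (2 * ‖f‖₊) * nndist x y ^ (β : ℝ) := by
      have h4 := f.norm_sub_apply_le x y
      have h5 : ‖f x - f y‖ ≤ 2 * ‖f‖ :=
        (norm_sub_le _ _).trans (by linarith [f.norm_apply_le x, f.norm_apply_le y])
      rw [coe_gauge] at h4
      have h6 := le_mul_rpow_of_le (r := β) (s := β') β.2 (by exact_mod_cast h) dist_nonneg
        (by positivity) h5 h4
      rw [max_eq_left (by linarith [norm_nonneg f]), ← dist_eq_norm] at h6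
      exact h6
    rw [edist_nndist, edist_nndist, ← ENNReal.coe_rpow_of_nonneg _ β.coe_nonneg]
    exact_mod_cast h3
  calc holderNorm β (f : Torus d → V) ≤ (‖f‖₊ : ℝ≥0∞) + ((2 * ‖f‖₊ : ℝ≥0) : ℝ≥0∞) :=
        add_le_add h1 h2.eHolderNorm_le
    _ = _ := by rw [← ENNReal.coe_add]; congr 1; ring

end HolderNorm

/-! ### The flat torus: shortest representatives, compactness, quasi-periodic lifts. -/

section Torus

variable {d : ℕ}

theorem proj_sub (x y : E d) : proj (x - y) = proj x - proj y := by
  ext i; simp [proj]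

theorem proj_zero : proj (0 : E d) = 0 := by
  ext i; simp [proj]

theorem norm_proj_le (x : E d) : ‖proj x‖ ≤ ‖x‖ := by
  rw [PiLp.norm_eq_of_L2, PiLp.norm_eq_of_L2]
  gcongr with i
  exact QuotientAddGroup.norm_mk_le_norm

/-- In each coordinate the representative in (-π, π] is a shortest one. Hence `rep` of a difference
realises the distance, and Lipschitz constants descend to the torus unchanged. -/
theorem norm_rep (ψ : Torus d) : ‖rep ψ‖ = ‖ψ‖ := by
  rw [PiLp.norm_eq_of_L2, PiLp.norm_eq_of_L2]
  congr 1
  refine Finset.sum_congr rfl fun i _ => ?_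
  congr 1
  have h := (AddCircle.equivIoc (2 * Real.pi) (-Real.pi) (ψ i)).2
  set y := AddCircle.equivIoc (2 * Real.pi) (-Real.pi) (ψ i)
  have h1 : ((y : ℝ) : AddCircle (2 * Real.pi)) = ψ i := by simp [y]
  have h2 : ‖((y : ℝ) : AddCircle (2 * Real.pi))‖ = |(y : ℝ)| := by
    rw [AddCircle.norm_coe_eq_abs_iff _ (by positivity), abs_of_pos Real.two_pi_pos, abs_le]
    constructor <;> linarith [h.1, h.2]
  rw [h1] at h2
  rw [h2]
  rfl

theorem continuous_proj : Continuous (proj : E d → Torus d) := by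
  refine (LipschitzWith.of_dist_le_mul (K := 1) fun x y => ?_).continuous
  rw [dist_eq_norm, dist_eq_norm, ← proj_sub, NNReal.coe_one, one_mul]
  exact norm_proj_le _

theorem exists_isCompact_rep (d : ℕ) : ∃ S : Set (E d), IsCompact S ∧ ∀ ψ : Torus d, rep ψ ∈ S := by
  refine ⟨WithLp.toLp 2 '' (Set.univ.pi fun _ : Fin d => Set.Icc (-Real.pi) Real.pi),
    (isCompact_univ_pi fun _ => isCompact_Icc).image (PiLp.continuous_toLp 2 _), fun ψ => ?_⟩
  refine ⟨_, fun i _ => ?_, rfl⟩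
  have h := (AddCircle.equivIoc (2 * Real.pi) (-Real.pi) (ψ i)).2
  exact ⟨h.1.le, by linarith [h.2]⟩

instance : CompactSpace (Torus d) := by
  obtain ⟨S, hS, h⟩ := exists_isCompact_rep d
  refine ⟨(hS.image continuous_proj).of_isClosed_subset isClosed_univ fun ψ _ => ?_⟩
  exact ⟨rep ψ, h ψ, proj_rep ψ⟩

theorem dist_eq_norm_rep (ψ ψ' : Torus d) : dist ψ ψ' = ‖rep (ψ - ψ')‖ := by
  rw [norm_rep, dist_eq_norm]

end Torus

section Hol

variable {d : ℕ} {V : Type*} [NormedAddCommGroup V] [NormedSpace ℝ V]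

/-- Since the torus has finite diameter, the exponent may be lowered. This places all the data in
one space of small exponent. -/
theorem exists_hol_of_isHolder {β β' : ℝ≥0} (h : β ≤ β') {f : Torus d → V} (hf : IsHolder β' f) :
    ∃ g : Hol (gauge (T := Torus d) β) V, ∀ x, g x = f x := by
  have h1 : supNorm f < ∞ := lt_of_le_of_lt le_self_add hf
  have h2 : eHolderNorm β' f < ∞ := lt_of_le_of_lt le_add_self hf
  obtain ⟨C, hC⟩ := (eHolderNorm_lt_top.1 h2).of_le h
  set M := (supNorm f).toReal
  have hM : ∀ x, ‖f x‖ ≤ M := fun x => by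
    have h3 : ‖f x‖ₑ ≤ supNorm f := le_iSup (fun ψ => ‖f ψ‖ₑ) x
    have := ENNReal.toReal_mono h1.ne h3
    simpa using this
  have hM0 : 0 ≤ M := ENNReal.toReal_nonneg
  refine ⟨Hol.mk f ⟨M + C, by positivity, fun x => (hM x).trans (by simp), fun x y => ?_⟩,
    fun x => rfl⟩
  have h3 := hC x y
  rw [edist_nndist, edist_nndist, ← ENNReal.coe_rpow_of_nonneg _ β.coe_nonneg] at h3
  have h4 : nndist (f x) (f y) ≤ C * nndist x y ^ (β : ℝ) := by exact_mod_cast h3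
  have h5 : dist (f x) (f y) ≤ C * gauge β x y := h4
  rw [← dist_eq_norm]
  refine h5.trans ?_
  gcongr
  linarith

end Hol

section QuasiPeriodic

variable {d : ℕ} {V : Type*} [NormedAddCommGroup V]

/-- A function on `ℝ^d` whose increments are periodic. -/
def IsQuasiPeriodic (f : E d → V) : Prop :=
  ∀ k, proj k = 0 → ∀ x u, f (x + k + u) - f (x + k) = f (x + u) - f x

/-- The increments of a quasi-periodic function, as functions on the torus. -/
def incr (f : E d → V) (ψ : Torus d) (u : E d) : V := f (rep ψ + u) - f (rep ψ)

theorem IsQuasiPeriodic.sub_eq {f : E d → V} (hf : IsQuasiPeriodic f) {x y : E d}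
    (h : proj x = proj y) (u : E d) : f (x + u) - f x = f (y + u) - f y := by
  have := hf (x - y) (by rw [proj_sub, h, sub_self]) y u
  rwa [add_sub_cancel] at this

theorem IsQuasiPeriodic.incr_proj {f : E d → V} (hf : IsQuasiPeriodic f) (x u : E d) :
    incr f (proj x) u = f (x + u) - f x :=
  hf.sub_eq (proj_rep _) u

theorem IsQuasiPeriodic.of_periodic {f : E d → V} (hf : ∀ x y, proj x = proj y → f x = f y) :
    IsQuasiPeriodic f := fun k hk x u => by
  rw [hf (x + k + u) (x + u) (by simp [proj_add, hk]), hf (x + k) x (by simp [proj_add, hk])]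

theorem exists_bound_of_periodic {f : E d → V} (hf : Continuous f)
    (h : ∀ x y, proj x = proj y → f x = f y) : ∃ C : ℝ, 0 ≤ C ∧ ∀ x, ‖f x‖ ≤ C := by
  obtain ⟨S, hS, hrep⟩ := exists_isCompact_rep d
  obtain ⟨C, hC⟩ := hS.exists_bound_of_continuousOn hf.continuousOn
  refine ⟨max C 0, le_max_right _ _, fun x => ?_⟩
  rw [h x (rep (proj x)) (proj_rep _).symm]
  exact (hC _ (hrep _)).trans (le_max_left _ _)

/-- Descent of a Lipschitz periodic function to the torus. -/
theorem norm_sub_rep_le {f : E d → V} {L : ℝ} (hL : ∀ x y, ‖f x - f y‖ ≤ L * ‖x - y‖)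
    (h : ∀ x y, proj x = proj y → f x = f y) (ψ ψ' : Torus d) :
    ‖f (rep ψ) - f (rep ψ')‖ ≤ L * dist ψ ψ' := by
  rw [h (rep ψ) (rep ψ' + rep (ψ - ψ')) (by rw [proj_add, proj_rep, proj_rep, proj_rep]; abel),
    dist_eq_norm_rep]
  exact (hL _ _).trans (by rw [add_sub_cancel_left])

variable [NormedSpace ℝ V]

theorem IsQuasiPeriodic.fderiv_eq {f : E d → V} (hf : IsQuasiPeriodic f) {x y : E d}
    (h : proj x = proj y) : fderiv ℝ f x = fderiv ℝ f y := by
  have h1 : ∀ z : E d, fderiv ℝ f z = fderiv ℝ (fun u => f (z + u) - f z) 0 := fun z => by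
    rw [fderiv_sub_const]
    simpa using (fderiv_comp_add_left (𝕜 := ℝ) (f := f) (x := (0 : E d)) z).symm
  rw [h1 x, h1 y]
  congr 1
  ext u
  exact hf.sub_eq h u

/-- For a period k, the function z ↦ f (z + k) - f z has zero derivative and so is constant. No
knowledge of the action of the map on the period lattice is needed. -/
theorem isQuasiPeriodic_of_fderiv_eq {f : E d → V} (hf : Differentiable ℝ f)
    (h : ∀ x y, proj x = proj y → fderiv ℝ f x = fderiv ℝ f y) : IsQuasiPeriodic f := by
  intro k hk x u
  have h1 : ∀ z, fderiv ℝ (fun z => f (z + k) - f z) z = 0 := fun z => by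
    have hd : DifferentiableAt ℝ (fun z => f (z + k)) z :=
      (hf (z + k)).comp z (by fun_prop)
    rw [fderiv_fun_sub hd (hf z), fderiv_comp_add_right,
      h (z + k) z (by rw [proj_add, hk, add_zero]), sub_self]
  have h2 := is_const_of_fderiv_eq_zero (𝕜 := ℝ) (f := fun z => f (z + k) - f z)
    (fun z => ((hf (z + k)).comp z (by fun_prop)).sub (hf z)) h1 (x + u) x
  rw [show x + k + u = x + u + k by abel]
  exact sub_eq_sub_iff_sub_eq_sub.1 h2

theorem AnalyticOnNhd.differentiable_univ {f : E d → V} (hf : AnalyticOnNhd ℝ f Set.univ) :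
    Differentiable ℝ f := fun x => (hf x (Set.mem_univ x)).differentiableAt

/-- The derivative is continuous and periodic, hence bounded by compactness. -/
theorem exists_lipschitz_of_quasiPeriodic [CompleteSpace V] {f : E d → V}
    (hf : AnalyticOnNhd ℝ f Set.univ)
    (h : IsQuasiPeriodic f) : ∃ L : ℝ≥0, LipschitzWith L f := by
  obtain ⟨C, hC0, hC⟩ := exists_bound_of_periodic
    (f := fderiv ℝ f) (AnalyticOnNhd.differentiable_univ hf.fderiv).continuous
    (fun x y hxy => h.fderiv_eq hxy)
  exact ⟨⟨C, hC0⟩, lipschitzWith_of_nnnorm_fderiv_le (AnalyticOnNhd.differentiable_univ hf) hC⟩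

/-- An analytic periodic function descends to a Hölder function on the torus. -/
theorem exists_hol_of_periodic [CompleteSpace V] {β : ℝ≥0} (hβ : β ≤ 1) {f : E d → V}
    (hf : AnalyticOnNhd ℝ f Set.univ) (h : ∀ x y, proj x = proj y → f x = f y) :
    ∃ g : Hol (gauge (T := Torus d) β) V, ∀ x, g (proj x) = f x := by
  obtain ⟨L, hL⟩ := exists_lipschitz_of_quasiPeriodic hf (.of_periodic h)
  obtain ⟨C, hC0, hC⟩ :=
    exists_bound_of_periodic (AnalyticOnNhd.differentiable_univ hf).continuous h
  obtain ⟨g, hg, -⟩ := exists_hol_of_lipschitz β hβ (fun ψ : Torus d => f (rep ψ)) hC0 L.2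
    (fun ψ => hC _) (fun ψ ψ' => norm_sub_rep_le (fun x y => by
      rw [← dist_eq_norm, ← dist_eq_norm]; exact hL.dist_le_mul x y) h ψ ψ')
  exact ⟨g, fun x => by rw [hg]; exact h _ _ (proj_rep _)⟩

end QuasiPeriodic

/-! ### Superposition with analytic maps of the torus, and the analytic implicit function theorem.
-/

section TorusSuperposition

variable {d : ℕ} {V : Type*} [NormedAddCommGroup V] [NormedSpace ℝ V]

/-- The Taylor coefficients of the increments of `f` at `x`. -/
def incrCoeff (f : E d → V) (n : ℕ) (x : E d) : (E d) [×n]→L[ℝ] V :=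
  (n.factorial : ℝ)⁻¹ • iteratedFDeriv ℝ n (fun u => f (x + u) - f x) 0

theorem incrCoeff_zero (f : E d → V) (x : E d) : incrCoeff f 0 x = 0 := by
  ext m; simp [incrCoeff]

theorem incrCoeff_succ (f : E d → V) (n : ℕ) (x : E d) :
    incrCoeff f (n + 1) x = ((n + 1).factorial : ℝ)⁻¹ • iteratedFDeriv ℝ (n + 1) f x := by
  have h1 : fderiv ℝ (fun u => f (x + u) - f x) = fderiv ℝ (fun u => f (x + u)) := by
    ext1 u; rw [fderiv_sub_const]
  have h2 : iteratedFDeriv ℝ (n + 1) (fun u => f (x + u) - f x) 0 =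
      iteratedFDeriv ℝ (n + 1) (fun u => f (x + u)) 0 := by
    ext m
    rw [iteratedFDeriv_succ_apply_right, iteratedFDeriv_succ_apply_right, h1]
  rw [incrCoeff, h2, iteratedFDeriv_comp_add_left, add_zero]

theorem incrCoeff_eq {f : E d → V} (hf : IsQuasiPeriodic f) (n : ℕ) {x y : E d}
    (h : proj x = proj y) : incrCoeff f n x = incrCoeff f n y := by
  have : (fun u => f (x + u) - f x) = fun u => f (y + u) - f y := funext fun u => hf.sub_eq h u
  rw [incrCoeff, incrCoeff, this]

/-- The increments of an analytic quasi-periodic function define an analytic superposition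
operator on Hölder functions. -/
theorem exists_torus_superposition [CompleteSpace V] {β : ℝ≥0} (hβ : β ≤ 1) {f : E d → V}
    (hf : AnalyticOnNhd ℝ f Set.univ) (hper : IsQuasiPeriodic f) :
    ∃ (N : Hol (gauge (T := Torus d) β) (E d) → Hol (gauge (T := Torus d) β) V)
      (N' : Hol (gauge (T := Torus d) β) (E d) →L[ℝ] Hol (gauge (T := Torus d) β) V),
      AnalyticAt ℝ N 0 ∧ N 0 = 0 ∧ HasFDerivAt N N' 0 ∧
      (∀ u ψ, N' u ψ = fderiv ℝ f (rep ψ) (u ψ)) ∧ ∀ᶠ u in 𝓝 0, ∀ ψ, N u ψ = incr f ψ (u ψ) := by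
  obtain ⟨S, hS, hrep⟩ := exists_isCompact_rep d
  obtain ⟨r, hr, K, C, hK, hC, hb⟩ := exists_taylor_bound_of_isCompact hf hS
  have hfac : ∀ n : ℕ, (0 : ℝ) < n.factorial := fun n => by exact_mod_cast n.factorial_pos
  have hbound : ∀ n x, ‖incrCoeff f n x‖ ≤ K * C ^ n := by
    intro n x
    rw [incrCoeff_eq hper n (proj_rep (proj x)).symm]
    cases n with
    | zero => rw [incrCoeff_zero, norm_zero]; positivity
    | succ n =>
      rw [incrCoeff_succ, norm_smul, norm_inv, Real.norm_eq_abs, abs_of_pos (hfac _),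
        inv_mul_le_iff₀ (hfac _), mul_comm]
      exact (hb _ (hrep _)).1 (n + 1)
  have hderiv : ∀ n x, ‖iteratedFDeriv ℝ (n + 1) f x‖ ≤ (n + 1).factorial * (K * C ^ (n + 1)) := by
    intro n x
    have := hbound (n + 1) x
    rwa [incrCoeff_succ, norm_smul, norm_inv, Real.norm_eq_abs, abs_of_pos (hfac _),
        inv_mul_le_iff₀ (hfac _)] at this
  -- The derivative of the n-th Taylor coefficient is n + 1 times the next one in size; the factor n
  -- + 1 ≤ 2 ^ n is absorbed by replacing C with 2C.
  have hlip : ∀ n x y, ‖incrCoeff f n x - incrCoeff f n y‖ ≤ K * C * (2 * C) ^ n * ‖x - y‖ := by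
    intro n x y
    cases n with
    | zero => rw [incrCoeff_zero, incrCoeff_zero, sub_self, norm_zero]; positivity
    | succ n =>
      rw [incrCoeff_succ, incrCoeff_succ, ← smul_sub, norm_smul, norm_inv, Real.norm_eq_abs,
        abs_of_pos (hfac _), inv_mul_le_iff₀ (hfac _), ← mul_assoc]
      refine Convex.norm_image_sub_le_of_norm_fderiv_le (𝕜 := ℝ) (s := Set.univ) (fun z _ => ?_)
        (fun z _ => ?_) convex_univ (Set.mem_univ y) (Set.mem_univ x)
      · exact ((hf.iteratedFDeriv (n + 1)) z (Set.mem_univ z)).differentiableAt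
      · rw [norm_fderiv_iteratedFDeriv]
        refine (hderiv (n + 1) z).trans ?_
        have h2 : ((n + 1 + 1 : ℕ) : ℝ) ≤ 2 ^ (n + 1) := by
          exact_mod_cast Nat.lt_two_pow_self
        rw [Nat.factorial_succ (n + 1)]
        push_cast at h2 ⊢
        calc ((n : ℝ) + 1 + 1) * (n + 1).factorial * (K * C ^ (n + 1 + 1))
            ≤ 2 ^ (n + 1) * (n + 1).factorial * (K * C ^ (n + 1 + 1)) := by gcongr
          _ = _ := by rw [mul_pow]; ring
  have hq : ∀ n, ∃ q : Hol (gauge (T := Torus d) β) ((E d) [×n]→L[ℝ] V),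
      (∀ ψ, q ψ = incrCoeff f n (rep ψ)) ∧ ‖q‖ ≤ (2 * K + K * C) * (2 * C) ^ n := by
    intro n
    obtain ⟨q, hq1, hq2⟩ := exists_hol_of_lipschitz β hβ (fun ψ : Torus d => incrCoeff f n (rep ψ))
      (a := K * C ^ n) (b := K * C * (2 * C) ^ n) (by positivity) (by positivity)
      (fun ψ => hbound n _)
      (fun ψ ψ' => norm_sub_rep_le (hlip n) (fun x y hxy => incrCoeff_eq hper n hxy) ψ ψ')
    refine ⟨q, hq1, hq2.trans ?_⟩
    have : K * C ^ n ≤ K * (2 * C) ^ n := by gcongr; linarith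
    linarith
  choose q hq1 hq2 using hq
  obtain ⟨N, hN1, hN2⟩ := exists_superposition (fun ψ u => incr f ψ u) q (by positivity) hr hq2
    (fun ψ u hu => by
      have h1 := ((hb _ (hrep ψ)).2 u hu).sub (hasSum_ite_eq 0 (f (rep ψ)))
      have e : (fun n => q n ψ fun _ => u) = fun n =>
          ((n.factorial : ℝ)⁻¹ • iteratedFDeriv ℝ n f (rep ψ)) (fun _ => u) -
            if n = 0 then f (rep ψ) else 0 := by
        ext1 n
        rw [hq1]
        cases n with
        | zero => simp [incrCoeff_zero]
        | succ n => simp [incrCoeff_succ]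
      rw [e]
      exact h1)
  refine ⟨N, continuousMultilinearCurryFin1 ℝ (Hol (gauge (T := Torus d) β) (E d))
    (Hol (gauge (T := Torus d) β) V) (Hol.multilin (q 1)), hN1.analyticAt, ?_,
    hN1.hasFDerivAt, fun u ψ => ?_, hN2⟩
  · ext ψ
    rw [hN2.self_of_nhds ψ]
    simp [incr]
  · change q 1 ψ (fun _ => u ψ) = _
    rw [hq1, incrCoeff_succ]
    simp

end TorusSuperposition

section Implicit

variable {P X Y : Type*} [NormedAddCommGroup P] [NormedSpace ℝ P] [CompleteSpace P]
  [NormedAddCommGroup X] [NormedSpace ℝ X] [CompleteSpace X]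
  [NormedAddCommGroup Y] [NormedSpace ℝ Y] [CompleteSpace Y]

/-- The analytic implicit function theorem at the origin. -/
theorem exists_analytic_implicit {G : P × X → Y} (hG : AnalyticAt ℝ G (0, 0)) (hG0 : G (0, 0) = 0)
    (L : X →L[ℝ] Y) (hbij : Function.Bijective L) (hL : HasFDerivAt (fun x => G (0, x)) L 0) :
    ∃ φ : P → X, AnalyticAt ℝ φ 0 ∧ φ 0 = 0 ∧ ∀ᶠ p in 𝓝 (0 : P), G (p, φ p) = 0 := by
  set G' := fderiv ℝ G (0, 0)
  have hstrict : HasStrictFDerivAt G G' (0, 0) := hG.hasStrictFDerivAt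
  have hinr : ∀ x, G' (0, x) = L x := by
    have h1 : HasFDerivAt (fun x : X => G (0, x)) (G' ∘L ContinuousLinearMap.inr ℝ P X) 0 := by
      have h2 : HasFDerivAt (fun x : X => ((0 : P), x)) (ContinuousLinearMap.inr ℝ P X) 0 :=
        (ContinuousLinearMap.inr ℝ P X).hasFDerivAt
      exact HasFDerivAt.comp (g := G) (0 : X) hstrict.hasFDerivAt h2
    intro x
    rw [hL.unique h1]
    rfl
  let e₀ : P × X →L[ℝ] P × Y := (ContinuousLinearMap.fst ℝ P X).prod G'
  have hsplit : ∀ p x, G' (p, x) = G' (p, 0) + L x := fun p x => by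
    rw [← hinr, ← map_add]; simp
  have he₀ : Function.Bijective e₀ := by
    constructor
    · rw [injective_iff_map_eq_zero]
      rintro ⟨p, x⟩ h
      have h1 : p = 0 := congrArg Prod.fst h
      have h2 : G' (p, x) = 0 := congrArg Prod.snd h
      subst h1
      rw [hinr] at h2
      rw [(injective_iff_map_eq_zero L).1 hbij.1 x h2]
      rfl
    · rintro ⟨p, y⟩
      obtain ⟨x, hx⟩ := hbij.2 (y - G' (p, 0))
      refine ⟨(p, x), Prod.ext rfl ?_⟩
      change G' (p, x) = y
      rw [hsplit, hx]; abel
  let e : (P × X) ≃L[ℝ] (P × Y) := ContinuousLinearEquiv.ofBijective e₀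
    (LinearMap.ker_eq_bot.2 he₀.1) (LinearMap.range_eq_top.2 he₀.2)
  have hecoe : (e : P × X →L[ℝ] P × Y) = e₀ := ContinuousLinearEquiv.coe_ofBijective _ _ _
  -- Carrying the parameter along makes the differential invertible, so the local inverse `Θ.symm`
  -- is analytic. The solution is its second component on the slice y = 0.
  let Ψ : P × X → P × Y := fun z => (z.1, G z)
  have hΨ : HasStrictFDerivAt Ψ (e : P × X →L[ℝ] P × Y) (0, 0) := by
    rw [hecoe]; exact hasStrictFDerivAt_fst.prodMk hstrict
  have hΨa : AnalyticAt ℝ Ψ (0, 0) := analyticAt_fst.prod hG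
  let Θ := hΨ.toOpenPartialHomeomorph Ψ
  have hΘ : (Θ : P × X → P × Y) = Ψ := rfl
  have hmem : ((0 : P), (0 : X)) ∈ Θ.source := hΨ.mem_toOpenPartialHomeomorph_source
  have hΘ0 : Θ (0, 0) = (0, 0) := by rw [hΘ]; simp [Ψ, hG0]
  have hsymm : AnalyticAt ℝ Θ.symm (0, 0) := by
    rw [← hΘ0]
    exact Θ.analyticAt_symm' hmem hΨa hΨ.hasFDerivAt.fderiv
  have hinc : AnalyticAt ℝ (fun p : P => (p, (0 : Y))) 0 := analyticAt_id.prod analyticAt_const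
  refine ⟨fun p => (Θ.symm (p, 0)).2, ?_, ?_, ?_⟩
  · exact analyticAt_snd.comp (AnalyticAt.comp (g := Θ.symm) hsymm hinc)
  · change (Θ.symm (0, 0)).2 = 0
    rw [← hΘ0, Θ.left_inv hmem]
  · have htar : Θ.target ∈ 𝓝 ((0 : P), (0 : Y)) := by
      rw [← hΘ0]; exact Θ.open_target.mem_nhds (Θ.map_source hmem)
    filter_upwards [hinc.continuousAt.preimage_mem_nhds htar] with p hp
    have h1 : Ψ (Θ.symm (p, 0)) = (p, 0) := Θ.right_inv hp
    have h2 : (Θ.symm (p, 0)).1 = p := congrArg Prod.fst h1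
    have h3 : G (Θ.symm (p, 0)) = 0 := congrArg Prod.snd h1
    rwa [show Θ.symm (p, 0) = (p, (Θ.symm (p, 0)).2) from Prod.ext h2 rfl] at h3

end Implicit

section AnalyticFamilies

variable {d : ℕ} {V : Type*} [NormedAddCommGroup V] [NormedSpace ℝ V]

/-- A curve of Hölder functions that is analytic at `0` is an analytic family for every smaller
exponent, on every small interval. -/
theorem exists_isAnalyticHolder {β' : ℝ≥0}
    (f : ℝ → Hol (gauge (T := Torus d) β') V) (hf : AnalyticAt ℝ f 0) :
    ∃ r > 0, ∀ β ≤ β', ∀ ε₀ : ℝ, 0 < ε₀ → ε₀ ≤ r → IsAnalyticHolder β ε₀ (fun ε ψ => f ε ψ) := by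
  obtain ⟨p, R, hp⟩ := hf
  obtain ⟨s, hs0, hsR⟩ := ENNReal.lt_iff_exists_nnreal_btwn.1 hp.r_pos
  have hs0' : 0 < s := by exact_mod_cast hs0
  obtain ⟨K, hK, hKb⟩ := p.nnnorm_mul_pow_le_of_lt_radius (hsR.trans_le hp.r_le)
  -- The 3 comes from `holderNorm_le_of_le`; the growth rate s⁻¹ is admissible because ε₀ ≤ s.
  refine ⟨s, hs0', fun β hβ ε₀ hε0 hεs => ⟨fun n => p.coeff n, 3 * K, s⁻¹, ?_, fun n => ?_,
    fun ε hε ψ => ?_⟩⟩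
  · rw [NNReal.coe_inv, inv_mul_le_iff₀ (by exact_mod_cast hs0')]; simpa using hεs
  · refine (holderNorm_le_of_le hβ (p.coeff n)).trans ?_
    rw [ENNReal.coe_le_coe, mul_assoc]
    gcongr
    have h1 : ‖p.coeff n‖₊ ≤ ‖p n‖₊ := by
      have := (p n).le_opNorm (fun _ => (1 : ℝ))
      simp only [norm_one, Finset.prod_const_one, mul_one] at this
      exact this
    rw [inv_pow, ← div_eq_mul_inv, le_div_iff₀ (by positivity)]
    exact (mul_le_mul_left h1 _).trans (hKb n)
  · have hmem : ε ∈ Metric.eball (0 : ℝ) R := by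
      rw [Metric.mem_eball, edist_zero_right]
      refine lt_trans ?_ hsR
      rw [enorm_eq_nnnorm, ENNReal.coe_lt_coe]
      exact hε.trans_le hεs
    have h1 := hp.hasSum hmem
    rw [zero_add] at h1
    have h2 := h1.mapL (Hol.eval ψ)
    simp only [FormalMultilinearSeries.apply_eq_pow_smul_coeff, Hol.eval_apply,
      Hol.smul_apply] at h2
    exact h2

end AnalyticFamilies

/-! ### Lifts of torus maps, the chain rule, and cocycles of eigenvalues. -/

section Lifts

variable {d : ℕ}

/-- Quasi-periodicity is automatic: the derivative of the lift is `tderiv f`, a function on the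
torus, hence periodic. -/
theorem IsAnalyticMap.exists_lift {f : Torus d → Torus d} (hf : IsAnalyticMap f) :
    ∃ g : E d → E d, AnalyticOnNhd ℝ g Set.univ ∧ (∀ x, proj (g x) = f (proj x)) ∧
      IsQuasiPeriodic g ∧ ∀ x, tderiv f (proj x) = fderiv ℝ g x := by
  obtain ⟨g, hg, hgf⟩ := hf
  have ht : ∀ x, tderiv f (proj x) = fderiv ℝ g x := fun x =>
    tderiv_eq_of_lift hgf (hg x (Set.mem_univ x)).continuousAt
  refine ⟨g, hg, hgf, ?_, ht⟩
  exact isQuasiPeriodic_of_fderiv_eq (AnalyticOnNhd.differentiable_univ hg) fun x y hxy => by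
    rw [← ht, ← ht, hxy]

theorem IsAnalyticMap.comp {f f' : Torus d → Torus d} (hf : IsAnalyticMap f)
    (hf' : IsAnalyticMap f') : IsAnalyticMap (f ∘ f') := by
  obtain ⟨g, hg, hgf⟩ := hf
  obtain ⟨g', hg', hgf'⟩ := hf'
  refine ⟨g ∘ g', fun x _ => (hg _ (Set.mem_univ _)).comp (hg' x (Set.mem_univ _)), fun x => ?_⟩
  simp [hgf, hgf']

theorem isAnalyticMap_id : IsAnalyticMap (id : Torus d → Torus d) :=
  ⟨id, fun _ _ => analyticAt_id, fun _ => rfl⟩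

theorem tderiv_comp {f f' : Torus d → Torus d} (hf : IsAnalyticMap f)
    (hf' : IsAnalyticMap f') (ψ : Torus d) :
    tderiv (f ∘ f') ψ = tderiv f (f' ψ) ∘L tderiv f' ψ := by
  obtain ⟨g, hg, hgf, -, hgt⟩ := hf.exists_lift
  obtain ⟨g', hg', hgf', -, hgt'⟩ := hf'.exists_lift
  have hc : ∀ x, proj ((g ∘ g') x) = (f ∘ f') (proj x) := fun x => by simp [hgf, hgf']
  have hd := hg (g' (rep ψ)) (Set.mem_univ _)
  have hd' := hg' (rep ψ) (Set.mem_univ _)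
  have h1 := tderiv_eq_of_lift hc (x := rep ψ)
    (ContinuousAt.comp (g := g) hd.continuousAt hd'.continuousAt)
  rw [fderiv_comp _ hd.differentiableAt hd'.differentiableAt, ← hgt, ← hgt', hgf', proj_rep] at h1
  exact h1

theorem tderiv_id (ψ : Torus d) :
    tderiv (id : Torus d → Torus d) ψ = ContinuousLinearMap.id ℝ _ := by
  have := tderiv_eq_of_lift (f := id) (g := id) (fun x => rfl) (x := rep ψ) continuousAt_id
  rwa [proj_rep, fderiv_id] at this

theorem IsAnalyticMap.exists_lipschitz {f : Torus d → Torus d} (hf : IsAnalyticMap f) :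
    ∃ L : ℝ≥0, LipschitzWith L f := by
  obtain ⟨g, hg, hgf, hper, -⟩ := hf.exists_lift
  obtain ⟨L, hL⟩ := exists_lipschitz_of_quasiPeriodic hg hper
  refine ⟨L, LipschitzWith.of_dist_le_mul fun ψ ψ' => ?_⟩
  have h1 : f ψ = proj (g (rep ψ' + rep (ψ - ψ'))) := by
    rw [hgf, proj_add, proj_rep, proj_rep]; congr 1; abel
  have h2 : f ψ' = proj (g (rep ψ')) := by rw [hgf, proj_rep]
  rw [h1, h2, dist_eq_norm, ← proj_sub, dist_eq_norm_rep]
  refine (norm_proj_le _).trans ?_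
  have := hL.dist_le_mul (rep ψ' + rep (ψ - ψ')) (rep ψ')
  rwa [dist_eq_norm, dist_eq_norm, add_sub_cancel_left] at this

variable {A : Equiv.Perm (Torus d)}

theorem isAnalyticMap_pow (hA : IsAnalyticMap A) (n : ℕ) :
    IsAnalyticMap (A ^ n : Equiv.Perm (Torus d)) := by
  induction n with
  | zero => exact isAnalyticMap_id
  | succ n ih => rw [pow_succ]; exact ih.comp hA

theorem tderiv_pow_succ (hA : IsAnalyticMap A) (n : ℕ) (ψ : Torus d) :
    tderiv (A ^ (n + 1) : Equiv.Perm (Torus d)) ψ =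
      tderiv A ((A ^ n : Equiv.Perm (Torus d)) ψ) ∘L tderiv (A ^ n : Equiv.Perm (Torus d)) ψ := by
  rw [pow_succ']
  exact tderiv_comp hA (isAnalyticMap_pow hA n) ψ

theorem tderiv_inv_pow_tderiv_pow (hA : IsAnalyticMap A) (hA' : IsAnalyticMap (A⁻¹ : Equiv.Perm _))
    (n : ℕ) (ψ : Torus d) (w : E d) :
    tderiv (A⁻¹ ^ n : Equiv.Perm (Torus d)) ((A ^ n : Equiv.Perm (Torus d)) ψ)
      (tderiv (A ^ n : Equiv.Perm (Torus d)) ψ w) = w := by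
  have h := tderiv_comp (isAnalyticMap_pow hA' n) (isAnalyticMap_pow hA n) ψ
  have h1 : (⇑(A⁻¹ ^ n) ∘ ⇑(A ^ n) : Torus d → Torus d) = id := by
    rw [← Equiv.Perm.coe_mul, inv_pow, inv_mul_cancel]; rfl
  rw [h1, tderiv_id] at h
  exact (congrArg (fun D : E d →L[ℝ] E d => D w) h).symm

theorem tderiv_inv_tderiv (hA : IsAnalyticMap A) (hA' : IsAnalyticMap (A⁻¹ : Equiv.Perm _))
    (ψ : Torus d) (w : E d) :
    tderiv (A⁻¹ : Equiv.Perm (Torus d)) (A ψ) (tderiv A ψ w) = w := by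
  simpa using tderiv_inv_pow_tderiv_pow hA hA' 1 ψ w

theorem cocycle_succ (A : Equiv.Perm (Torus d)) (Λ : Torus d → ℝ) (n : ℕ) (ψ : Torus d) :
    cocycle A Λ (n + 1) ψ = cocycle A Λ n ψ * Λ ((A ^ n : Equiv.Perm (Torus d)) ψ) :=
  Finset.prod_range_succ _ _

theorem tderiv_pow_apply (hA : IsAnalyticMap A) {v : Torus d → E d} {Λ : Torus d → ℝ}
    (heq : ∀ ψ, tderiv A ψ (v ψ) = Λ ψ • v (A ψ)) (n : ℕ) (ψ : Torus d) :
    tderiv (A ^ n : Equiv.Perm (Torus d)) ψ (v ψ) =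
      cocycle A Λ n ψ • v ((A ^ n : Equiv.Perm (Torus d)) ψ) := by
  induction n with
  | zero =>
    rw [pow_zero, show ⇑(1 : Equiv.Perm (Torus d)) = id from rfl, tderiv_id]
    simp [cocycle]
  | succ n ih =>
    rw [tderiv_pow_succ hA, ContinuousLinearMap.comp_apply, ih, map_smul, heq, smul_smul,
      cocycle_succ, pow_succ', Equiv.Perm.mul_apply]

theorem eigenvalue_ne_zero (hA : IsAnalyticMap A) (hA' : IsAnalyticMap (A⁻¹ : Equiv.Perm _))
    {v : Torus d → E d} {Λ : Torus d → ℝ} (hv : ∀ ψ, v ψ ≠ 0)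
    (heq : ∀ ψ, tderiv A ψ (v ψ) = Λ ψ • v (A ψ)) (ψ : Torus d) : Λ ψ ≠ 0 := by
  intro h
  have h1 := tderiv_inv_tderiv hA hA' ψ (v ψ)
  rw [heq, h, zero_smul, map_zero] at h1
  exact hv ψ h1.symm

theorem cocycle_ne_zero {Λ : Torus d → ℝ} (h : ∀ ψ, Λ ψ ≠ 0) (n : ℕ) (ψ : Torus d) :
    cocycle A Λ n ψ ≠ 0 := Finset.prod_ne_zero_iff.2 fun _ _ => h _

theorem cocycle_eq_iterate (A : Equiv.Perm (Torus d)) (Λ : Torus d → ℝ) (n : ℕ) (ψ : Torus d) :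
    cocycle A Λ n ψ = ∏ j ∈ Finset.range n, Λ (A^[j] ψ) := by
  simp only [cocycle, Equiv.Perm.iterate_eq_pow]

theorem cocycle_inv (A : Equiv.Perm (Torus d)) (Λ : Torus d → ℝ) (n : ℕ) (ψ : Torus d) :
    cocycle A⁻¹ (fun φ => (Λ (A⁻¹ φ))⁻¹) n ψ =
      (cocycle A Λ n ((A⁻¹ ^ n : Equiv.Perm (Torus d)) ψ))⁻¹ := by
  rw [cocycle_eq_iterate, cocycle_eq_iterate, prod_range_inv_pow A (fun φ => (Λ φ)⁻¹),
    Finset.prod_inv_distrib, Equiv.Perm.iterate_eq_pow A⁻¹ n]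

theorem eigen_inv (hA : IsAnalyticMap A) (hA' : IsAnalyticMap (A⁻¹ : Equiv.Perm _))
    {v : Torus d → E d} {Λ : Torus d → ℝ} (hv : ∀ ψ, v ψ ≠ 0)
    (heq : ∀ ψ, tderiv A ψ (v ψ) = Λ ψ • v (A ψ)) (ψ : Torus d) :
    tderiv (A⁻¹ : Equiv.Perm (Torus d)) ψ (v ψ) = (Λ (A⁻¹ ψ))⁻¹ • v (A⁻¹ ψ) := by
  have h1 := tderiv_inv_tderiv hA hA' (A⁻¹ ψ) (v (A⁻¹ ψ))
  rw [heq, map_smul, show A (A⁻¹ ψ) = ψ by simp] at h1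
  rw [← h1, smul_smul, inv_mul_cancel₀ (eigenvalue_ne_zero hA hA' hv heq _), one_smul]

end Lifts

/-! ### Stable and unstable eigendirections. -/

section Hyperbolic

variable {d : ℕ} {A : Equiv.Perm (Torus d)} {Ws Wu : Torus d → Submodule ℝ (E d)}

/-- Time reversal: every result on the stable bundle gives one on the unstable bundle. -/
theorem IsHyperbolicSplitting.symm (hs : IsHyperbolicSplitting A Ws Wu) (hA : IsAnalyticMap A)
    (hA' : IsAnalyticMap (A⁻¹ : Equiv.Perm _)) : IsHyperbolicSplitting A⁻¹ Wu Ws := by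
  have key : ∀ W : Torus d → Submodule ℝ (E d),
      (∀ ψ, (W ψ).map (tderiv A ψ).toLinearMap = W (A ψ)) →
      ∀ ψ, (W ψ).map (tderiv (A⁻¹ : Equiv.Perm (Torus d)) ψ).toLinearMap = W (A⁻¹ ψ) := by
    intro W hW ψ
    have h1 := hW (A⁻¹ ψ)
    have h2 : A (A⁻¹ ψ) = ψ := by simp
    rw [h2] at h1
    rw [← h1, ← Submodule.map_comp]
    have h3 : (tderiv (A⁻¹ : Equiv.Perm (Torus d)) ψ).toLinearMap ∘ₗ
        (tderiv A (A⁻¹ ψ)).toLinearMap = LinearMap.id := by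
      ext1 w
      have := tderiv_inv_tderiv hA hA' (A⁻¹ ψ) w
      rw [h2] at this
      exact this
    rw [h3, Submodule.map_id]
  obtain ⟨ds, du, hdim⟩ := hs.dim_const
  obtain ⟨Θ, l, hΘ, hl0, hl1, h⟩ := hs.hyperbolic
  exact ⟨fun ψ => (hs.isCompl ψ).symm, ⟨du, ds, fun ψ => (hdim ψ).symm⟩, key _ hs.invariant_u,
    key _ hs.invariant_s, hs.continuous_u, hs.continuous_s,
    ⟨Θ, l, hΘ, hl0, hl1, fun n ψ => by
      rw [inv_inv]
      exact ⟨(h n ψ).2, (h n ψ).1⟩⟩⟩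

theorem IsHyperbolicSplitting.tderiv_pow_mem (hs : IsHyperbolicSplitting A Ws Wu)
    (hA : IsAnalyticMap A) (n : ℕ) (ψ : Torus d) {w : E d} (hw : w ∈ Wu ψ) :
    tderiv (A ^ n : Equiv.Perm (Torus d)) ψ w ∈ Wu ((A ^ n : Equiv.Perm (Torus d)) ψ) := by
  induction n with
  | zero =>
    rw [pow_zero, show ⇑(1 : Equiv.Perm (Torus d)) = id from rfl, tderiv_id]
    exact hw
  | succ n ih =>
    rw [tderiv_pow_succ hA, ContinuousLinearMap.comp_apply, pow_succ', Equiv.Perm.mul_apply,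
      ← hs.invariant_u]
    exact Submodule.mem_map_of_mem ih

variable {v : Torus d → E d} {Λ : Torus d → ℝ}

theorem exists_bounds_of_continuous (hv : Continuous v) (hv0 : ∀ ψ, v ψ ≠ 0) :
    ∃ m M : ℝ, 0 < m ∧ 0 < M ∧ ∀ ψ, m ≤ ‖v ψ‖ ∧ ‖v ψ‖ ≤ M := by
  obtain ⟨ψ₁, -, h₁⟩ := isCompact_univ.exists_isMinOn (Set.univ_nonempty (α := Torus d))
    hv.norm.continuousOn
  obtain ⟨ψ₂, -, h₂⟩ := isCompact_univ.exists_isMaxOn (Set.univ_nonempty (α := Torus d))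
    hv.norm.continuousOn
  exact ⟨‖v ψ₁‖, ‖v ψ₂‖, norm_pos_iff.2 (hv0 _), norm_pos_iff.2 (hv0 _),
    fun ψ => ⟨h₁ (Set.mem_univ ψ), h₂ (Set.mem_univ ψ)⟩⟩

/-- If an eigendirection is not stable at some point, its rate blows up there, and the
unstable part of its image dominates. -/
theorem IsHyperbolicSplitting.tendsto_cocycle (hs : IsHyperbolicSplitting A Ws Wu)
    (hA : IsAnalyticMap A) (hA' : IsAnalyticMap (A⁻¹ : Equiv.Perm _)) (hv : Continuous v)
    (hv0 : ∀ ψ, v ψ ≠ 0) (heq : ∀ ψ, tderiv A ψ (v ψ) = Λ ψ • v (A ψ)) {ψ : Torus d}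
    (hψ : v ψ ∉ Ws ψ) : Tendsto (fun n => |cocycle A Λ n ψ|) atTop atTop := by
  obtain ⟨Θ, l, hΘ, hl0, hl1, h⟩ := hs.hyperbolic
  obtain ⟨m, M, hm, hM, hb⟩ := exists_bounds_of_continuous hv hv0
  obtain ⟨s, hsW, u, huW, hsu⟩ := Submodule.mem_sup.1
    ((hs.isCompl ψ).sup_eq_top ▸ Submodule.mem_top : v ψ ∈ Ws ψ ⊔ Wu ψ)
  have hu0 : u ≠ 0 := fun h0 => hψ (by rw [← hsu, h0, add_zero]; exact hsW)
  -- Backward contraction on `Wu`, read forwards, makes the image of u at least of order l⁻ⁿ, while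
  -- the image of s stays bounded. Division by M, the maximal length of v, leaves the cocycle.
  have hlow : ∀ n : ℕ, (‖u‖ / Θ * (l⁻¹) ^ n - Θ * ‖s‖) / M ≤ |cocycle A Λ n ψ| := by
    intro n
    have h1 : ‖u‖ ≤ Θ * l ^ n * ‖tderiv (A ^ n : Equiv.Perm (Torus d)) ψ u‖ := by
      have := (h n ((A ^ n : Equiv.Perm (Torus d)) ψ)).2 _ (hs.tderiv_pow_mem hA n ψ huW)
      rwa [tderiv_inv_pow_tderiv_pow hA hA'] at this
    have h2 : ‖tderiv (A ^ n : Equiv.Perm (Torus d)) ψ s‖ ≤ Θ * ‖s‖ := by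
      refine ((h n ψ).1 s hsW).trans ?_
      gcongr
      exact mul_le_of_le_one_right hΘ.le (pow_le_one₀ hl0.le hl1.le)
    have h3 : ‖u‖ / Θ * (l⁻¹) ^ n ≤ ‖tderiv (A ^ n : Equiv.Perm (Torus d)) ψ u‖ := by
      rw [inv_pow, ← div_eq_mul_inv, div_div, div_le_iff₀ (by positivity), mul_comm]
      exact h1
    have h4 := tderiv_pow_apply hA heq n ψ
    have h5 : tderiv (A ^ n : Equiv.Perm (Torus d)) ψ u =
        cocycle A Λ n ψ • v ((A ^ n : Equiv.Perm (Torus d)) ψ) -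
          tderiv (A ^ n : Equiv.Perm (Torus d)) ψ s := by
      rw [← h4, ← hsu, map_add]; abel
    rw [div_le_iff₀ hM]
    have h6 : ‖tderiv (A ^ n : Equiv.Perm (Torus d)) ψ u‖ ≤ |cocycle A Λ n ψ| * M + Θ * ‖s‖ := by
      rw [h5]
      refine (norm_sub_le _ _).trans (add_le_add ?_ h2)
      rw [norm_smul, Real.norm_eq_abs]
      gcongr
      exact (hb _).2
    linarith
  refine tendsto_atTop_mono hlow ?_
  refine Tendsto.atTop_div_const hM (tendsto_atTop_add_const_right _ _ ?_)
  exact (tendsto_pow_atTop_atTop_of_one_lt ((one_lt_inv₀ hl0).2 hl1)).const_mul_atTop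
    (div_pos (norm_pos_iff.2 hu0) hΘ)

/-- An eigendirection that is not everywhere stable is unstable somewhere. -/
theorem IsHyperbolicSplitting.exists_mem_unstable (hs : IsHyperbolicSplitting A Ws Wu)
    (hA : IsAnalyticMap A) (hA' : IsAnalyticMap (A⁻¹ : Equiv.Perm _)) (hv : Continuous v)
    (hv0 : ∀ ψ, v ψ ≠ 0) (heq : ∀ ψ, tderiv A ψ (v ψ) = Λ ψ • v (A ψ)) {ψ : Torus d}
    (hψ : v ψ ∉ Ws ψ) : ∃ φ, v φ ∈ Wu φ := by
  by_contra hcon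
  push Not at hcon
  -- If v were never unstable, this component orthogonal to `Wu` would be bounded below by
  -- compactness. Along the orbit of ψ, cocycle times w comes from the stable part of v ψ alone and
  -- is bounded, so the cocycle could not blow up.
  let w : Torus d → E d := fun φ => v φ - (Wu φ).starProjection (v φ)
  have hw : Continuous w := hv.sub (hs.continuous_u.clm_apply hv)
  have hw0 : ∀ φ, w φ ≠ 0 := fun φ h0 => hcon φ (by
    rw [sub_eq_zero.1 h0]; exact Submodule.starProjection_apply_mem _ _)
  obtain ⟨m, M, hm, hM, hb⟩ := exists_bounds_of_continuous hw hw0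
  obtain ⟨Θ, l, hΘ, hl0, hl1, h⟩ := hs.hyperbolic
  obtain ⟨s, hsW, u, huW, hsu⟩ := Submodule.mem_sup.1
    ((hs.isCompl ψ).sup_eq_top ▸ Submodule.mem_top : v ψ ∈ Ws ψ ⊔ Wu ψ)
  have hle : ∀ n : ℕ, |cocycle A Λ n ψ| ≤ 2 * (Θ * ‖s‖) / m := by
    intro n
    set φ := (A ^ n : Equiv.Perm (Torus d)) ψ
    have h2 : ‖tderiv (A ^ n : Equiv.Perm (Torus d)) ψ s‖ ≤ Θ * ‖s‖ := by
      refine ((h n ψ).1 s hsW).trans ?_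
      gcongr
      exact mul_le_of_le_one_right hΘ.le (pow_le_one₀ hl0.le hl1.le)
    have h4 := tderiv_pow_apply hA heq n ψ
    have h5 : cocycle A Λ n ψ • v φ = tderiv (A ^ n : Equiv.Perm (Torus d)) ψ s +
        tderiv (A ^ n : Equiv.Perm (Torus d)) ψ u := by
      rw [← h4, ← map_add, hsu]
    have h6 : (Wu φ).starProjection (tderiv (A ^ n : Equiv.Perm (Torus d)) ψ u) =
        tderiv (A ^ n : Equiv.Perm (Torus d)) ψ u :=
      Submodule.starProjection_eq_self_iff.2 (hs.tderiv_pow_mem hA n ψ huW)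
    have h7 : cocycle A Λ n ψ • w φ = tderiv (A ^ n : Equiv.Perm (Torus d)) ψ s -
        (Wu φ).starProjection (tderiv (A ^ n : Equiv.Perm (Torus d)) ψ s) := by
      simp only [w]
      rw [smul_sub, ← map_smul, h5, map_add, h6]; abel
    have h8 : |cocycle A Λ n ψ| * ‖w φ‖ ≤ 2 * (Θ * ‖s‖) := by
      rw [← Real.norm_eq_abs, ← norm_smul, h7]
      refine (norm_sub_le _ _).trans ?_
      have := (Wu φ).norm_starProjection_apply_le (tderiv (A ^ n : Equiv.Perm (Torus d)) ψ s)
      linarith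
    rw [le_div_iff₀ hm]
    exact (mul_le_mul_of_nonneg_left (hb φ).1 (abs_nonneg _)).trans h8
  have ht := hs.tendsto_cocycle hA hA' hv hv0 heq hψ
  obtain ⟨n, hn⟩ := (ht.eventually_gt_atTop (2 * (Θ * ‖s‖) / m)).exists
  exact absurd (hle n) (not_le.2 hn)

/-- The rate of an everywhere stable direction is eventually contracting. -/
theorem IsHyperbolicSplitting.exists_contraction (hs : IsHyperbolicSplitting A Ws Wu)
    (hA : IsAnalyticMap A) (hv : Continuous v)
    (hv0 : ∀ ψ, v ψ ≠ 0) (heq : ∀ ψ, tderiv A ψ (v ψ) = Λ ψ • v (A ψ))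
    (hmem : ∀ ψ, v ψ ∈ Ws ψ) : ∃ n : ℕ, ∀ ψ, |cocycle A Λ n ψ| ≤ 1 / 2 := by
  obtain ⟨Θ, l, hΘ, hl0, hl1, h⟩ := hs.hyperbolic
  obtain ⟨m, M, hm, hM, hb⟩ := exists_bounds_of_continuous hv hv0
  have hlim : Tendsto (fun n : ℕ => Θ * l ^ n * M / m) atTop (𝓝 0) := by
    have := (((tendsto_pow_atTop_nhds_zero_of_lt_one hl0.le hl1).const_mul Θ).mul_const
      M).div_const m
    simpa using this
  obtain ⟨n, hn⟩ := (hlim.eventually_lt_const (by norm_num : (0 : ℝ) < 1 / 2)).exists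
  refine ⟨n, fun ψ => le_trans ?_ hn.le⟩
  rw [le_div_iff₀ hm]
  have h1 := (h n ψ).1 _ (hmem ψ)
  rw [tderiv_pow_apply hA heq, norm_smul, Real.norm_eq_abs] at h1
  calc |cocycle A Λ n ψ| * m ≤ |cocycle A Λ n ψ| * ‖v ((A ^ n : Equiv.Perm (Torus d)) ψ)‖ := by
        gcongr; exact (hb _).1
    _ ≤ Θ * l ^ n * ‖v ψ‖ := h1
    _ ≤ Θ * l ^ n * M := by gcongr; exact (hb _).2

end Hyperbolic

/-! ### Domination makes each eigendirection purely stable or purely unstable. -/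

section Purity

variable {d : ℕ} {A : Equiv.Perm (Torus d)}

/-- The gaps between neighbours multiply. Because the hypothesis is a product of two suprema, the
rates may be compared at two unrelated points, which `stable_or_unstable` needs. -/
theorem IsDominated.exists_lt {Λ : Fin d → Torus d → ℝ} (h : IsDominated A Λ)
    (hΛ : ∀ i ψ, Λ i ψ ≠ 0) : ∃ N₀ : ℕ, ∀ n > N₀, ∀ i j : Fin d, i < j →
      ∃ κ : ℝ, 0 ≤ κ ∧ κ < 1 ∧ ∀ ψ φ, |cocycle A (Λ i) n ψ| ≤ κ * |cocycle A (Λ j) n φ| := by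
  obtain ⟨N₀, h⟩ := h
  refine ⟨N₀, fun n hn => ?_⟩
  have base : ∀ i j : Fin d, (i : ℕ) + 1 = j →
      ∃ κ : ℝ, 0 ≤ κ ∧ κ < 1 ∧ ∀ ψ φ, |cocycle A (Λ i) n ψ| ≤ κ * |cocycle A (Λ j) n φ| := by
    intro i j hij
    have h1 := h n hn i j hij
    refine ⟨_, ENNReal.toReal_nonneg, (ENNReal.toReal_lt_of_lt_ofReal (by simpa using h1)),
      fun ψ φ => ?_⟩
    have h2 : ‖cocycle A (Λ i) n ψ‖ₑ * ‖(cocycle A (Λ j) n φ)⁻¹‖ₑ ≤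
        supNorm (cocycle A (Λ i) n) * supNorm (fun ψ => (cocycle A (Λ j) n ψ)⁻¹) :=
      mul_le_mul' (le_iSup (fun ψ => ‖cocycle A (Λ i) n ψ‖ₑ) ψ)
        (le_iSup (fun φ => ‖(cocycle A (Λ j) n φ)⁻¹‖ₑ) φ)
    have h3 := ENNReal.toReal_mono (h1.trans ENNReal.one_lt_top).ne h2
    rw [ENNReal.toReal_mul, toReal_enorm, toReal_enorm, norm_inv, Real.norm_eq_abs,
      Real.norm_eq_abs, ← div_eq_mul_inv,
      div_le_iff₀ (abs_pos.2 (cocycle_ne_zero (hΛ j) n φ))] at h3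
    exact h3
  have ind : ∀ (k : ℕ) (i j : Fin d), (i : ℕ) + (k + 1) = j →
      ∃ κ : ℝ, 0 ≤ κ ∧ κ < 1 ∧ ∀ ψ φ, |cocycle A (Λ i) n ψ| ≤ κ * |cocycle A (Λ j) n φ| := by
    intro k
    induction k with
    | zero => intro i j hij; exact base i j hij
    | succ k ih =>
      intro i j hij
      obtain ⟨κ, hκ0, hκ1, hκ⟩ := ih i ⟨i + (k + 1), by omega⟩ rfl
      obtain ⟨κ', hκ0', hκ1', hκ'⟩ := base ⟨i + (k + 1), by omega⟩ j hij
      refine ⟨κ * κ', by positivity, mul_lt_one_of_nonneg_of_lt_one_left hκ0 hκ1 hκ1'.le,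
        fun ψ φ => (hκ ψ φ).trans ?_⟩
      rw [mul_assoc]
      gcongr
      exact hκ' φ φ
  intro i j hij
  exact ind (j - i - 1) i j (by have : (i : ℕ) < j := hij; omega)

theorem card_le_finrank_of_mem {v : Fin d → E d} (hv : LinearIndependent ℝ v) (p : Fin d → Prop)
    [DecidablePred p] (W : Submodule ℝ (E d)) (h : ∀ k, p k → v k ∈ W) :
    Fintype.card {k // p k} ≤ Module.finrank ℝ W := by
  have h1 : LinearIndependent ℝ (fun k : {k // p k} => v k) :=
    hv.comp _ Subtype.val_injective
  have h2 : LinearIndependent ℝ (fun k : {k // p k} => (⟨v k, h k k.2⟩ : W)) :=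
    LinearIndependent.of_comp W.subtype h1
  exact h2.fintype_card_le_finrank

/-- Under the domination condition every eigendirection is stable everywhere or unstable
everywhere. -/
theorem IsHyperbolicSplitting.stable_or_unstable {Ws Wu : Torus d → Submodule ℝ (E d)}
    (hs : IsHyperbolicSplitting A Ws Wu) (hA : IsAnalyticMap A)
    (hA' : IsAnalyticMap (A⁻¹ : Equiv.Perm _)) {v : Fin d → Torus d → E d}
    {Λ : Fin d → Torus d → ℝ} (hv : ∀ i, Continuous (v i))
    (hli : ∀ ψ, LinearIndependent ℝ (fun i => v i ψ))
    (heq : ∀ i ψ, tderiv A ψ (v i ψ) = Λ i ψ • v i (A ψ)) (hdom : IsDominated A Λ) (i : Fin d) :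
    (∀ ψ, v i ψ ∈ Ws ψ) ∨ ∀ ψ, v i ψ ∈ Wu ψ := by
  have hv0 : ∀ i ψ, v i ψ ≠ 0 := fun i ψ => (hli ψ).ne_zero i
  have hΛ : ∀ i ψ, Λ i ψ ≠ 0 := fun i => eigenvalue_ne_zero hA hA' (hv0 i) (heq i)
  obtain ⟨N₀, hN⟩ := hdom.exists_lt hΛ
  have heq' := fun i => eigen_inv hA hA' (hv0 i) (heq i)
  have hA'' : IsAnalyticMap ((A⁻¹)⁻¹ : Equiv.Perm (Torus d)) := by rwa [inv_inv]
  -- Otherwise the i-th rate blows up from ψ onwards while the k-th rate over the n steps ending at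
  -- φ tends to 0, against domination.
  have key : ∀ i k : Fin d, i < k → ∀ ψ φ, v i ψ ∉ Ws ψ → v k φ ∉ Wu φ → False := by
    intro i k hik ψ φ hψ hφ
    have h1 := hs.tendsto_cocycle hA hA' (hv i) (hv0 i) (heq i) hψ
    have h2 := (hs.symm hA hA').tendsto_cocycle hA' hA'' (hv k) (hv0 k) (heq' k) hφ
    obtain ⟨n, h3, h4, h5⟩ := ((h1.eventually_gt_atTop 1).and
      ((h2.eventually_gt_atTop 1).and (eventually_gt_atTop N₀))).exists
    obtain ⟨κ, hκ0, hκ1, hκ⟩ := hN n h5 i k hik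
    have h6 := hκ ψ ((A⁻¹ ^ n : Equiv.Perm (Torus d)) φ)
    rw [cocycle_inv, abs_inv] at h4
    have h7 : |cocycle A (Λ k) n ((A⁻¹ ^ n : Equiv.Perm (Torus d)) φ)| < 1 := by
      by_contra h8
      push Not at h8
      exact absurd h4 (not_lt.2 (inv_le_one_of_one_le₀ h8))
    nlinarith [abs_nonneg (cocycle A (Λ k) n ((A⁻¹ ^ n : Equiv.Perm (Torus d)) φ))]
  by_contra hcon
  push Not at hcon
  obtain ⟨⟨ψ₁, h₁⟩, ⟨ψ₂, h₂⟩⟩ := hcon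
  obtain ⟨φ₁, hφ₁⟩ := hs.exists_mem_unstable hA hA' (hv i) (hv0 i) (heq i) h₁
  obtain ⟨φ₂, hφ₂⟩ := (hs.symm hA hA').exists_mem_unstable hA' hA'' (hv i) (hv0 i) (heq' i) h₂
  obtain ⟨ds, du, hdim⟩ := hs.dim_const
  -- By `key` all later directions are unstable and all earlier ones stable. Counting vᵢ as unstable
  -- at φ₁ and as stable at φ₂ gives (d - i) + (i + 1) ≤ du + ds = d, which is absurd.
  have hu : Fintype.card {k : Fin d // i ≤ k} ≤ du := by
    rw [← (hdim φ₁).2]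
    refine card_le_finrank_of_mem (hli φ₁) _ _ fun k hk => ?_
    rcases hk.eq_or_lt with rfl | hk
    · exact hφ₁
    · by_contra h; exact key i k hk _ _ h₁ h
  have hs' : Fintype.card {k : Fin d // k ≤ i} ≤ ds := by
    rw [← (hdim φ₂).1]
    refine card_le_finrank_of_mem (hli φ₂) _ _ fun k hk => ?_
    rcases hk.eq_or_lt with rfl | hk
    · exact hφ₂
    · by_contra h; exact key k i hk _ _ h h₂
  have hsum : ds + du = d := by
    have := Submodule.finrank_add_eq_of_isCompl (hs.isCompl φ₁)
    rw [(hdim φ₁).1, (hdim φ₁).2] at this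
    simpa using this
  rw [Fintype.card_of_subtype (Finset.Ici i) (by simp), Fin.card_Ici] at hu
  rw [Fintype.card_of_subtype (Finset.Iic i) (by simp), Fin.card_Iic] at hs'
  have := i.2
  omega

end Purity

/-! ### Quasi-Newton scheme, and twisted operators on bounded functions. -/

section QuasiNewton

variable {X Y : Type*} [NormedAddCommGroup X] [NormedSpace ℝ X] [CompleteSpace X]
  [NormedAddCommGroup Y] [NormedSpace ℝ Y]

/-- Existence and uniqueness of small zeros of a map close to an invertible linear one. -/
theorem exists_zero_and_unique (G : X → Y) (L : X →L[ℝ] Y) {C R : ℝ} (hC : 0 < C)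
    (hsurj : Function.Surjective L) (hL : ∀ a, ‖a‖ ≤ C * ‖L a‖)
    (happ : ∀ a b, ‖a‖ ≤ R → ‖b‖ ≤ R → ‖G a - G b - L (a - b)‖ ≤ (2 * C)⁻¹ * ‖a - b‖) :
    (∀ R', 0 ≤ R' → R' ≤ R → ‖G 0‖ ≤ (2 * C)⁻¹ * R' → ∃ a, ‖a‖ ≤ R' ∧ G a = 0) ∧
      ∀ a b, ‖a‖ ≤ R → ‖b‖ ≤ R → G a = 0 → G b = 0 → a = b := by
  constructor
  · intro R' hR'0 hR' hG0
    choose inv hinv using hsurj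
    -- The scheme only needs preimages of controlled size, so a pointwise choice suffices.
    let Linv : L.NonlinearRightInverse :=
      ⟨inv, ⟨C, hC.le⟩, fun y => by have := hL (inv y); rwa [hinv] at this, hinv⟩
    have h1 : ApproximatesLinearOn G L (Metric.closedBall 0 R') ⟨(2 * C)⁻¹, by positivity⟩ := by
      intro a ha b hb
      rw [mem_closedBall_zero_iff] at ha hb
      exact happ a b (ha.trans hR') (hb.trans hR')
    have h2 := h1.surjOn_closedBall_of_nonlinearRightInverse Linv hR'0 subset_rfl
    have h3 : (0 : Y) ∈ Metric.closedBall (G 0) (((Linv.nnnorm : ℝ)⁻¹ - (2 * C)⁻¹) * R') := by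
      rw [Metric.mem_closedBall, dist_eq_norm, zero_sub, norm_neg]
      change ‖G 0‖ ≤ (C⁻¹ - (2 * C)⁻¹) * R'
      have : C⁻¹ - (2 * C)⁻¹ = (2 * C)⁻¹ := by field_simp; norm_num
      rw [this]; exact hG0
    obtain ⟨a, ha, ha0⟩ := h2 h3
    exact ⟨a, mem_closedBall_zero_iff.1 ha, ha0⟩
  · intro a b ha hb hGa hGb
    have h1 := happ a b ha hb
    rw [hGa, hGb, sub_zero, zero_sub, norm_neg] at h1
    have h2 := hL (a - b)
    have h3 : ‖a - b‖ ≤ C * ((2 * C)⁻¹ * ‖a - b‖) := h2.trans (by gcongr)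
    have h4 : C * ((2 * C)⁻¹ * ‖a - b‖) = ‖a - b‖ / 2 := by field_simp
    have h5 : ‖a - b‖ = 0 := le_antisymm (by linarith) (norm_nonneg _)
    exact sub_eq_zero.1 (norm_eq_zero.1 h5)

end QuasiNewton

section Bounded

variable {T : Type*}

/-- The gauge whose Hölder space is the space of bounded functions with the sup norm. -/
def bgauge : T → T → ℝ≥0 := fun _ _ => 2

theorem bgauge_le (φ : T → T) (x y : T) : (bgauge (φ x) (φ y) : ℝ≥0) ≤ 1 * bgauge x y := by
  simp [bgauge]

theorem bounded_sub {V : Type*} [NormedAddCommGroup V] {f : T → V} {C : ℝ}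
    (h : ∀ x, ‖f x‖ ≤ C) (x y : T) :
    ‖f x - f y‖ ≤ C * (bgauge x y : ℝ≥0) := by
  refine (norm_sub_le _ _).trans ?_
  simp only [bgauge, NNReal.coe_ofNat]
  linarith [h x, h y]

variable {V : Type*} [NormedAddCommGroup V] [NormedSpace ℝ V]

theorem norm_le_of_bounded {f : Hol (bgauge (T := T)) V} {C : ℝ} (hC : 0 ≤ C)
    (h : ∀ x, ‖f x‖ ≤ C) : ‖f‖ ≤ C := Hol.norm_le hC h (bounded_sub h)

/-- A bounded function as an element of the Banach space of bounded functions. -/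
def ofBounded (f : T → V) (h : ∃ C : ℝ, 0 ≤ C ∧ ∀ x, ‖f x‖ ≤ C) : Hol (bgauge (T := T)) V :=
  Hol.mk f (by obtain ⟨C, hC, hf⟩ := h; exact ⟨C, hC, hf, bounded_sub hf⟩)

@[simp] theorem ofBounded_apply (f : T → V) (h) (x : T) : ofBounded f h x = f x := rfl

/-- The operator `w ↦ w ∘ B - Λ w` on bounded functions is invertible, with uniform bounds, when
the iterated weights along `B` contract or expand. -/
theorem twist_bounded (Λ Λ' : Hol (bgauge (T := T)) ℝ) (hΛ : ∀ x, Λ x * Λ' x = 1) (n : ℕ) {M : ℝ}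
    (hM : ∀ x, |Λ x| ≤ M) (hM' : ∀ x, |Λ' x| ≤ M) (hM0 : 0 ≤ M) (B : Equiv.Perm T)
    (h : (∀ x, |∏ j ∈ Finset.range n, Λ (B^[j] x)| ≤ 3 / 4) ∨
      ∀ x, |∏ j ∈ Finset.range n, Λ' (B^[j] x)| ≤ 3 / 4) :
    Function.Bijective (Hol.twist B 1 (bgauge_le B) (-Λ) (-Hol.const 1)) ∧
      ∀ w, ‖w‖ ≤ 4 * (1 + M) * (∑ j ∈ Finset.range n, M ^ j) *
        ‖Hol.twist B 1 (bgauge_le B) (-Λ) (-Hol.const 1) w‖ := by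
  have htw : ∀ w x, Hol.twist B 1 (bgauge_le B) (-Λ) (-Hol.const 1) w x = w (B x) - Λ x * w x :=
    fun w x => by rw [Hol.twist_apply]; simp; ring
  have hS0 : 0 ≤ ∑ j ∈ Finset.range n, M ^ j := Finset.sum_nonneg fun _ _ => by positivity
  -- Contracting weights are iterated along backward orbits, expanding ones along forward orbits.
  -- The factor 4 is 1 / (1 - 3/4), and 1 + M covers both cases, M being the cost of dividing by Λ
  -- in the second.
  rcases h with h | h
  · refine ⟨Hol.twist_bijective_of_left_lt B 1 1 (bgauge_le B) (bgauge_le _) (-Λ) (-Hol.const 1)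
      (-Hol.const 1) (by simp) n (κ := 3 / 4) (by norm_num) (by norm_num) (by norm_num)
      (fun x => by simpa using h x), fun w => ?_⟩
    set f := Hol.twist B 1 (bgauge_le B) (-Λ) (-Hol.const 1) w
    refine norm_le_of_bounded (by positivity) fun x => ?_
    have h1 := abs_le_of_abs_sub_weighted_le (⇑B⁻¹) (fun y => Λ (B⁻¹ y)) w (s := ‖f‖) (C := M)
      (κ := 3 / 4) (M := ‖w‖) n w.norm_apply_le (fun y => by
        have h2 := f.norm_apply_le (B⁻¹ y)
        rw [htw, show B (B⁻¹ y) = y by simp] at h2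
        exact h2) (fun y => hM _) (by norm_num) (by norm_num) (fun y => by
        rw [prod_range_inv_pow B Λ]; exact h _) x
    rw [Real.norm_eq_abs]
    refine h1.trans ?_
    rw [div_le_iff₀ (by norm_num)]
    have h3 : 0 ≤ M * (∑ j ∈ Finset.range n, M ^ j) * ‖f‖ := by positivity
    linarith
  · refine ⟨Hol.twist_bijective_of_right_lt B 1 (bgauge_le B) (-Λ) (-Λ') (-Hol.const 1)
      (by simpa using hΛ) n (κ := 3 / 4) (by norm_num) (by norm_num) (by norm_num)
      (fun x => by simpa using h x), fun w => ?_⟩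
    set f := Hol.twist B 1 (bgauge_le B) (-Λ) (-Hol.const 1) w
    refine norm_le_of_bounded (by positivity) fun x => ?_
    have h1 := abs_le_of_abs_sub_weighted_le B Λ' w (s := M * ‖f‖) (C := M)
      (κ := 3 / 4) (M := ‖w‖) n w.norm_apply_le (fun y => by
        have h2 := f.norm_apply_le y
        rw [htw] at h2
        have h3 : w y - Λ' y * w (B y) = -(Λ' y * (w (B y) - Λ y * w y)) := by
          linear_combination (-(w y)) * hΛ y
        rw [h3, abs_neg, abs_mul]
        exact mul_le_mul (hM' y) h2 (abs_nonneg _) hM0) hM' (by norm_num) (by norm_num) h x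
    rw [Real.norm_eq_abs]
    refine h1.trans ?_
    rw [div_le_iff₀ (by norm_num)]
    have h3 : 0 ≤ (∑ j ∈ Finset.range n, M ^ j) * ‖f‖ := by positivity
    linarith

end Bounded

/-! ### The perturbed map and persistence of rates along it. -/

section Perturbed

variable {d : ℕ} {A : Equiv.Perm (Torus d)} {F : Torus d → E d}

/-- A small perturbation of a bi-Lipschitz map is bijective. -/
theorem perturbed_bijective {L M : ℝ≥0} (hA : LipschitzWith L (⇑A⁻¹)) (hF : LipschitzWith M F)
    {ε : ℝ} (hε : ‖ε‖₊ * (M * L) < 1) : Function.Bijective (perturbed A F ε) := by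
  -- In the variable y = A ψ the perturbed map is the identity plus a term of Lipschitz constant
  -- less than 1, so each value is attained exactly once by the contraction principle.
  have hlip : LipschitzWith (‖ε‖₊ * (M * L)) fun y => proj (ε • F (A⁻¹ y)) := by
    refine LipschitzWith.of_dist_le_mul fun y z => ?_
    rw [dist_eq_norm, ← proj_sub, ← smul_sub]
    refine (norm_proj_le _).trans ?_
    rw [norm_smul, NNReal.coe_mul, mul_assoc]
    refine mul_le_mul_of_nonneg_left ?_ (norm_nonneg _)
    rw [← dist_eq_norm]
    exact (hF.comp hA).dist_le_mul y z
  have hsol : ∀ z, ∃! y, y + proj (ε • F (A⁻¹ y)) = z := by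
    intro z
    have hc : ContractingWith (‖ε‖₊ * (M * L)) fun y => z - proj (ε • F (A⁻¹ y)) := by
      refine ⟨hε, LipschitzWith.of_dist_le_mul fun y y' => ?_⟩
      rw [dist_sub_left]
      exact hlip.dist_le_mul y y'
    refine ⟨ContractingWith.fixedPoint _ hc, ?_, fun y hy => ?_⟩
    · have h1 : z - proj (ε • F (A⁻¹ (ContractingWith.fixedPoint _ hc))) =
        ContractingWith.fixedPoint _ hc := hc.fixedPoint_isFixedPt
      exact (eq_add_of_sub_eq h1).symm
    · exact hc.fixedPoint_unique (show z - proj (ε • F (A⁻¹ y)) = y from by rw [← hy]; abel)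
  constructor
  · intro ψ ψ' h
    have h1 := (hsol (perturbed A F ε ψ')).unique (y₁ := A ψ) (y₂ := A ψ')
      (by rw [← h]; simp [perturbed]) (by simp [perturbed])
    exact A.injective h1
  · intro z
    obtain ⟨y, hy, -⟩ := hsol z
    exact ⟨A⁻¹ y, by simpa [perturbed] using hy⟩

theorem continuous_perturbed (hA : Continuous A) (hF : Continuous F) :
    Continuous fun p : ℝ × Torus d => perturbed A F p.1 p.2 := by
  unfold perturbed
  exact (hA.comp continuous_snd).add
    (continuous_proj.comp (continuous_fst.smul (hF.comp continuous_snd)))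

theorem continuous_perturbed_iterate (hA : Continuous A) (hF : Continuous F) (n : ℕ) :
    Continuous fun p : ℝ × Torus d => (perturbed A F p.1)^[n] p.2 := by
  induction n with
  | zero => exact continuous_snd
  | succ n ih =>
    simp only [Function.iterate_succ_apply']
    exact (continuous_perturbed hA hF).comp (continuous_fst.prodMk ih)

theorem perturbed_zero (A : Equiv.Perm (Torus d)) (F : Torus d → E d) : perturbed A F 0 = A := by
  ext1 ψ; simp [perturbed, proj_zero]

theorem eventually_forall_lt {Q : ℝ × Torus d → ℝ} (hQ : Continuous Q) {c : ℝ}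
    (h : ∀ ψ, Q (0, ψ) < c) : ∀ᶠ ε in 𝓝 (0 : ℝ), ∀ ψ, Q (ε, ψ) < c := by
  have := isCompact_univ.eventually_forall_of_forall_eventually (x₀ := (0 : ℝ))
    (P := fun ε (ψ : Torus d) => Q (ε, ψ) < c)
    (fun ψ _ => hQ.continuousAt.eventually_lt continuousAt_const (h ψ))
  filter_upwards [this] with ε hε ψ using hε ψ (Set.mem_univ ψ)

/-- Contraction of the iterated weights persists along the perturbed map. -/
theorem eventually_prod_le (hA : Continuous A) (hF : Continuous F) {Λ : Torus d → ℝ}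
    (hΛ : Continuous Λ) (n : ℕ) (h : ∀ ψ, |∏ j ∈ Finset.range n, Λ (A^[j] ψ)| ≤ 1 / 2) :
    ∀ᶠ ε in 𝓝 (0 : ℝ), ∀ ψ, |∏ j ∈ Finset.range n, Λ ((perturbed A F ε)^[j] ψ)| ≤ 3 / 4 := by
  have hQ : Continuous fun p : ℝ × Torus d =>
      |∏ j ∈ Finset.range n, Λ ((perturbed A F p.1)^[j] p.2)| :=
    (continuous_finsetProd _ fun j _ => hΛ.comp (continuous_perturbed_iterate hA hF j)).abs
  have := eventually_forall_lt hQ (c := 3 / 4) (fun ψ => by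
    simp only [perturbed_zero]; linarith [h ψ])
  filter_upwards [this] with ε hε ψ using (hε ψ).le

theorem eventually_norm_sub_le {V : Type*} [NormedAddCommGroup V] (hA : Continuous A)
    (hF : Continuous F) {v : Torus d → V}
    (hv : Continuous v) {c : ℝ} (hc : 0 < c) :
    ∀ᶠ ε in 𝓝 (0 : ℝ), ∀ ψ, ‖v (perturbed A F ε ψ) - v (A ψ)‖ ≤ c := by
  have hQ : Continuous fun p : ℝ × Torus d => ‖v (perturbed A F p.1 p.2) - v (A p.2)‖ :=
    ((hv.comp (continuous_perturbed hA hF)).sub (hv.comp (hA.comp continuous_snd))).norm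
  have := eventually_forall_lt hQ (c := c) (fun ψ => by simpa [perturbed_zero] using hc)
  filter_upwards [this] with ε hε ψ using (hε ψ).le

end Perturbed

/-! ### Shadowing among bounded displacements, and the homeomorphism property. -/

section Shadowing

variable {d : ℕ}

/-- It turns conjugacy equations on the torus into equations between displacements with values in
ℝ^d. -/
theorem map_add_proj {f : Torus d → Torus d} {g : E d → E d} (hg : ∀ x, proj (g x) = f (proj x))
    (ψ : Torus d) (u : E d) : f (ψ + proj u) = f ψ + proj (incr g ψ u) := by
  rw [incr, proj_sub, hg, hg, proj_add, proj_rep]; abel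

theorem IsQuasiPeriodic.incr_add {g : E d → E d} (hg : IsQuasiPeriodic g) (ψ : Torus d)
    (u w : E d) : incr g ψ (u + w) = incr g ψ u + incr g (ψ + proj u) w := by
  have h1 : ψ + proj u = proj (rep ψ + u) := by rw [proj_add, proj_rep]
  rw [h1, hg.incr_proj, incr, incr, ← add_assoc]; abel

theorem norm_incr_sub_le {g : E d → E d} (hg : Differentiable ℝ g) {C : ℝ≥0}
    (hC : LipschitzWith C (fderiv ℝ g)) (ψ : Torus d) {u w : E d} {s : ℝ}
    (hu : ‖u‖ ≤ s) (hw : ‖w‖ ≤ s) :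
    ‖incr g ψ u - incr g ψ w - fderiv ℝ g (rep ψ) (u - w)‖ ≤ C * s * ‖u - w‖ := by
  have h := Convex.norm_image_sub_le_of_norm_fderiv_le' (𝕜 := ℝ) (f := g)
    (φ := fderiv ℝ g (rep ψ)) (C := C * s) (s := Metric.closedBall (rep ψ) s) (x := rep ψ + w)
    (y := rep ψ + u) (fun x _ => hg x) (fun x hx => ?_) (convex_closedBall _ _)
    (by simpa using hw) (by simpa using hu)
  · rw [add_sub_add_left_eq_sub] at h
    simpa [incr] using h
  · rw [← dist_eq_norm]
    exact (hC.dist_le_mul _ _).trans (by gcongr; exact hx)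

set_option maxHeartbeats 1600000 in
/-- The equation satisfied by displacements `k` with `(id + k) ∘ A_ε = A_δ ∘ (id + k)` has a
unique small bounded solution. -/
theorem exists_shadowing {A : Equiv.Perm (Torus d)} (hA : Continuous A) {LA LF : ℝ≥0}
    (hA' : LipschitzWith LA (⇑A⁻¹)) {g : E d → E d} (hg : AnalyticOnNhd ℝ g Set.univ)
    (hper : IsQuasiPeriodic g) {F : Torus d → E d} (hF : LipschitzWith LF F)
    {v : Fin d → Torus d → E d} {Λ : Fin d → Torus d → ℝ} (hv : ∀ i, Continuous (v i))
    (hΛ : ∀ i, Continuous (Λ i)) (hΛ0 : ∀ i ψ, Λ i ψ ≠ 0) {c : ℝ} (hc : 0 < c)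
    (hframe : ∀ ψ (a : Fin d → ℝ), c * ‖a‖ ≤ ‖∑ k, a k • v k ψ‖)
    (heq : ∀ i ψ, fderiv ℝ g (rep ψ) (v i ψ) = Λ i ψ • v i (A ψ))
    (hrate : ∀ i, ∃ n : ℕ, (∀ ψ, |∏ j ∈ Finset.range n, Λ i (A^[j] ψ)| ≤ 1 / 2) ∨
      ∀ ψ, |∏ j ∈ Finset.range n, (Λ i (A^[j] ψ))⁻¹| ≤ 1 / 2) :
    ∃ r > 0, ∃ η > 0, ∀ ε ε' : ℝ, |ε| < η → |ε'| < η →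
      (∃ k : Torus d → E d, (∀ ψ, ‖k ψ‖ ≤ r / 2) ∧
        ∀ ψ, k (perturbed A F ε ψ) =
          incr g ψ (k ψ) + ε' • F (ψ + proj (k ψ)) - ε • F ψ) ∧
      ∀ k k' : Torus d → E d, (∀ ψ, ‖k ψ‖ ≤ r) → (∀ ψ, ‖k' ψ‖ ≤ r) →
        (∀ ψ, k (perturbed A F ε ψ) =
          incr g ψ (k ψ) + ε' • F (ψ + proj (k ψ)) - ε • F ψ) →
        (∀ ψ, k' (perturbed A F ε ψ) =
          incr g ψ (k' ψ) + ε' • F (ψ + proj (k' ψ)) - ε • F ψ) → k = k' := by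
  have bdd : ∀ {V : Type} [NormedAddCommGroup V] {f : Torus d → V}, Continuous f →
      ∃ C : ℝ, 0 ≤ C ∧ ∀ x, ‖f x‖ ≤ C := by
    intro V _ f hf
    obtain ⟨C, hC⟩ := isCompact_univ.exists_bound_of_continuousOn hf.continuousOn
    exact ⟨max C 0, le_max_right _ _, fun x => (hC x (Set.mem_univ x)).trans (le_max_left _ _)⟩
  have hgd := AnalyticOnNhd.differentiable_univ hg
  obtain ⟨Lg, hLg⟩ := exists_lipschitz_of_quasiPeriodic hg hper
  obtain ⟨C2, hC2⟩ := exists_lipschitz_of_quasiPeriodic hg.fderiv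
    (.of_periodic fun x y hxy => hper.fderiv_eq hxy)
  obtain ⟨Fm, hFm0, hFm⟩ := bdd hF.continuous
  have hΛi : ∀ i, Continuous fun ψ => (Λ i ψ)⁻¹ := fun i => (hΛ i).inv₀ (hΛ0 i)
  let Λb : Fin d → Hol (bgauge (T := Torus d)) ℝ := fun i => ofBounded (Λ i) (bdd (hΛ i))
  let Λb' : Fin d → Hol (bgauge (T := Torus d)) ℝ :=
    fun i => ofBounded (fun ψ => (Λ i ψ)⁻¹) (bdd (hΛi i))
  let vb : Fin d → Hol (bgauge (T := Torus d)) (E d) := fun i => ofBounded (v i) (bdd (hv i))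
  set M : ℝ := ∑ i, (‖Λb i‖ + ‖Λb' i‖) with hMdef
  have hM0 : 0 ≤ M := Finset.sum_nonneg fun i _ => by positivity
  have hMi : ∀ i, ‖Λb i‖ + ‖Λb' i‖ ≤ M := fun i =>
    Finset.single_le_sum (f := fun i => ‖Λb i‖ + ‖Λb' i‖) (fun j _ => by positivity)
      (Finset.mem_univ i)
  have hM : ∀ i ψ, |Λb i ψ| ≤ M := fun i ψ =>
    ((Λb i).norm_apply_le ψ).trans (by linarith [hMi i, norm_nonneg (Λb' i)])
  have hM' : ∀ i ψ, |Λb' i ψ| ≤ M := fun i ψ =>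
    ((Λb' i).norm_apply_le ψ).trans (by linarith [hMi i, norm_nonneg (Λb i)])
  choose n hn using hrate
  have hsum0 : ∀ i, 0 ≤ 4 * (1 + M) * ∑ j ∈ Finset.range (n i), M ^ j := fun i =>
    mul_nonneg (by positivity) (Finset.sum_nonneg fun _ _ => by positivity)
  set C0 : ℝ := (∑ i, 4 * (1 + M) * ∑ j ∈ Finset.range (n i), M ^ j) + 1 with hC0def
  have hC0 : 0 < C0 := add_pos_of_nonneg_of_pos (Finset.sum_nonneg fun i _ => hsum0 i) one_pos
  have hC0i : ∀ i, 4 * (1 + M) * ∑ j ∈ Finset.range (n i), M ^ j ≤ C0 := fun i =>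
    (Finset.single_le_sum (f := fun i => 4 * (1 + M) * ∑ j ∈ Finset.range (n i), M ^ j)
      (fun j _ => hsum0 j) (Finset.mem_univ i)).trans (by rw [hC0def]; linarith)
  -- Bound for the inverse of the linear model: `C0` inverts the scalar twists, c⁻¹ extracts
  -- coordinates in the frame.
  set C : ℝ := C0 * c⁻¹ with hCdef
  have hC : 0 < C := by positivity
  set Vm : ℝ := ∑ k, ‖vb k‖ with hVm
  have hVm0 : 0 ≤ Vm := Finset.sum_nonneg fun _ _ => norm_nonneg _
  have hnormframe : ∀ a, ‖frameL vb a‖ ≤ Vm * ‖a‖ := by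
    intro a
    refine norm_le_of_bounded (by positivity) fun ψ => ?_
    rw [frameL_apply, hVm, Finset.sum_mul]
    refine (norm_sum_le _ _).trans (Finset.sum_le_sum fun k _ => ?_)
    rw [norm_smul, mul_comm]
    gcongr
    · exact (vb k).norm_apply_le ψ
    · exact ((a k).norm_apply_le ψ).trans (norm_le_pi_norm a k)
  -- The quasi-Newton scheme tolerates the error (2C)⁻¹. It is shared equally by the quadratic
  -- remainder of g, the variation of ε' F, and the replacement of the frame at A ψ by the frame at
  -- A_ε ψ.
  set τ : ℝ := (2 * C)⁻¹ / 3 with hτ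
  have hτ0 : 0 < τ := by positivity
  set R : ℝ := τ / (C2 * Vm * Vm + 1) with hR
  have hR0 : 0 < R := by positivity
  have hRτ : C2 * (Vm * R) * Vm ≤ τ := by
    have h1 : C2 * (Vm * R) * Vm = τ * ((C2 * Vm * Vm) / (C2 * Vm * Vm + 1)) := by
      rw [hR]; field_simp
    rw [h1]
    refine mul_le_of_le_one_right hτ0.le ?_
    rw [div_le_one (by positivity)]; linarith
  -- Coordinates of size R' give displacements of size at most c R / 2. That is half of the radius c
  -- R on which uniqueness holds, which leaves room for composing two displacements.
  set R' : ℝ := min R (c * R / 2 / (Vm + 1)) with hR'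
  have hR'0 : 0 < R' := lt_min hR0 (by positivity)
  have hVR' : Vm * R' ≤ c * R / 2 := by
    have h1 : R' * (Vm + 1) ≤ c * R / 2 := by
      rw [← le_div_iff₀ (by positivity)]; exact min_le_right _ _
    linarith
  -- smallness conditions on the parameters
  have hFc := hF.continuous
  have ev1 : ∀ᶠ ε in 𝓝 (0 : ℝ), ‖ε‖₊ * (LF * LA) < 1 := by
    have : Continuous fun ε : ℝ => ‖ε‖₊ * (LF * LA) := by fun_prop
    exact (this.tendsto 0).eventually_lt_const (by simp)
  have ev2 : ∀ᶠ ε in 𝓝 (0 : ℝ), ∀ i,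
      (∀ ψ, |∏ j ∈ Finset.range (n i), Λb i ((perturbed A F ε)^[j] ψ)| ≤ 3 / 4) ∨
      ∀ ψ, |∏ j ∈ Finset.range (n i), Λb' i ((perturbed A F ε)^[j] ψ)| ≤ 3 / 4 := by
    rw [eventually_all]
    intro i
    rcases hn i with h | h
    · filter_upwards [eventually_prod_le hA hFc (hΛ i) (n i) h] with ε hε using Or.inl hε
    · filter_upwards [eventually_prod_le hA hFc (hΛi i) (n i) h] with ε hε using Or.inr hε
  have ev3 : ∀ᶠ ε in 𝓝 (0 : ℝ), ∀ i, ∀ ψ,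
      ‖v i (perturbed A F ε ψ) - v i (A ψ)‖ ≤ τ / (d * M + 1) := by
    rw [eventually_all]
    exact fun i => eventually_norm_sub_le hA hFc (hv i) (by positivity)
  have ev4 : ∀ᶠ ε in 𝓝 (0 : ℝ), |ε| * (LF * Vm) < τ := by
    have : Continuous fun ε : ℝ => |ε| * (LF * Vm) := by fun_prop
    exact (this.tendsto 0).eventually_lt_const (by simpa using hτ0)
  have ev5 : ∀ᶠ ε in 𝓝 (0 : ℝ), |ε| * Fm < (2 * C)⁻¹ * R' / 2 := by
    have : Continuous fun ε : ℝ => |ε| * Fm := by fun_prop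
    exact (this.tendsto 0).eventually_lt_const (by simp; positivity)
  obtain ⟨η, hη, hev⟩ := Metric.eventually_nhds_iff.1 (ev1.and (ev2.and (ev3.and (ev4.and ev5))))
  refine ⟨c * R, by positivity, η, hη, fun ε ε' hε hε' => ?_⟩
  obtain ⟨e1, e2, e3, -, e5⟩ := hev (y := ε) (by simpa using hε)
  obtain ⟨-, -, -, e4', e5'⟩ := hev (y := ε') (by simpa using hε')
  -- the perturbed map as a permutation
  have hbij := perturbed_bijective hA' hF e1
  let B : Equiv.Perm (Torus d) := Equiv.ofBijective _ hbij
  have hB : (⇑B : Torus d → Torus d) = perturbed A F ε := rfl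
  have htw := fun i => twist_bounded (Λb i) (Λb' i) (fun ψ => mul_inv_cancel₀ (hΛ0 i ψ)) (n i)
    (hM i) (hM' i) hM0 B (e2 i)
  let D : Fin d → Hol (bgauge (T := Torus d)) ℝ →L[ℝ] Hol (bgauge (T := Torus d)) ℝ :=
    fun i => Hol.twist B 1 (bgauge_le B) (-Λb i) (-Hol.const 1)
  have hDa : ∀ i w ψ, D i w ψ = w (B ψ) - Λ i ψ * w ψ := fun i w ψ => by
    simp only [D]; rw [Hol.twist_apply]; simp [Λb]; ring
  let vB : Fin d → Hol (bgauge (T := Torus d)) (E d) := fun i => Hol.comp B 1 (bgauge_le B) (vb i)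
  have hfB := frameL_bijective (by simp) vB hc (fun ψ a => hframe (B ψ) a)
  let diag :
      (Fin d → Hol (bgauge (T := Torus d)) ℝ) →L[ℝ] (Fin d → Hol (bgauge (T := Torus d)) ℝ) :=
    ContinuousLinearMap.pi fun i => D i ∘L ContinuousLinearMap.proj i
  have hdiag : Function.Surjective diag := fun b => by
    choose a ha using fun i => (htw i).1.2 (b i)
    exact ⟨a, funext fun i => ha i⟩
  -- The linear model uses the frame at B ψ for both terms, so that it is diagonal. The true
  -- linearisation carries v (A ψ) in the term with Λ, and the discrepancy is estimated in `t3`.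
  let L := (frameL vB) ∘L diag
  have hLsurj : Function.Surjective L := hfB.2.comp hdiag
  have hLbound : ∀ a, ‖a‖ ≤ C * ‖L a‖ := by
    intro a
    rw [pi_norm_le_iff_of_nonneg (by positivity)]
    intro i
    have h1 : ‖D i (a i)‖ ≤ c⁻¹ * ‖L a‖ := by
      refine norm_le_of_bounded (by positivity) fun ψ => ?_
      have h2 := hframe (B ψ) (fun k => D k (a k) ψ)
      have h3 : L a ψ = ∑ k, D k (a k) ψ • v k (B ψ) := frameL_apply vB (diag a) ψ
      rw [← h3] at h2
      have h4 := norm_le_pi_norm (fun k => D k (a k) ψ) i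
      rw [inv_mul_eq_div, le_div_iff₀ hc, mul_comm]
      calc c * ‖D i (a i) ψ‖ ≤ c * ‖fun k => D k (a k) ψ‖ := by gcongr
        _ ≤ ‖L a ψ‖ := h2
        _ ≤ ‖L a‖ := (L a).norm_apply_le ψ
    calc ‖a i‖ ≤ _ := (htw i).2 (a i)
      _ ≤ C0 * (c⁻¹ * ‖L a‖) := mul_le_mul (hC0i i) h1 (norm_nonneg _) hC0.le
      _ = C * ‖L a‖ := by rw [hCdef]; ring
  have hnl : ∀ u : Hol (bgauge (T := Torus d)) (E d), ∃ K : ℝ, 0 ≤ K ∧ ∀ ψ,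
      ‖incr g ψ (u ψ) + ε' • F (ψ + proj (u ψ)) - ε • F ψ‖ ≤ K := by
    intro u
    refine ⟨Lg * ‖u‖ + |ε'| * Fm + |ε| * Fm, by positivity, fun ψ => ?_⟩
    refine (norm_sub_le _ _).trans (add_le_add ((norm_add_le _ _).trans (add_le_add ?_ ?_)) ?_)
    · have h1 := hLg.dist_le_mul (rep ψ + u ψ) (rep ψ)
      rw [dist_eq_norm, dist_eq_norm, add_sub_cancel_left] at h1
      exact h1.trans (by gcongr; exact u.norm_apply_le ψ)
    · rw [norm_smul, Real.norm_eq_abs]; gcongr; exact hFm _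
    · rw [norm_smul, Real.norm_eq_abs]; gcongr; exact hFm _
  let G : (Fin d → Hol (bgauge (T := Torus d)) ℝ) → Hol (bgauge (T := Torus d)) (E d) := fun a =>
    Hol.comp B 1 (bgauge_le B) (frameL vb a) - ofBounded _ (hnl (frameL vb a))
  have hGa : ∀ a ψ, G a ψ = frameL vb a (B ψ) - (incr g ψ (frameL vb a ψ) +
      ε' • F (ψ + proj (frameL vb a ψ)) - ε • F ψ) := fun a ψ => rfl
  have happ : ∀ a b, ‖a‖ ≤ R → ‖b‖ ≤ R →
      ‖G a - G b - L (a - b)‖ ≤ (2 * C)⁻¹ * ‖a - b‖ := by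
    intro a b ha hb
    refine norm_le_of_bounded (by positivity) fun ψ => ?_
    set u := frameL vb a
    set w := frameL vb b
    have huw : ‖u ψ - w ψ‖ ≤ Vm * ‖a - b‖ := by
      have h1 := (frameL vb (a - b)).norm_apply_le ψ
      rw [map_sub] at h1
      exact h1.trans (by rw [← map_sub]; exact hnormframe _)
    have hu : ‖u ψ‖ ≤ Vm * R := (u.norm_apply_le ψ).trans ((hnormframe a).trans (by gcongr))
    have hw : ‖w ψ‖ ≤ Vm * R := (w.norm_apply_le ψ).trans ((hnormframe b).trans (by gcongr))
    have t1 : ‖incr g ψ (u ψ) - incr g ψ (w ψ) - fderiv ℝ g (rep ψ) (u ψ - w ψ)‖ ≤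
        τ * ‖a - b‖ := by
      refine (norm_incr_sub_le hgd hC2 ψ hu hw).trans ?_
      calc C2 * (Vm * R) * ‖u ψ - w ψ‖ ≤ C2 * (Vm * R) * (Vm * ‖a - b‖) := by gcongr
        _ = (C2 * (Vm * R) * Vm) * ‖a - b‖ := by ring
        _ ≤ τ * ‖a - b‖ := by gcongr
    have t2 : ‖ε' • (F (ψ + proj (u ψ)) - F (ψ + proj (w ψ)))‖ ≤ τ * ‖a - b‖ := by
      rw [norm_smul, Real.norm_eq_abs, ← dist_eq_norm]
      have h1 := hF.dist_le_mul (ψ + proj (u ψ)) (ψ + proj (w ψ))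
      rw [dist_add_left, dist_eq_norm (proj _), ← proj_sub] at h1
      calc |ε'| * dist (F (ψ + proj (u ψ))) (F (ψ + proj (w ψ)))
          ≤ |ε'| * (LF * (Vm * ‖a - b‖)) := by
            gcongr
            exact h1.trans (by gcongr; exact (norm_proj_le _).trans huw)
        _ = (|ε'| * (LF * Vm)) * ‖a - b‖ := by ring
        _ ≤ τ * ‖a - b‖ := by gcongr
    have t3 : ‖∑ i, (Λ i ψ * (a i ψ - b i ψ)) • (v i (B ψ) - v i (A ψ))‖ ≤ τ * ‖a - b‖ := by
      refine (norm_sum_le _ _).trans ?_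
      calc ∑ i, ‖(Λ i ψ * (a i ψ - b i ψ)) • (v i (B ψ) - v i (A ψ))‖
          ≤ ∑ _i : Fin d, M * ‖a - b‖ * (τ / (d * M + 1)) := by
            refine Finset.sum_le_sum fun i _ => ?_
            rw [norm_smul, norm_mul]
            gcongr
            · exact hM i ψ
            · exact ((a i - b i).norm_apply_le ψ).trans (norm_le_pi_norm (a - b) i)
            · exact e3 i ψ
        _ = (d * M) / (d * M + 1) * (τ * ‖a - b‖) := by
            rw [Finset.sum_const, Finset.card_univ, Fintype.card_fin, nsmul_eq_mul]
            field_simp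
        _ ≤ 1 * (τ * ‖a - b‖) := by
            gcongr
            rw [div_le_one (by positivity)]; linarith
        _ = _ := one_mul _
    have hLe : L (a - b) ψ = (u (B ψ) - w (B ψ)) -
        ∑ i, (Λ i ψ * (a i ψ - b i ψ)) • v i (B ψ) := by
      have h3 : L (a - b) ψ = ∑ k, D k ((a - b) k) ψ • v k (B ψ) := frameL_apply vB (diag (a - b)) ψ
      rw [h3, frameL_apply, frameL_apply, ← Finset.sum_sub_distrib, ← Finset.sum_sub_distrib]
      refine Finset.sum_congr rfl fun i _ => ?_
      rw [hDa]
      change ((a i (B ψ) - b i (B ψ)) - Λ i ψ * (a i ψ - b i ψ)) • v i (B ψ) =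
        a i (B ψ) • v i (B ψ) - b i (B ψ) • v i (B ψ) - (Λ i ψ * (a i ψ - b i ψ)) • v i (B ψ)
      rw [sub_smul, sub_smul]
    have hDe : fderiv ℝ g (rep ψ) (u ψ - w ψ) =
        ∑ i, (Λ i ψ * (a i ψ - b i ψ)) • v i (A ψ) := by
      rw [frameL_apply, frameL_apply, ← Finset.sum_sub_distrib, map_sum]
      refine Finset.sum_congr rfl fun i _ => ?_
      rw [← sub_smul, map_smul]
      change (a i ψ - b i ψ) • fderiv ℝ g (rep ψ) (v i ψ) = _
      rw [heq, smul_smul, mul_comm]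
    have e : (G a - G b - L (a - b)) ψ =
        -(incr g ψ (u ψ) - incr g ψ (w ψ) - fderiv ℝ g (rep ψ) (u ψ - w ψ)) -
        ε' • (F (ψ + proj (u ψ)) - F (ψ + proj (w ψ))) +
        ∑ i, (Λ i ψ * (a i ψ - b i ψ)) • (v i (B ψ) - v i (A ψ)) := by
      rw [Hol.sub_apply, Hol.sub_apply, hGa, hGa, hLe, hDe]
      simp only [smul_sub, Finset.sum_sub_distrib]
      abel
    rw [e]
    have h3 : (2 * C)⁻¹ = 3 * τ := by rw [hτ]; ring
    rw [h3]
    have h4 := norm_add_le (-(incr g ψ (u ψ) - incr g ψ (w ψ) - fderiv ℝ g (rep ψ) (u ψ - w ψ)) -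
        ε' • (F (ψ + proj (u ψ)) - F (ψ + proj (w ψ))))
        (∑ i, (Λ i ψ * (a i ψ - b i ψ)) • (v i (B ψ) - v i (A ψ)))
    have h5 := norm_sub_le (-(incr g ψ (u ψ) - incr g ψ (w ψ) - fderiv ℝ g (rep ψ) (u ψ - w ψ)))
        (ε' • (F (ψ + proj (u ψ)) - F (ψ + proj (w ψ))))
    rw [norm_neg] at h5
    linarith
  obtain ⟨hex, huniq⟩ := exists_zero_and_unique G L hC hLsurj hLbound happ
  constructor
  · have hG0 : ‖G 0‖ ≤ (2 * C)⁻¹ * R' := by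
      refine norm_le_of_bounded (by positivity) fun ψ => ?_
      rw [hGa, map_zero]
      simp only [Hol.zero_apply, proj_zero, add_zero]
      have h1 : incr g ψ 0 = 0 := by simp [incr]
      rw [h1, zero_add, zero_sub, norm_neg]
      refine (norm_sub_le _ _).trans ?_
      rw [norm_smul, norm_smul, Real.norm_eq_abs, Real.norm_eq_abs]
      have h2 : |ε'| * ‖F ψ‖ ≤ |ε'| * Fm := by gcongr; exact hFm ψ
      have h3 : |ε| * ‖F ψ‖ ≤ |ε| * Fm := by gcongr; exact hFm ψ
      linarith
    obtain ⟨a, ha, hGa0⟩ := hex R' hR'0.le (min_le_left _ _) hG0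
    refine ⟨fun ψ => frameL vb a ψ, fun ψ => ?_, fun ψ => ?_⟩
    · refine ((frameL vb a).norm_apply_le ψ).trans ((hnormframe a).trans ?_)
      exact (mul_le_mul_of_nonneg_left ha hVm0).trans hVR'
    · have h1 := hGa a ψ
      rw [hGa0, Hol.zero_apply] at h1
      exact (sub_eq_zero.1 h1.symm)
  · have hfb := frameL_bijective (by simp) vb hc (fun ψ a => hframe ψ a)
    have hcoord : ∀ k : Torus d → E d, (∀ ψ, ‖k ψ‖ ≤ c * R) →
        (∀ ψ, k (perturbed A F ε ψ) = incr g ψ (k ψ) + ε' • F (ψ + proj (k ψ)) - ε • F ψ) →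
        ∃ a, (∀ ψ, frameL vb a ψ = k ψ) ∧ ‖a‖ ≤ R ∧ G a = 0 := by
      intro k hk hkeq
      obtain ⟨a, ha⟩ := hfb.2 (ofBounded k ⟨c * R, by positivity, hk⟩)
      have ha' : ∀ ψ, frameL vb a ψ = k ψ := fun ψ => by rw [ha]; rfl
      refine ⟨a, ha', ?_, ?_⟩
      · rw [pi_norm_le_iff_of_nonneg hR0.le]
        intro i
        refine norm_le_of_bounded hR0.le fun ψ => ?_
        have h2 := hframe ψ (fun k => a k ψ)
        have h3 : frameL vb a ψ = ∑ k, a k ψ • v k ψ := frameL_apply vb a ψ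
        rw [← h3, ha'] at h2
        have h4 := norm_le_pi_norm (fun k => a k ψ) i
        refine h4.trans (le_of_mul_le_mul_left (h2.trans (hk ψ)) hc)
      · ext1 ψ
        rw [hGa, ha', ha', Hol.zero_apply, hB, hkeq, sub_self]
    intro k k' hk hk' hkeq hkeq'
    obtain ⟨a, ha1, ha2, ha3⟩ := hcoord k hk hkeq
    obtain ⟨b, hb1, hb2, hb3⟩ := hcoord k' hk' hkeq'
    have := huniq a b ha2 hb2 ha3 hb3
    ext1 ψ
    rw [← ha1, ← hb1, this]

/-- Small continuous solutions of the conjugacy equation are homeomorphisms. -/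
theorem exists_radius_isHomeomorph {A : Equiv.Perm (Torus d)} (hA : Continuous A) {LA LF : ℝ≥0}
    (hA' : LipschitzWith LA (⇑A⁻¹)) {g : E d → E d} (hg : AnalyticOnNhd ℝ g Set.univ)
    (hper : IsQuasiPeriodic g) (hgA : ∀ x, proj (g x) = A (proj x))
    {F : Torus d → E d} (hF : LipschitzWith LF F)
    {v : Fin d → Torus d → E d} {Λ : Fin d → Torus d → ℝ} (hv : ∀ i, Continuous (v i))
    (hΛ : ∀ i, Continuous (Λ i)) (hΛ0 : ∀ i ψ, Λ i ψ ≠ 0) {c : ℝ} (hc : 0 < c)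
    (hframe : ∀ ψ (a : Fin d → ℝ), c * ‖a‖ ≤ ‖∑ k, a k • v k ψ‖)
    (heq : ∀ i ψ, fderiv ℝ g (rep ψ) (v i ψ) = Λ i ψ • v i (A ψ))
    (hrate : ∀ i, ∃ n : ℕ, (∀ ψ, |∏ j ∈ Finset.range n, Λ i (A^[j] ψ)| ≤ 1 / 2) ∨
      ∀ ψ, |∏ j ∈ Finset.range n, (Λ i (A^[j] ψ))⁻¹| ≤ 1 / 2) :
    ∃ r > 0, ∃ η > 0, ∀ ε : ℝ, |ε| < η → ∀ h : Torus d → E d, Continuous h → (∀ ψ, ‖h ψ‖ ≤ r) →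
      (∀ ψ, h (A ψ) = incr g ψ (h ψ) + ε • F (ψ + proj (h ψ))) →
      IsHomeomorph fun ψ => ψ + proj (h ψ) := by
  obtain ⟨r, hr, η, hη, H⟩ := exists_shadowing hA hA' hg hper hF hv hΛ hΛ0 hc hframe heq hrate
  refine ⟨r / 2, half_pos hr, η, hη, fun ε hε h hh hhr hheq => ?_⟩
  have h0 : |(0 : ℝ)| < η := by simpa using hη
  -- Target parameter 0: id + k carries the perturbed map back to A, the reverse of what id + h
  -- does.
  obtain ⟨k, hkr, hkeq⟩ := (H ε 0 hε h0).1
  simp only [zero_smul, add_zero] at hkeq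
  -- `id + h` is a left inverse of `id + k`
  have hHK : ∀ ψ, k ψ + h (ψ + proj (k ψ)) = 0 := by
    -- The composition commutes with A_ε, as does the identity, and both displacements lie within
    -- the uniqueness radius.
    have := (H ε ε hε hε).2 (fun ψ => k ψ + h (ψ + proj (k ψ))) (fun _ => 0)
      (fun ψ => (norm_add_le _ _).trans (by linarith [hkr ψ, hhr (ψ + proj (k ψ))]))
      (fun ψ => by simpa using hr.le) (fun ψ => ?_) (fun ψ => by simp [incr, proj_zero])
    · exact fun ψ => congrFun this ψ
    · have h1 : perturbed A F ε ψ + proj (k (perturbed A F ε ψ)) = A (ψ + proj (k ψ)) := by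
        rw [map_add_proj hgA, hkeq, perturbed, proj_sub]; abel
      change k _ + h _ = _
      rw [h1, hheq, hkeq, hper.incr_add, proj_add, ← add_assoc ψ]; abel
  -- The composition in the other order commutes with A, hence uniqueness is applied with both
  -- parameters 0.
  have hKH : ∀ ψ, h ψ + k (ψ + proj (h ψ)) = 0 := by
    have := (H 0 0 h0 h0).2 (fun ψ => h ψ + k (ψ + proj (h ψ))) (fun _ => 0)
      (fun ψ => (norm_add_le _ _).trans (by linarith [hhr ψ, hkr (ψ + proj (h ψ))]))
      (fun ψ => by simpa using hr.le) (fun ψ => ?_) (fun ψ => by simp [incr])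
    · exact fun ψ => congrFun this ψ
    · have h1 : A ψ + proj (h (A ψ)) = perturbed A F ε (ψ + proj (h ψ)) := by
        rw [hheq, perturbed, map_add_proj hgA, proj_add]; abel
      simp only [perturbed_zero, zero_smul, add_zero, sub_zero]
      rw [h1, hheq, hkeq, hper.incr_add]; abel
  have hcont : Continuous fun ψ => ψ + proj (h ψ) := continuous_id.add (continuous_proj.comp hh)
  rw [isHomeomorph_iff_continuous_bijective]
  refine ⟨hcont, Function.bijective_iff_has_inverse.2 ⟨fun ψ => ψ + proj (k ψ), fun ψ => ?_,
    fun ψ => ?_⟩⟩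
  · change ψ + proj (h ψ) + proj (k (ψ + proj (h ψ))) = ψ
    rw [add_assoc, ← proj_add, hKH, proj_zero, add_zero]
  · change ψ + proj (k ψ) + proj (h (ψ + proj (k ψ))) = ψ
    rw [add_assoc, ← proj_add, hHK, proj_zero, add_zero]

end Shadowing

/-! ### Uniform bounds for frames, and the choice of rates and exponents. -/

section Frames

variable {d : ℕ}

/-- The constant is a minimum over the torus times the unit sphere; for d = 0 the sphere is empty
and any constant serves. -/
theorem exists_frame_bound {v : Fin d → Torus d → E d} (hv : ∀ i, Continuous (v i))
    (hli : ∀ ψ, LinearIndependent ℝ (fun i => v i ψ)) :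
    ∃ c > 0, ∀ ψ (a : Fin d → ℝ), c * ‖a‖ ≤ ‖∑ k, a k • v k ψ‖ := by
  let Q : Torus d × (Fin d → ℝ) → ℝ := fun p => ‖∑ k, p.2 k • v k p.1‖
  have hQ : Continuous Q := by
    refine (continuous_finsetSum _ fun k _ => ?_).norm
    exact ((continuous_apply k).comp continuous_snd).smul ((hv k).comp continuous_fst)
  have hQpos : ∀ ψ (a : Fin d → ℝ), a ≠ 0 → 0 < Q (ψ, a) := fun ψ a ha => by
    refine norm_pos_iff.2 fun h0 => ha (funext fun k => ?_)
    exact Fintype.linearIndependent_iff.1 (hli ψ) a h0 k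
  have hK : IsCompact ((Set.univ : Set (Torus d)) ×ˢ Metric.sphere (0 : Fin d → ℝ) 1) :=
    isCompact_univ.prod (isCompact_sphere _ _)
  have hscale : ∀ c : ℝ, (∀ ψ (a : Fin d → ℝ), ‖a‖ = 1 → c ≤ Q (ψ, a)) →
      ∀ ψ (a : Fin d → ℝ), c * ‖a‖ ≤ Q (ψ, a) := by
    intro c hc ψ a
    rcases eq_or_ne a 0 with rfl | ha
    · simp [Q]
    have hn : 0 < ‖a‖ := norm_pos_iff.2 ha
    have h1 := hc ψ (‖a‖⁻¹ • a) (by rw [norm_smul, norm_inv, norm_norm, inv_mul_cancel₀ hn.ne'])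
    have h2 : Q (ψ, ‖a‖⁻¹ • a) = ‖a‖⁻¹ * Q (ψ, a) := by
      simp only [Q, Pi.smul_apply, smul_eq_mul, mul_smul, ← Finset.smul_sum]
      rw [norm_smul, norm_inv, norm_norm]
    rw [h2, inv_mul_eq_div, le_div_iff₀ hn] at h1
    exact h1
  rcases (((Set.univ : Set (Torus d)) ×ˢ Metric.sphere (0 : Fin d → ℝ) 1)).eq_empty_or_nonempty
    with he | hne
  · refine ⟨1, one_pos, hscale 1 fun ψ a ha => ?_⟩
    have : (ψ, a) ∈ ((Set.univ : Set (Torus d)) ×ˢ Metric.sphere (0 : Fin d → ℝ) 1) :=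
      ⟨Set.mem_univ _, by simpa using ha⟩
    rw [he] at this
    exact this.elim
  · obtain ⟨p, hp, hmin⟩ := hK.exists_isMinOn hne hQ.continuousOn
    refine ⟨Q p, hQpos p.1 p.2 ?_, hscale _ fun ψ a ha => hmin ⟨Set.mem_univ _, by simpa using ha⟩⟩
    rintro h0
    have := hp.2
    rw [h0] at this
    simp at this

theorem linearIndependent_of_frame_bound {v w : Fin d → E d} {c : ℝ}
    (h : ∀ a : Fin d → ℝ, c * ‖a‖ ≤ ‖∑ k, a k • v k‖) (hw : ∑ k, ‖w k - v k‖ < c) :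
    LinearIndependent ℝ w := by
  rw [Fintype.linearIndependent_iff]
  intro a ha
  have h1 : ∑ k, a k • v k = -∑ k, a k • (w k - v k) := by
    simp only [smul_sub, Finset.sum_sub_distrib, ha]; simp
  have h2 : ‖∑ k, a k • v k‖ ≤ (∑ k, ‖w k - v k‖) * ‖a‖ := by
    rw [h1, norm_neg, Finset.sum_mul]
    refine (norm_sum_le _ _).trans (Finset.sum_le_sum fun k _ => ?_)
    rw [norm_smul, mul_comm]
    gcongr
    exact norm_le_pi_norm a k
  have h3 : ‖a‖ = 0 := by
    by_contra hne
    have := mul_lt_mul_of_pos_right hw ((norm_nonneg a).lt_of_ne (Ne.symm hne))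
    linarith [h a]
  exact fun k => congrFun (norm_eq_zero.1 h3) k

end Frames

section Rates

variable {d : ℕ} {A : Equiv.Perm (Torus d)}

/-- At β = 0 the left side is κ. The condition L ≠ 0 makes β ↦ L ^ β continuous there. -/
theorem eventually_mul_rpow_pow_lt {κ : ℝ} (hκ : κ < 1) {L : ℝ≥0} (hL : L ≠ 0) (n : ℕ) :
    ∀ᶠ β : ℝ≥0 in 𝓝[>] 0, κ * ((L ^ (β : ℝ) : ℝ≥0) : ℝ) ^ n < 1 := by
  have h : Continuous fun β : ℝ≥0 => κ * ((L ^ (β : ℝ) : ℝ≥0) : ℝ) ^ n := by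
    simp only [NNReal.coe_rpow]
    have h1 := (Real.continuous_const_rpow (a := (L : ℝ)) (by exact_mod_cast hL)).comp
      NNReal.continuous_coe
    exact continuous_const.mul (h1.pow n)
  exact ((h.tendsto 0).eventually_lt_const (by simpa using hκ)).filter_mono nhdsWithin_le_nhds

theorem Hol.exists_inv_of_continuous {β : ℝ≥0} {f : Torus d → ℝ} (hf : Continuous f)
    (hf0 : ∀ ψ, f ψ ≠ 0) (a : Hol (gauge (T := Torus d) β) ℝ) (ha : ∀ ψ, a ψ = f ψ) :
    ∃ a' : Hol (gauge (T := Torus d) β) ℝ, ∀ ψ, a' ψ = (a ψ)⁻¹ := by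
  obtain ⟨ψ₀, -, h₀⟩ := isCompact_univ.exists_isMinOn (Set.univ_nonempty (α := Torus d))
    hf.abs.continuousOn
  exact Hol.exists_inv a (abs_pos.2 (hf0 ψ₀)) fun ψ => by rw [ha]; exact h₀ (Set.mem_univ ψ)

/-- If one of the two weights dominates the other along the orbits, the twisted cohomological
operator is invertible in all Hölder spaces of small exponent. -/
theorem eventually_twist_bijective {L L' : ℝ≥0} (hL : L ≠ 0) (hL' : L' ≠ 0)
    (hA : LipschitzWith L A) (hA' : LipschitzWith L' (⇑A⁻¹)) {f g : Torus d → ℝ}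
    (hf : Continuous f) (hg : Continuous g) (hf0 : ∀ ψ, f ψ ≠ 0) (hg0 : ∀ ψ, g ψ ≠ 0) (n : ℕ)
    {κ : ℝ} (hκ0 : 0 ≤ κ) (hκ : κ < 1)
    (h : (∀ ψ, |cocycle A g n ψ| ≤ κ * |cocycle A f n ψ|) ∨
      ∀ ψ, |cocycle A f n ψ| ≤ κ * |cocycle A g n ψ|) :
    ∀ᶠ β : ℝ≥0 in 𝓝[>] 0, ∀ a b : Hol (gauge (T := Torus d) β) ℝ, (∀ ψ, a ψ = f ψ) →
      (∀ ψ, b ψ = g ψ) →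
      Function.Bijective (Hol.twist A (L ^ (β : ℝ)) (gauge_le_of_lipschitz β hA) a b) := by
  have key : ∀ f g : Torus d → ℝ, (∀ ψ, f ψ ≠ 0) →
      (∀ ψ, |cocycle A g n ψ| ≤ κ * |cocycle A f n ψ|) →
      ∀ ψ, |∏ j ∈ Finset.range n, ((f (A^[j] ψ))⁻¹ * g (A^[j] ψ))| ≤ κ := by
    intro f g hf0 h ψ
    rw [Finset.prod_mul_distrib, Finset.prod_inv_distrib, ← cocycle_eq_iterate,
      ← cocycle_eq_iterate, abs_mul, abs_inv,
      inv_mul_le_iff₀ (abs_pos.2 (cocycle_ne_zero hf0 n ψ)), mul_comm]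
    exact h ψ
  filter_upwards [eventually_mul_rpow_pow_lt hκ hL n, eventually_mul_rpow_pow_lt hκ hL' n]
    with β h1 h2 a b ha hb
  rcases h with h | h
  · obtain ⟨a', ha'⟩ := Hol.exists_inv_of_continuous hf hf0 a ha
    refine Hol.twist_bijective_of_right_lt A _ _ a a' b
      (fun ψ => by rw [ha', ha, mul_inv_cancel₀ (hf0 ψ)]) n hκ0 hκ h1 fun ψ => ?_
    simp only [ha', ha, hb]
    exact key f g hf0 h ψ
  · obtain ⟨b', hb'⟩ := Hol.exists_inv_of_continuous hg hg0 b hb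
    refine Hol.twist_bijective_of_left_lt A _ _ _ (gauge_le_of_lipschitz β hA') a b b'
      (fun ψ => by rw [hb', hb, mul_inv_cancel₀ (hg0 ψ)]) n hκ0 hκ h2 fun ψ => ?_
    simp only [hb', ha, hb]
    exact key g f hg0 h ψ

/-- Purity of the direction converts hyperbolicity into uniform contraction of the cocycle or of its
inverse, the latter by time reversal. -/
theorem IsHyperbolicSplitting.exists_rate {Ws Wu : Torus d → Submodule ℝ (E d)}
    (hs : IsHyperbolicSplitting A Ws Wu) (hA : IsAnalyticMap A)
    (hA' : IsAnalyticMap (A⁻¹ : Equiv.Perm _)) {v : Fin d → Torus d → E d}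
    {Λ : Fin d → Torus d → ℝ} (hv : ∀ i, Continuous (v i))
    (hli : ∀ ψ, LinearIndependent ℝ (fun i => v i ψ))
    (heq : ∀ i ψ, tderiv A ψ (v i ψ) = Λ i ψ • v i (A ψ)) (hdom : IsDominated A Λ) (i : Fin d) :
    ∃ n : ℕ, (∀ ψ, |cocycle A (Λ i) n ψ| ≤ 1 / 2) ∨ ∀ ψ, |(cocycle A (Λ i) n ψ)⁻¹| ≤ 1 / 2 := by
  have hv0 : ∀ ψ, v i ψ ≠ 0 := fun ψ => (hli ψ).ne_zero i
  rcases hs.stable_or_unstable hA hA' hv hli heq hdom i with h | h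
  · obtain ⟨n, hn⟩ := hs.exists_contraction hA (hv i) hv0 (heq i) h
    exact ⟨n, Or.inl hn⟩
  · obtain ⟨n, hn⟩ := (hs.symm hA hA').exists_contraction hA' (hv i) hv0
      (eigen_inv hA hA' hv0 (heq i)) h
    refine ⟨n, Or.inr fun ψ => ?_⟩
    have := hn ((A ^ n : Equiv.Perm (Torus d)) ψ)
    rwa [cocycle_inv, inv_pow, show (A ^ n)⁻¹ ((A ^ n) ψ) = ψ by simp] at this

end Rates

/-! ### Analytic continuation of the conjugacy and of the eigendirections. -/

section BilinearZero

variable {𝓜 X S Y U : Type*} [NormedAddCommGroup 𝓜] [NormedSpace ℝ 𝓜]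
  [NormedAddCommGroup X] [NormedSpace ℝ X] [NormedAddCommGroup S] [NormedSpace ℝ S]
  [NormedAddCommGroup Y] [NormedSpace ℝ Y] [CompleteSpace Y]
  [NormedAddCommGroup U] [NormedSpace ℝ U] [CompleteSpace U]

/-- Analytic continuation of a solution of a bilinear eigenvalue equation `M x = s • C x`, with
`x ∈ x₀ + range W` and `s ∈ s₀ + range π`. -/
theorem exists_analytic_bilinear_zero (P : 𝓜 →L[ℝ] X →L[ℝ] Y) (Q : S →L[ℝ] Y →L[ℝ] Y)
    (W : U →L[ℝ] X) (C : X →L[ℝ] Y) (π : U →L[ℝ] S) {x₀ : X} {s₀ : S} {M : ℝ → 𝓜}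
    (hM : AnalyticAt ℝ M 0) (h₀ : P (M 0) x₀ = Q s₀ (C x₀))
    (hbij : Function.Bijective (P (M 0) ∘L W - Q s₀ ∘L C ∘L W - Q.flip (C x₀) ∘L π)) :
    ∃ a : ℝ → U, AnalyticAt ℝ a 0 ∧ a 0 = 0 ∧
      ∀ᶠ ε in 𝓝 0, P (M ε) (x₀ + W (a ε)) = Q (s₀ + π (a ε)) (C (x₀ + W (a ε))) := by
  let G : ℝ × U → Y := fun p => P (M p.1) (x₀ + W p.2) - Q (s₀ + π p.2) (C (x₀ + W p.2))
  have hW : AnalyticAt ℝ (fun p : ℝ × U => x₀ + W p.2) (0, 0) :=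
    analyticAt_const.add ((W.analyticAt _).comp analyticAt_snd)
  have hl : AnalyticAt ℝ (fun p : ℝ × U => s₀ + π p.2) (0, 0) :=
    analyticAt_const.add ((π.analyticAt _).comp analyticAt_snd)
  have hG : AnalyticAt ℝ G (0, 0) :=
    (AnalyticAt.comp (g := fun q : 𝓜 × X => P q.1 q.2) (P.analyticAt_bilinear _)
      ((hM.comp_of_eq analyticAt_fst rfl).prod hW)).sub
    (AnalyticAt.comp (g := fun q : S × Y => Q q.1 q.2) (Q.analyticAt_bilinear _)
      (hl.prod ((C.analyticAt _).comp hW)))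
  have hG0 : G (0, 0) = 0 := by simp only [G, map_zero, add_zero, h₀, sub_self]
  obtain ⟨a, ha, ha0, hae⟩ := exists_analytic_implicit hG hG0 _ hbij (by
    -- At ε = 0 this product of the two corrections is the only nonlinear term, and it is quadratic.
    have h1 : HasFDerivAt (fun a => Q (π a) (C (W a))) (0 : U →L[ℝ] Y) 0 := by
      have := Q.hasFDerivAt_of_bilinear (π.hasFDerivAt (x := 0)) ((C ∘L W).hasFDerivAt (x := 0))
      refine this.congr_fderiv (ContinuousLinearMap.ext fun a => ?_)
      simp
    have h2 := ((P (M 0) ∘L W - Q s₀ ∘L C ∘L W - Q.flip (C x₀) ∘L π).hasFDerivAt (x := 0)).sub h1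
    have h3 : (fun a => G (0, a)) = fun a => (P (M 0) ∘L W - Q s₀ ∘L C ∘L W -
        Q.flip (C x₀) ∘L π) a - Q (π a) (C (W a)) := by
      funext a
      simp only [G, map_add, h₀, sub_apply, ContinuousLinearMap.comp_apply,
        ContinuousLinearMap.flip_apply, add_apply]
      abel
    rw [sub_zero] at h2
    rw [h3]
    exact h2)
  exact ⟨a, ha, ha0, by filter_upwards [hae] with ε hε using sub_eq_zero.1 hε⟩

end BilinearZero

section Continuation

variable {d : ℕ} {β : ℝ≥0} {A : Equiv.Perm (Torus d)} {L : ℝ≥0}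

/-- Values of an analytic periodic function along an analytic curve of displacements. -/
theorem exists_analytic_along {V : Type*} [NormedAddCommGroup V] [NormedSpace ℝ V]
    [CompleteSpace V] (hβ : β ≤ 1) {f : E d → V} (hf : AnalyticOnNhd ℝ f Set.univ)
    (hper : ∀ x y, proj x = proj y → f x = f y) {h : ℝ → Hol (gauge (T := Torus d) β) (E d)}
    (hh : AnalyticAt ℝ h 0) (h0 : h 0 = 0) :
    ∃ Φ : ℝ → Hol (gauge (T := Torus d) β) V, AnalyticAt ℝ Φ 0 ∧
      ∀ᶠ ε in 𝓝 0, ∀ ψ, Φ ε ψ = f (rep ψ + h ε ψ) := by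
  obtain ⟨N, N', hN, -, -, -, hNe⟩ := exists_torus_superposition hβ hf (.of_periodic hper)
  obtain ⟨f₀, hf₀⟩ := exists_hol_of_periodic hβ hf hper
  refine ⟨fun ε => f₀ + N (h ε), analyticAt_const.add (hN.comp_of_eq hh h0), ?_⟩
  have ht : Tendsto h (𝓝 0) (𝓝 0) := by have := hh.continuousAt.tendsto; rwa [h0] at this
  filter_upwards [ht.eventually hNe] with ε hε ψ
  have h1 := hf₀ (rep ψ)
  rw [proj_rep] at h1
  rw [Hol.add_apply, hε, h1, incr]; abel

variable (hL : ∀ x y, gauge β (A x) (A y) ≤ L * gauge β x y)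
  (v : Fin d → Hol (gauge (T := Torus d) β) (E d)) (Λ : Fin d → Hol (gauge (T := Torus d) β) ℝ)
  {c : ℝ}

/-- The linear part of the equations below, in the coordinates given by the frame. -/
theorem frame_pi_bijective (hc : 0 < c)
    (hframe : ∀ ψ (a : Fin d → ℝ), c * ‖a‖ ≤ ‖∑ k, a k • v k ψ‖)
    (D : Fin d → Hol (gauge (T := Torus d) β) ℝ →L[ℝ] Hol (gauge (T := Torus d) β) ℝ)
    (hD : ∀ k, Function.Bijective (D k)) :
    Function.Bijective (frameL (fun k => Hol.comp A L hL (v k)) ∘L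
      ContinuousLinearMap.pi fun k => D k ∘L ContinuousLinearMap.proj k) := by
  refine (frameL_bijective (by simp) _ hc fun ψ a => hframe (A ψ) a).comp ⟨fun a b hab => ?_,
    fun b => ?_⟩
  · exact funext fun k => (hD k).1 (congrFun hab k)
  · choose a ha using fun k => (hD k).2 (b k)
    exact ⟨a, funext ha⟩

/-- Analytic continuation of the conjugacy. -/
theorem exists_analytic_conjugacy (hβ : β ≤ 1) {g : E d → E d} (hg : AnalyticOnNhd ℝ g Set.univ)
    (hper : IsQuasiPeriodic g) {F : Torus d → E d} (hF : IsAnalyticField F) (hc : 0 < c)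
    (hframe : ∀ ψ (a : Fin d → ℝ), c * ‖a‖ ≤ ‖∑ k, a k • v k ψ‖)
    (heq : ∀ i ψ, fderiv ℝ g (rep ψ) (v i ψ) = Λ i ψ • v i (A ψ))
    (hD : ∀ i, Function.Bijective (Hol.twist A L hL (Λ i) (Hol.const 1))) :
    ∃ h : ℝ → Hol (gauge (T := Torus d) β) (E d), AnalyticAt ℝ h 0 ∧ h 0 = 0 ∧
      ∀ᶠ ε in 𝓝 0, ∀ ψ, h ε (A ψ) = incr g ψ (h ε ψ) + ε • F (ψ + proj (h ε ψ)) := by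
  have hperF : ∀ x y : E d, proj x = proj y → F (proj x) = F (proj y) := fun x y h => by rw [h]
  obtain ⟨N, N', hN, hN0, hN', hN'a, hNe⟩ := exists_torus_superposition hβ hg hper
  obtain ⟨NF, -, hNF, -, -, -, hNFe⟩ := exists_torus_superposition hβ hF (.of_periodic hperF)
  obtain ⟨F₀, hF₀⟩ := exists_hol_of_periodic hβ hF hperF
  let G : ℝ × (Fin d → Hol (gauge (T := Torus d) β) ℝ) → Hol (gauge (T := Torus d) β) (E d) :=
    fun p => N (frameL v p.2) + p.1 • (F₀ + NF (frameL v p.2)) - Hol.comp A L hL (frameL v p.2)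
  have hV : AnalyticAt ℝ (fun p : ℝ × (Fin d → Hol (gauge (T := Torus d) β) ℝ) => frameL v p.2)
      (0, 0) := ((frameL v).analyticAt _).comp analyticAt_snd
  have hV0 : frameL v (0 : Fin d → Hol (gauge (T := Torus d) β) ℝ) = 0 := map_zero _
  have hG : AnalyticAt ℝ G (0, 0) :=
    ((hN.comp_of_eq hV hV0).add (analyticAt_fst.smul
      (analyticAt_const.add (hNF.comp_of_eq hV hV0)))).sub
      (((Hol.comp A L hL).analyticAt _).comp hV)
  have hG0 : G (0, 0) = 0 := by simp [G, hN0]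
  have hbij := frame_pi_bijective hL v hc hframe
    (fun i => Hol.twist A L hL (Λ i) (Hol.const 1)) hD
  obtain ⟨a, ha, ha0, hae⟩ := exists_analytic_implicit hG hG0 _ hbij (by
    have h1 : HasFDerivAt (fun a : Fin d → Hol (gauge (T := Torus d) β) ℝ =>
        N (frameL v a) - Hol.comp A L hL (frameL v a))
        (N' ∘L frameL v - Hol.comp A L hL ∘L frameL v) 0 :=
      (HasFDerivAt.comp 0 (by rw [hV0]; exact hN') (frameL v).hasFDerivAt).sub
        (Hol.comp A L hL ∘L frameL v).hasFDerivAt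
    have h2 : (fun a => G (0, a)) = fun a => N (frameL v a) - Hol.comp A L hL (frameL v a) := by
      funext a; simp [G]
    rw [h2]
    -- As Dg maps vₖ(ψ) to Λₖ(ψ) vₖ(A ψ), the linearisation is diagonal from the frame at ψ to the
    -- frame at A ψ.
    refine h1.congr_fderiv (ContinuousLinearMap.ext fun a => ?_)
    refine Hol.ext fun ψ => Eq.symm ?_
    change frameL _ _ ψ = N' (frameL v a) ψ - frameL v a (A ψ)
    rw [hN'a, frameL_apply, frameL_apply, frameL_apply, map_sum, ← Finset.sum_sub_distrib]
    refine Finset.sum_congr rfl fun k _ => ?_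
    change (Λ k ψ * a k ψ - 1 * a k (A ψ)) • v k (A ψ) = _
    rw [map_smul, heq, sub_smul, one_mul, mul_comm, mul_smul])
  have hh : AnalyticAt ℝ (fun ε => frameL v (a ε)) 0 := ((frameL v).analyticAt _).comp ha
  have hh0 : frameL v (a 0) = 0 := by rw [ha0, hV0]
  refine ⟨fun ε => frameL v (a ε), hh, hh0, ?_⟩
  have ht : Tendsto (fun ε => frameL v (a ε)) (𝓝 0) (𝓝 0) := by
    have := hh.continuousAt.tendsto; rwa [hh0] at this
  filter_upwards [hae, ht.eventually hNe, ht.eventually hNFe] with ε h1 h2 h3 ψ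
  have h4 : G (ε, a ε) ψ = N (frameL v (a ε)) ψ + ε • (F₀ ψ + NF (frameL v (a ε)) ψ) -
      frameL v (a ε) (A ψ) := rfl
  have h5 := hF₀ (rep ψ)
  rw [proj_rep] at h5
  rw [h1, Hol.zero_apply, h2, h3, h5, incr, incr, proj_add, proj_rep] at h4
  rw [← sub_eq_zero.1 h4.symm, incr, add_sub_cancel]

/-- Analytic continuation of an eigendirection. -/
theorem exists_analytic_eigen {M : ℝ → Hol (gauge (T := Torus d) β) (E d →L[ℝ] E d)}
    (hM : AnalyticAt ℝ M 0) (hc : 0 < c)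
    (hframe : ∀ ψ (a : Fin d → ℝ), c * ‖a‖ ≤ ‖∑ k, a k • v k ψ‖)
    (heq : ∀ i ψ, M 0 ψ (v i ψ) = Λ i ψ • v i (A ψ)) (i : Fin d)
    (hD : ∀ k, k ≠ i → Function.Bijective (Hol.twist A L hL (Λ k) (Λ i))) :
    ∃ (w : ℝ → Hol (gauge (T := Torus d) β) (E d)) (l : ℝ → Hol (gauge (T := Torus d) β) ℝ),
      AnalyticAt ℝ w 0 ∧ AnalyticAt ℝ l 0 ∧ w 0 = v i ∧ l 0 = Λ i ∧
      ∀ᶠ ε in 𝓝 0, ∀ ψ, M ε ψ (w ε ψ) = l ε ψ • w ε (A ψ) := by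
  classical
  -- The rescaling freedom of an eigenvector is removed by forbidding a correction along vᵢ, which
  -- is the role of `Function.update v i 0` below. The vacant slot i holds the correction of the
  -- eigenvalue.
  let D : Fin d → Hol (gauge (T := Torus d) β) ℝ →L[ℝ] Hol (gauge (T := Torus d) β) ℝ := fun k =>
    if k = i then -ContinuousLinearMap.id ℝ _ else Hol.twist A L hL (Λ k) (Λ i)
  have hDi : ∀ w ψ, D i w ψ = -w ψ := fun w ψ => by simp [D]
  have hDk : ∀ k, k ≠ i → D k = Hol.twist A L hL (Λ k) (Λ i) := fun k hk => if_neg hk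
  have hDbij : ∀ k, Function.Bijective (D k) := by
    intro k
    by_cases hk : k = i
    · simp only [D, if_pos hk]
      exact neg_bijective
    · rw [hDk k hk]
      exact hD k hk
  have hbij := frame_pi_bijective hL v hc hframe D hDbij
  have hlin : frameL (fun k => Hol.comp A L hL (v k)) ∘L
      (ContinuousLinearMap.pi fun k => D k ∘L ContinuousLinearMap.proj k) =
      Hol.applyL (M 0) ∘L frameL (Function.update v i 0) -
        Hol.smulL (Λ i) ∘L Hol.comp A L hL ∘L frameL (Function.update v i 0) -
        (Hol.smulL.flip (Hol.comp A L hL (v i))) ∘L ContinuousLinearMap.proj i := by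
    refine ContinuousLinearMap.ext fun a => ?_
    refine Hol.ext fun ψ => ?_
    change frameL (fun k => Hol.comp A L hL (v k)) (fun k => D k (a k)) ψ =
      M 0 ψ (frameL (Function.update v i 0) a ψ) -
        Λ i ψ • frameL (Function.update v i 0) a (A ψ) - a i ψ • v i (A ψ)
    have h4 : a i ψ • v i (A ψ) = ∑ k, if k = i then a i ψ • v i (A ψ) else 0 := by simp
    rw [frameL_apply, frameL_apply, frameL_apply, map_sum, Finset.smul_sum,
      ← Finset.sum_sub_distrib, h4, ← Finset.sum_sub_distrib]
    refine Finset.sum_congr rfl fun k _ => ?_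
    change D k (a k) ψ • v k (A ψ) = _
    by_cases hk : k = i
    · subst hk
      rw [hDi]
      simp
    · rw [hDk k hk, if_neg hk, Function.update_of_ne hk, Hol.twist_apply, map_smul, heq, sub_smul,
        sub_zero, mul_comm, mul_smul, mul_smul]
  rw [hlin] at hbij
  have hv : Hol.applyL (M 0) (v i) = Hol.smulL (Λ i) (Hol.comp A L hL (v i)) :=
    Hol.ext fun ψ => heq i ψ
  obtain ⟨a, ha, ha0, hae⟩ := exists_analytic_bilinear_zero Hol.applyL Hol.smulL _ _ _ hM hv hbij
  refine ⟨fun ε => v i + frameL (Function.update v i 0) (a ε), fun ε => Λ i + a ε i,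
    analyticAt_const.add (((frameL _).analyticAt _).comp ha),
    analyticAt_const.add (((ContinuousLinearMap.proj (R := ℝ)
      (φ := fun _ : Fin d => Hol (gauge (T := Torus d) β) ℝ) i).analyticAt _).comp ha), ?_, ?_, ?_⟩
  · simp only [ha0, map_zero, add_zero]
  · simp only [ha0, Pi.zero_apply, add_zero]
  · filter_upwards [hae] with ε hε ψ
    exact congrArg (fun f : Hol (gauge (T := Torus d) β) (E d) => f ψ) hε

end Continuation

/-! ### Choice of the exponent and assembly. -/

section Assembly

variable {d : ℕ}

theorem IsAnalyticField.exists_lipschitz {F : Torus d → E d} (hF : IsAnalyticField F) :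
    ∃ L : ℝ≥0, LipschitzWith L F := by
  have hper : ∀ x y : E d, proj x = proj y → F (proj x) = F (proj y) := fun x y h => by rw [h]
  obtain ⟨L, hL⟩ := exists_lipschitz_of_quasiPeriodic hF (.of_periodic hper)
  refine ⟨L, LipschitzWith.of_dist_le_mul fun ψ ψ' => ?_⟩
  have := norm_sub_rep_le (f := fun x => F (proj x)) (L := L) (fun x y => by
    simpa [dist_eq_norm] using hL.dist_le_mul x y) hper ψ ψ'
  simpa [proj_rep, dist_eq_norm] using this

/-- The differential of the perturbed map at a displaced point, in terms of lifts. -/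
theorem tderiv_perturbed {A : Equiv.Perm (Torus d)} {F : Torus d → E d} (hF : IsAnalyticField F)
    {g : E d → E d} (hg : AnalyticOnNhd ℝ g Set.univ) (hgA : ∀ x, proj (g x) = A (proj x)) (ε : ℝ)
    (ψ : Torus d) (u : E d) :
    tderiv (perturbed A F ε) (ψ + proj u) =
      fderiv ℝ g (rep ψ + u) + ε • fderiv ℝ (fun x => F (proj x)) (rep ψ + u) := by
  have hgd := AnalyticOnNhd.differentiable_univ hg
  have hFd := AnalyticOnNhd.differentiable_univ hF
  have h1 : ψ + proj u = proj (rep ψ + u) := by rw [proj_add, proj_rep]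
  rw [h1, tderiv_eq_of_lift (g := fun x => g x + ε • F (proj x))
    (fun x => by rw [proj_add, hgA, perturbed])
    (hgd.continuous.add (hFd.continuous.const_smul ε)).continuousAt]
  exact ((hgd _).hasFDerivAt.add ((hFd _).hasFDerivAt.const_smul ε)).fderiv

theorem eventually_isAnalyticHolder {V : Type*} [NormedAddCommGroup V] [NormedSpace ℝ V]
    {β' : ℝ≥0} {f : ℝ → Hol (gauge (T := Torus d) β') V} (hf : AnalyticAt ℝ f 0) :
    ∀ᶠ ε₀ in 𝓝[>] (0 : ℝ), ∀ β ≤ β', IsAnalyticHolder β ε₀ (fun ε ψ => f ε ψ) := by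
  obtain ⟨r, hr, h⟩ := exists_isAnalyticHolder f hf
  filter_upwards [Ioc_mem_nhdsGT hr] with ε₀ hε β hβ using h β hβ ε₀ hε.1 hε.2

theorem eventually_forall_abs_lt {p : ℝ → Prop} (hp : ∀ᶠ ε in 𝓝 (0 : ℝ), p ε) :
    ∀ᶠ ε₀ in 𝓝[>] (0 : ℝ), ∀ ε, |ε| < ε₀ → p ε := by
  obtain ⟨δ, hδ, h⟩ := Metric.eventually_nhds_iff.1 hp
  filter_upwards [Ioc_mem_nhdsGT hδ] with ε₀ hε₀ ε hε
  exact h (by simpa using hε.trans_le hε₀.2)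

/-- For a small exponent, all the cohomological operators that govern the perturbation theory
are invertible. -/
theorem exists_exponent {A : Equiv.Perm (Torus d)} {L L' : ℝ≥0} (hL : L ≠ 0) (hL' : L' ≠ 0)
    (hA : LipschitzWith L A) (hA' : LipschitzWith L' (⇑A⁻¹)) {Λ : Fin d → Torus d → ℝ}
    (hΛ : ∀ i, Continuous (Λ i)) (hΛ0 : ∀ i ψ, Λ i ψ ≠ 0) (hdom : IsDominated A Λ)
    (hrate : ∀ i, ∃ n : ℕ, (∀ ψ, |cocycle A (Λ i) n ψ| ≤ 1 / 2) ∨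
      ∀ ψ, |(cocycle A (Λ i) n ψ)⁻¹| ≤ 1 / 2) {β₀ : ℝ≥0} (hβ₀ : 0 < β₀) :
    ∃ β : ℝ≥0, 0 < β ∧ β ≤ β₀ ∧ ∀ Λb : Fin d → Hol (gauge (T := Torus d) β) ℝ,
      (∀ i ψ, Λb i ψ = Λ i ψ) →
      (∀ i, Function.Bijective (Hol.twist A (L ^ (β : ℝ)) (gauge_le_of_lipschitz β hA) (Λb i)
        (Hol.const 1))) ∧
      ∀ i k, k ≠ i → Function.Bijective
        (Hol.twist A (L ^ (β : ℝ)) (gauge_le_of_lipschitz β hA) (Λb k) (Λb i)) := by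
  have ev1 : ∀ i, ∀ᶠ β : ℝ≥0 in 𝓝[>] 0, ∀ a b : Hol (gauge (T := Torus d) β) ℝ,
      (∀ ψ, a ψ = Λ i ψ) → (∀ ψ, b ψ = 1) →
      Function.Bijective (Hol.twist A (L ^ (β : ℝ)) (gauge_le_of_lipschitz β hA) a b) := by
    intro i
    obtain ⟨n, hn⟩ := hrate i
    refine eventually_twist_bijective hL hL' hA hA' (hΛ i) continuous_const (hΛ0 i)
      (fun _ => one_ne_zero) n (κ := 1 / 2) (by norm_num) (by norm_num) ?_
    have h1 : ∀ ψ, cocycle A (fun _ => 1) n ψ = 1 := fun ψ => by simp [cocycle]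
    refine hn.symm.imp (fun h ψ => ?_) (fun h ψ => ?_)
    · have := h ψ
      rw [abs_inv, inv_le_iff_one_le_mul₀ (abs_pos.2 (cocycle_ne_zero (hΛ0 i) n ψ))] at this
      rwa [h1, abs_one]
    · rw [h1, abs_one, mul_one]; exact h ψ
  obtain ⟨N₀, hN⟩ := hdom.exists_lt hΛ0
  have ev2 : ∀ i k, ∀ᶠ β : ℝ≥0 in 𝓝[>] 0, k ≠ i → ∀ a b : Hol (gauge (T := Torus d) β) ℝ,
      (∀ ψ, a ψ = Λ k ψ) → (∀ ψ, b ψ = Λ i ψ) →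
      Function.Bijective (Hol.twist A (L ^ (β : ℝ)) (gauge_le_of_lipschitz β hA) a b) := by
    intro i k
    rw [eventually_imp_distrib_left]
    intro hki
    rcases lt_or_gt_of_ne hki with h | h
    · obtain ⟨κ, hκ0, hκ, hb⟩ := hN (N₀ + 1) (Nat.lt_succ_self _) k i h
      exact eventually_twist_bijective hL hL' hA hA' (hΛ k) (hΛ i) (hΛ0 k) (hΛ0 i) _ hκ0 hκ
        (Or.inr fun ψ => hb ψ ψ)
    · obtain ⟨κ, hκ0, hκ, hb⟩ := hN (N₀ + 1) (Nat.lt_succ_self _) i k h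
      exact eventually_twist_bijective hL hL' hA hA' (hΛ k) (hΛ i) (hΛ0 k) (hΛ0 i) _ hκ0 hκ
        (Or.inl fun ψ => hb ψ ψ)
  have ev3 : ∀ᶠ β : ℝ≥0 in 𝓝[>] 0, β ∈ Set.Ioc 0 β₀ := Ioc_mem_nhdsGT hβ₀
  obtain ⟨β, ⟨hβ0, hβ⟩, h1, h2⟩ := (ev3.and
    ((eventually_all.2 ev1).and (eventually_all.2 fun i => eventually_all.2 (ev2 i)))).exists
  exact ⟨β, hβ0, hβ, fun Λb hΛb => ⟨fun i => h1 i _ _ (hΛb i) fun _ => rfl,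
    fun i k hki => h2 i k hki _ _ (hΛb k) (hΛb i)⟩⟩

end Assembly

end ToralAnosov

end

open Filter Topology

/-- All equations are solved once, in the space of one small exponent β', which serves as the
threshold for β. Smaller exponents inherit the same power series, so neither the families nor the
radius in ε have to be changed with β. -/
theorem mainTheorem2 (d : ℕ)
    (A₀ : Equiv.Perm (Torus d)) (hA₀ : IsAnalyticAnosov A₀)
    (F : Torus d → E d) (hF : IsAnalyticField F)
    (v₀ : Fin d → Torus d → E d) (Λ : Fin d → Torus d → ℝ)
    (β₀ : ℝ≥0) (hβ₀ : 0 < β₀) (hβ₀' : β₀ < 1)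
    (hv₀ : ∀ i, IsHolder β₀ (v₀ i)) (hΛ : ∀ i, IsHolder β₀ (Λ i))
    (hbasis : ∀ ψ, LinearIndependent ℝ (fun i => v₀ i ψ))
    (heq : ∀ i ψ, tderiv A₀ ψ (v₀ i ψ) = Λ i ψ • v₀ i (A₀ ψ))
    (hord : IsDominated A₀ Λ) :
    ∃ (H : ℝ → Torus d → Torus d) (h : ℝ → Torus d → E d),
      (∀ ε ψ, H ε ψ = ψ + proj (h ε ψ)) ∧ (∀ ψ, h 0 ψ = 0) ∧
      ∃ βbar : ℝ≥0, 0 < βbar ∧ ∀ β : ℝ≥0, 0 < β → β < βbar →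
        ∃ εbar : ℝ, 0 < εbar ∧
          IsAnalyticHolder β εbar h ∧
          (∀ ε : ℝ, |ε| < εbar → IsHomeomorph (H ε) ∧
            ∀ ψ, H ε (A₀ ψ) = perturbed A₀ F ε (H ε ψ)) ∧
          ∃ (v : Fin d → ℝ → Torus d → E d) (L : Fin d → ℝ → Torus d → ℝ),
            (∀ i, IsAnalyticHolder β εbar (v i)) ∧
            (∀ i, IsAnalyticHolder β εbar (L i)) ∧
            (∀ i ψ, v i 0 ψ = v₀ i ψ) ∧ (∀ i ψ, L i 0 ψ = Λ i ψ) ∧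
            ∀ ε : ℝ, |ε| < εbar → ∀ ψ,
              LinearIndependent ℝ (fun i => v i ε ψ) ∧
              ∀ i, tderiv (perturbed A₀ F ε) (H ε ψ) (v i ε ψ) =
                L i ε ψ • v i ε (A₀ ψ) := by
  have hA := hA₀.analytic
  have hA' : IsAnalyticMap (A₀⁻¹ : Equiv.Perm (Torus d)) := hA₀.analytic_symm
  obtain ⟨Ws, Wu, hs⟩ := hA₀.splitting
  have hcont : ∀ {V : Type} [NormedAddCommGroup V] [NormedSpace ℝ V] {f : Torus d → V},
      IsHolder β₀ f → Continuous f := by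
    intro V _ _ f hf
    obtain ⟨g, hg⟩ := exists_hol_of_isHolder le_rfl hf
    rw [← show (g : Torus d → V) = f from funext hg]
    exact g.continuous hβ₀
  have hvc : ∀ i, Continuous (v₀ i) := fun i => hcont (hv₀ i)
  have hΛc : ∀ i, Continuous (Λ i) := fun i => hcont (hΛ i)
  have hΛ0 : ∀ i ψ, Λ i ψ ≠ 0 := fun i =>
    eigenvalue_ne_zero hA hA' (fun ψ => (hbasis ψ).ne_zero i) (heq i)
  have hrate := hs.exists_rate hA hA' hvc hbasis heq hord
  obtain ⟨LA, hLA⟩ := hA.exists_lipschitz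
  obtain ⟨LA', hLA'⟩ := hA'.exists_lipschitz
  obtain ⟨LF, hLF⟩ := hF.exists_lipschitz
  obtain ⟨c, hc, hframe⟩ := exists_frame_bound hvc hbasis
  obtain ⟨g, hg, hgA, hgper, hgt⟩ := hA.exists_lift
  have heqg : ∀ i ψ, fderiv ℝ g (rep ψ) (v₀ i ψ) = Λ i ψ • v₀ i (A₀ ψ) := fun i ψ => by
    rw [← hgt, proj_rep, heq]
  -- the exponent
  obtain ⟨β', hβ'0, hβ', hbij⟩ := exists_exponent (L := max LA 1) (L' := max LA' 1)
    (by positivity) (by positivity) (hLA.weaken (le_max_left _ _))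
    (hLA'.weaken (le_max_left _ _)) hΛc hΛ0 hord hrate hβ₀
  have hβ'1 : β' ≤ 1 := hβ'.trans hβ₀'.le
  choose vb hvb using fun i => exists_hol_of_isHolder hβ' (hv₀ i)
  choose Λb hΛb using fun i => exists_hol_of_isHolder hβ' (hΛ i)
  obtain ⟨hbij1, hbij2⟩ := hbij Λb hΛb
  have hframeb : ∀ ψ (a : Fin d → ℝ), c * ‖a‖ ≤ ‖∑ k, a k • vb k ψ‖ := fun ψ a => by
    simpa only [hvb] using hframe ψ a
  have heqb : ∀ i ψ, fderiv ℝ g (rep ψ) (vb i ψ) = Λb i ψ • vb i (A₀ ψ) := fun i ψ => by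
    rw [hvb, hvb, hΛb, heqg]
  -- the conjugacy
  obtain ⟨h, hh, hh0, hheq⟩ := exists_analytic_conjugacy _ vb Λb hβ'1 hg hgper hF hc hframeb
    heqb hbij1
  -- the differential along the conjugacy
  have hgper' : ∀ x y, proj x = proj y → fderiv ℝ g x = fderiv ℝ g y :=
    fun x y hxy => hgper.fderiv_eq hxy
  have hFper' : ∀ x y : E d, proj x = proj y →
      fderiv ℝ (fun z => F (proj z)) x = fderiv ℝ (fun z => F (proj z)) y := fun x y hxy =>
    (IsQuasiPeriodic.of_periodic fun x y h => by rw [h]).fderiv_eq hxy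
  obtain ⟨Φ, hΦ, hΦe⟩ := exists_analytic_along hβ'1 hg.fderiv hgper' hh hh0
  obtain ⟨Ψ, hΨ, hΨe⟩ := exists_analytic_along hβ'1 (AnalyticOnNhd.fderiv hF) hFper' hh hh0
  -- For small ε this curve is the differential of A_ε at H_ε(ψ), by `tderiv_perturbed`.
  have hM : AnalyticAt ℝ (fun ε : ℝ => Φ ε + ε • Ψ ε) 0 := hΦ.add (analyticAt_id.smul hΨ)
  have hM0 : ∀ i ψ, (Φ 0 + (0 : ℝ) • Ψ 0) ψ (vb i ψ) = Λb i ψ • vb i (A₀ ψ) := fun i ψ => by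
    rw [zero_smul, add_zero, hΦe.self_of_nhds, hh0, Hol.zero_apply, add_zero, heqb]
  -- the eigendirections
  choose w l hw hl hw0 hl0 hwl using fun i =>
    exists_analytic_eigen _ vb Λb hM hc hframeb hM0 i (hbij2 i)
  -- the homeomorphism property
  obtain ⟨r, hr, η, hη, hhomeo⟩ := exists_radius_isHomeomorph hLA.continuous hLA' hg hgper hgA hLF
    hvc hΛc hΛ0 hc hframe heqg (fun i => by
      obtain ⟨n, hn⟩ := hrate i
      refine ⟨n, hn.imp (fun h ψ => ?_) (fun h ψ => ?_)⟩
      · rw [← cocycle_eq_iterate]; exact h ψ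
      · rw [Finset.prod_inv_distrib, ← cocycle_eq_iterate]; exact h ψ)
  have hsmall : ∀ᶠ ε in 𝓝 (0 : ℝ), ‖h ε‖ < r := by
    have := hh.continuousAt.norm.tendsto
    rw [hh0, norm_zero] at this
    exact this.eventually_lt_const hr
  have hclose : ∀ᶠ ε in 𝓝 (0 : ℝ), ∑ k, ‖w k ε - vb k‖ < c := by
    have : ContinuousAt (fun ε => ∑ k, ‖w k ε - vb k‖) 0 :=
      tendsto_finsetSum _ fun k _ => ((hw k).continuousAt.sub continuousAt_const).norm
    refine this.tendsto.eventually_lt_const ?_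
    simpa [hw0] using hc
  have habs : ∀ᶠ ε in 𝓝 (0 : ℝ), |ε| < η :=
    (continuous_abs.tendsto (0 : ℝ)).eventually_lt_const (by simpa using hη)
  have hpos : ∀ᶠ ε₀ : ℝ in 𝓝[>] 0, 0 < ε₀ := self_mem_nhdsWithin
  obtain ⟨εbar, hε0, hevh, hevw, hevl, hev⟩ :=
    (hpos.and
    ((eventually_isAnalyticHolder hh).and
    ((eventually_all.2 fun i => eventually_isAnalyticHolder (hw i)).and
    ((eventually_all.2 fun i => eventually_isAnalyticHolder (hl i)).and
    (eventually_forall_abs_lt (hheq.and (hΦe.and (hΨe.and ((eventually_all.2 hwl).and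
      (hsmall.and (hclose.and habs))))))))))).exists
  refine ⟨fun ε ψ => ψ + proj (h ε ψ), fun ε ψ => h ε ψ, fun _ _ => rfl,
    fun ψ => by beta_reduce; rw [hh0, Hol.zero_apply], β', hβ'0,
    fun β _ hβ => ⟨εbar, hε0, hevh β hβ.le,
    fun ε hε => ?_, fun i ε ψ => w i ε ψ, fun i ε ψ => l i ε ψ, fun i => hevw i β hβ.le,
    fun i => hevl i β hβ.le, fun i ψ => by beta_reduce; rw [hw0, hvb],
    fun i ψ => by beta_reduce; rw [hl0, hΛb],
    fun ε hε ψ => ?_⟩⟩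
  · obtain ⟨h1, -, -, -, h5, -, h7⟩ := hev ε hε
    refine ⟨hhomeo ε h7 _ ((h ε).continuous hβ'0)
      (fun ψ => ((h ε).norm_apply_le ψ).trans h5.le) h1, fun ψ => ?_⟩
    beta_reduce
    rw [h1, perturbed, map_add_proj hgA, proj_add, add_assoc]
  · obtain ⟨-, h2, h3, h4, -, h6, -⟩ := hev ε hε
    refine ⟨linearIndependent_of_frame_bound (hframeb ψ) (lt_of_le_of_lt
      (Finset.sum_le_sum fun k _ => (w k ε - vb k).norm_apply_le ψ) h6), fun i => ?_⟩
    have h8 := h4 i ψ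
    rw [Hol.add_apply, Hol.smul_apply, h2, h3] at h8
    rw [tderiv_perturbed hF hg hgA, h8]
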